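/- **Lemma 3.4.** Let $n\ge 1$, $s\in(0,1)$ with $2s<n$, let $\Omega\subset\mathbb R^n$ be a bounded open set and $\Omega_e=\mathbb R^n\setminus\overline\Omega$. Let $\gamma:\mathbb R^n\to\mathbb R$ be measurable with $0<\underline\gamma\le\gamma(x)\le\overline\gamma<\infty$ for a.e. $x$, and suppose that $m:=\gamma^{1/2}-1$ belongs to $W^{2s,n/2s}_c(\Omega)$, the set of elements of $W^{2s,n/2s}(\mathbb R^n)$ that are limits in that space of functions in $C_c^\infty(\Omega)$. Let $(-\Delta)^s$ be the fractional Laplacian, with Fourier symbol $|\xi|^{2s}$, extended to a bounded map $W^{2s,n/2s}(\mathbb R^n)\to L^{n/2s}(\mathbb R^n)$ and to $H^s(\mathbb R^n)\to H^{-s}(\mathbb R^n)$, and put $q_\gamma:=-\gamma^{-1/2}(-\Delta)^s m$. All functions are real valued. Let $H^s=H^s(\mathbb R^n)$, let $\tilde H^s(\Omega)$ be the closure of $C_c^\infty(\Omega)$ in $H^s$, and let $X=H^s/\tilde H^s(\Omega)$, with classes $[f]$. For $u,v\in H^s$ put $$\nabla^s u(x,y)=-\frac{\mathcal C_{n,s}^{1/2}}{\sqrt2}\,\frac{u(y)-u(x)}{|y-x|^{n/2+s+1}}\,(y-x),\qquad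 \mathcal C_{n,s}=\frac{4^s\,\Gamma(n/2+s)}{\pi^{n/2}|\Gamma(-s)|},$$ $$B^s_\gamma[u,v]=\int_{\mathbb R^n}\int_{\mathbb R^n}\gamma(x)^{1/2}\gamma(y)^{1/2}\,\nabla^s v\cdot\nabla^s u\,dy\,dx,\qquad A_q[w,v]=\int_{\mathbb R^n}v\,(-\Delta)^s w\,dx+\int_\Omega q\,v\,w\,dx,$$ where the first integral in $A_q$ is the duality pairing of $H^{-s}$ and $H^s$. Then $(-\Delta)^s m\in L^{n/2s}(\mathbb R^n)$ is well defined, and the DN maps $\Lambda^s_\gamma,\Lambda_{q_\gamma}:X\to X^*$ are well defined by $$\Lambda^s_\gamma[f]([v])=B^s_\gamma[u_f,v],\qquad \Lambda_{q_\gamma}[f]([v])=A_{q_\gamma}[w_f,v]\qquad(f,v\in H^s),$$ where $u_f\in H^s$ is the unique function with $u_f-f\in\tilde H^s(\Omega)$ and $B^s_\gamma[u_f,\varphi]=0$ for all $\varphi\in\tilde H^s(\Omega)$ (the weak solution of the conductivity equation in $\Omega$ with exterior value $f$), and $w_f\in H^s$ is the unique function with $w_f-f\in\tilde H^s(\Omega)$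 and $A_{q_\gamma}[w_f,\varphi]=0$ for all $\varphi\in\tilde H^s(\Omega)$ (the weak solution of $((-\Delta)^s+q_\gamma)w=0$ in $\Omega$ with exterior value $f$). Moreover, if $f,v\in H^s$ satisfy $\operatorname{supp}f\subset\Omega_e$ and $\operatorname{supp}v\subset\Omega_e$, then $f\,v\,(-\Delta)^s m$ is integrable on $\Omega_e$ and $$\Lambda_{q_\gamma}[f]([v])-\Lambda^s_\gamma[f]([v])=\int_{\Omega_e}f\,v\,(-\Delta)^s m\,dx .$$ -/

import Mathlib

open MeasureTheory FourierTransform Topology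
open scoped ENNReal NNReal ContDiff SchwartzMap

noncomputable section

namespace FracCalderon

/-- Euclidean space `ℝⁿ`. -/
abbrev Sp (n : ℕ) : Type := EuclideanSpace ℝ (Fin n)

/-- `ψ ∈ C^∞_c(Ω)` (real valued). -/
def IsTestFunction {n : ℕ} (Ω : Set (Sp n)) (ψ : Sp n → ℝ) : Prop :=
  ContDiff ℝ ∞ ψ ∧ HasCompactSupport ψ ∧ tsupport ψ ⊆ Ω

/-! ### The space `H^s(ℝⁿ)`

Mathlib's Fourier transform is `û(ξ) = ∫ e^{-2πi x·ξ} u(x) dx`. So the frequency variable of the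
convention `∫ e^{-i x·ξ} u(x) dx` is `2πξ`, and Plancherel's identity holds without a constant. -/

/-- The Fourier transform in `L²` of a real-valued `u ∈ L²(ℝⁿ)`. -/
def fourierL2 {n : ℕ} : Lp ℝ 2 (volume : Measure (Sp n)) →ₗ[ℝ] Lp ℂ 2 (volume : Measure (Sp n)) :=
  ((Lp.fourierTransformₗᵢ (Sp n) ℂ).toLinearEquiv.toLinearMap.restrictScalars ℝ).comp
    (Complex.ofRealCLM.compLpₗ 2 volume)

/-- The weight `⟨2πξ⟩^s = (1 + |2πξ|²)^{s/2}`. -/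
def weight {n : ℕ} (s : ℝ) (ξ : Sp n) : ℂ :=
  (((1 + (2 * Real.pi * ‖ξ‖) ^ 2) ^ (s / 2) : ℝ) : ℂ)

/-- `H^s(ℝⁿ)`, real valued, as a set of `L²` functions: `⟨2πξ⟩^s û ∈ L²`. -/
def hsSubmodule (n : ℕ) (s : ℝ) : Submodule ℝ (Lp ℝ 2 (volume : Measure (Sp n))) where
  carrier := {u | MemLp (fun ξ => weight s ξ * fourierL2 u ξ) 2 volume}
  zero_mem' := by
    refine (memLp_congr_ae (g := 0) ?_).2 MemLp.zero
    rw [map_zero]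
    filter_upwards [Lp.coeFn_zero ℂ 2 (volume : Measure (Sp n))] with ξ h
    simp only [h, Pi.zero_apply, mul_zero]
  add_mem' := by
    intro u v hu hv
    refine (memLp_congr_ae ?_).2 (MemLp.add hu hv)
    rw [map_add]
    filter_upwards [Lp.coeFn_add (fourierL2 u) (fourierL2 v)] with ξ h
    rw [h, Pi.add_apply, mul_add, Pi.add_apply]
  smul_mem' := by
    intro c u hu
    refine (memLp_congr_ae ?_).2 (MemLp.const_smul hu c)
    rw [map_smul]
    filter_upwards [Lp.coeFn_smul c (fourierL2 u)] with ξ h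
    rw [h, Pi.smul_apply, mul_smul_comm, Pi.smul_apply]

/-- The Sobolev space `H^s(ℝⁿ)` (for `s ≥ 0`), a type of its own: it carries the `H^s` norm below,
not the norm of `L²`. -/
def Hs (n : ℕ) (s : ℝ) : Type := hsSubmodule n s

instance (n : ℕ) (s : ℝ) : AddCommGroup (Hs n s) := inferInstanceAs (AddCommGroup (hsSubmodule n s))

instance (n : ℕ) (s : ℝ) : Module ℝ (Hs n s) := inferInstanceAs (Module ℝ (hsSubmodule n s))

/-- The inclusion `H^s(ℝⁿ) ⊆ L²(ℝⁿ)`. -/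
def Hs.toL2 {n : ℕ} {s : ℝ} : Hs n s →ₗ[ℝ] Lp ℝ 2 (volume : Measure (Sp n)) :=
  (hsSubmodule n s).subtype

/-- An element of `H^s(ℝⁿ)` as a function (a representative of its class). -/
instance (n : ℕ) (s : ℝ) : CoeFun (Hs n s) (fun _ => Sp n → ℝ) where
  coe u := (Hs.toL2 u : Sp n → ℝ)

/-- The Fourier transform of `u ∈ H^s(ℝⁿ)`. -/
def Hs.fourier {n : ℕ} {s : ℝ} (u : Hs n s) : Lp ℂ 2 (volume : Measure (Sp n)) :=
  fourierL2 (Hs.toL2 u)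

theorem Hs.memLp {n : ℕ} {s : ℝ} (u : Hs n s) :
    MemLp (fun ξ => weight s ξ * Hs.fourier u ξ) 2 volume :=
  Subtype.property (p := fun u => u ∈ hsSubmodule n s) u

/-- The map `u ↦ ⟨2πξ⟩^s û` from `H^s` to `L²`. -/
def Hs.weightedFourier {n : ℕ} {s : ℝ} : Hs n s →ₗ[ℝ] Lp ℂ 2 (volume : Measure (Sp n)) where
  toFun u := (Hs.memLp u).toLp
  map_add' u v := by
    rw [← MemLp.toLp_add (Hs.memLp u) (Hs.memLp v), MemLp.toLp_eq_toLp_iff]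
    unfold Hs.fourier
    rw [map_add, map_add]
    filter_upwards [Lp.coeFn_add (fourierL2 (Hs.toL2 u)) (fourierL2 (Hs.toL2 v))] with ξ h
    rw [h, Pi.add_apply, mul_add, Pi.add_apply]
  map_smul' c u := by
    rw [RingHom.id_apply, ← MemLp.toLp_const_smul c (Hs.memLp u), MemLp.toLp_eq_toLp_iff]
    unfold Hs.fourier
    rw [map_smul, map_smul]
    filter_upwards [Lp.coeFn_smul c (fourierL2 (Hs.toL2 u))] with ξ h
    rw [h, Pi.smul_apply, mul_smul_comm, Pi.smul_apply]

theorem fourierL2_injective {n : ℕ} : Function.Injective (fourierL2 (n := n)) := by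
  intro u v h
  have h' : Complex.ofRealCLM.compLp u = Complex.ofRealCLM.compLp v :=
    (Lp.fourierTransformₗᵢ (Sp n) ℂ).injective h
  apply Lp.ext
  filter_upwards [Complex.ofRealCLM.coeFn_compLp u, Complex.ofRealCLM.coeFn_compLp v] with x hu hv
  rw [h', hv] at hu
  simpa using hu.symm

theorem Hs.toL2_injective {n : ℕ} {s : ℝ} : Function.Injective (Hs.toL2 (n := n) (s := s)) :=
  Subtype.val_injective

theorem Hs.weightedFourier_injective {n : ℕ} {s : ℝ} :
    Function.Injective (Hs.weightedFourier (n := n) (s := s)) := by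
  intro u v h
  apply Hs.toL2_injective
  apply fourierL2_injective
  apply Lp.ext
  have h' := (MemLp.toLp_eq_toLp_iff (Hs.memLp u) (Hs.memLp v)).1 h
  filter_upwards [h'] with ξ hξ
  refine mul_left_cancel₀ ?_ hξ
  have : (0 : ℝ) < (1 + (2 * Real.pi * ‖ξ‖) ^ 2) ^ (s / 2) := by positivity
  simpa [weight] using this.ne'

/-- `H^s(ℝⁿ)` with its norm `‖u‖_{H^s} = ‖⟨2πξ⟩^s û‖_{L²}`. -/
instance (n : ℕ) (s : ℝ) : NormedAddCommGroup (Hs n s) :=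
  NormedAddCommGroup.induced (Hs n s) (Lp ℂ 2 (volume : Measure (Sp n))) Hs.weightedFourier
    Hs.weightedFourier_injective

instance (n : ℕ) (s : ℝ) : NormedSpace ℝ (Hs n s) :=
  NormedSpace.induced ℝ (Hs n s) (Lp ℂ 2 (volume : Measure (Sp n))) Hs.weightedFourier

/-- The classes of functions in `C^∞_c(Ω)`, as a subspace of `H^s(ℝⁿ)`. -/
def testSubmodule {n : ℕ} (s : ℝ) (Ω : Set (Sp n)) : Submodule ℝ (Hs n s) where
  carrier := {φ | ∃ ψ : Sp n → ℝ, IsTestFunction Ω ψ ∧ φ =ᵐ[volume] ψ}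
  zero_mem' := by
    refine ⟨0, ⟨contDiff_const, HasCompactSupport.zero, by simp⟩, ?_⟩
    rw [map_zero]
    exact Lp.coeFn_zero ℝ 2 volume
  add_mem' := by
    rintro φ φ' ⟨ψ, ⟨h1, h2, h3⟩, h⟩ ⟨ψ', ⟨h1', h2', h3'⟩, h'⟩
    refine ⟨ψ + ψ', ⟨h1.add h1', h2.add h2', ?_⟩, ?_⟩
    · exact (tsupport_add ψ ψ').trans (Set.union_subset h3 h3')
    · rw [map_add]
      exact (Lp.coeFn_add _ _).trans (h.add h')
  smul_mem' := by
    rintro c φ ⟨ψ, ⟨h1, h2, h3⟩, h⟩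
    refine ⟨c • ψ, ⟨h1.const_smul c, h2.smul_left (f := fun _ => c), ?_⟩, ?_⟩
    · exact (tsupport_smul_subset_right (fun _ => c) ψ).trans h3
    · rw [map_smul]
      exact (Lp.coeFn_smul c _).trans (h.const_smul c)

/-- `H̃^s(Ω)`: the closure of `C^∞_c(Ω)` in `H^s(ℝⁿ)`. -/
def Htilde {n : ℕ} (s : ℝ) (Ω : Set (Sp n)) : Submodule ℝ (Hs n s) :=
  (testSubmodule s Ω).topologicalClosure

/-- The abstract trace space `X = H^s(ℝⁿ) / H̃^s(Ω)`. -/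
abbrev TraceSpace {n : ℕ} (s : ℝ) (Ω : Set (Sp n)) : Type := Hs n s ⧸ Htilde s Ω

/-- The class `[f] ∈ X` of `f ∈ H^s(ℝⁿ)`. -/
def trace {n : ℕ} (s : ℝ) (Ω : Set (Sp n)) (f : Hs n s) : TraceSpace s Ω :=
  (Htilde s Ω).mkQ f

/-- The exterior domain `Ω_e = ℝⁿ \ closure Ω`. -/
def exterior {n : ℕ} (Ω : Set (Sp n)) : Set (Sp n) := (closure Ω)ᶜ

/-- The support of a measurable function up to null sets: the complement of the largest open set on
which it vanishes almost everywhere. -/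
def aeSupport {n : ℕ} (f : Sp n → ℝ) : Set (Sp n) :=
  {x | ∀ U ∈ 𝓝 x, ¬ ∀ᵐ y ∂(volume : Measure (Sp n)), y ∈ U → f y = 0}

/-! ### The space `W^{k,p}_c(Ω)` -/

/-- `m ∈ W^{k,p}_c(Ω)`, `k ≥ 0`: `m` belongs to the Bessel potential space `W^{k,p}(ℝⁿ)` and is
the limit in it of functions in `C^∞_c(Ω)`. Mathlib's `besselPotential` has the symbol
`(1 + |ξ|²)^{k/2}` in the frequency variable of Mathlib; `‖besselPotential k ·‖_{L^p}` is one of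
the equivalent norms of `W^{k,p}(ℝⁿ)`. -/
def MemSobolevC {n : ℕ} (k : ℝ) (p : ℝ≥0∞) (Ω : Set (Sp n)) (m : Sp n → ℝ) : Prop :=
  ∃ (_ : Fact (1 ≤ p)) (M : Lp ℂ p (volume : Measure (Sp n))),
    (M =ᵐ[volume] fun x => (m x : ℂ)) ∧
    TemperedDistribution.MemSobolev k p (Lp.toTemperedDistribution M) ∧
    ∀ ε > (0 : ℝ), ∃ (ψ : Sp n → ℝ) (N g : Lp ℂ p (volume : Measure (Sp n))),
      IsTestFunction Ω ψ ∧ (N =ᵐ[volume] fun x => (ψ x : ℂ)) ∧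
      TemperedDistribution.besselPotential (Sp n) ℂ k (Lp.toTemperedDistribution (M - N))
        = Lp.toTemperedDistribution g ∧
      ‖g‖ < ε

/-! ### The fractional Laplacian -/

/-- The fractional Laplacian of a Schwartz function, by its Fourier symbol `|2πξ|^{2s}`. -/
def fracLaplacianSchwartz {n : ℕ} (s : ℝ) (φ : 𝓢(Sp n, ℂ)) : Sp n → ℂ :=
  𝓕⁻ (fun ξ : Sp n => (((2 * Real.pi * ‖ξ‖) ^ (2 * s) : ℝ) : ℂ) * (𝓕 φ) ξ)

/-- `g ∈ L^p` is the fractional Laplacian of `m ∈ W^{2s,p}`: `⟨g, φ⟩ = ⟨m, (-Δ)^s φ⟩` for all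
Schwartz functions `φ`. This is the value at `m` of the bounded extension
`(-Δ)^s : W^{2s,p} → L^p`, and it determines `g` almost everywhere. -/
def IsFracLaplacian {n : ℕ} (s : ℝ) (p : ℝ≥0∞) (m g : Sp n → ℝ) : Prop :=
  MemLp g p volume ∧
    ∀ φ : 𝓢(Sp n, ℂ), ∫ x, (g x : ℂ) * φ x = ∫ x, (m x : ℂ) * fracLaplacianSchwartz s φ x

/-- `(-Δ)^s m ∈ L^p`. -/
def fracLaplacian {n : ℕ} (s : ℝ) (p : ℝ≥0∞) (m : Sp n → ℝ) : Sp n → ℝ :=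
  Classical.epsilon (IsFracLaplacian s p m)

/-- The pairing `∫ v (-Δ)^s w dx` of `(-Δ)^s w ∈ H^{-s}` with `v ∈ H^s`, for `w ∈ H^s`. -/
def fracLaplacianPairing {n : ℕ} {s : ℝ} (w v : Hs n s) : ℝ :=
  (∫ ξ, (((2 * Real.pi * ‖ξ‖) ^ (2 * s) : ℝ) : ℂ) * Hs.fourier w ξ *
    (starRingEnd ℂ) (Hs.fourier v ξ)).re

/-! ### The conductivity equation -/

/-- The constant `C_{n,s} = 4^s Γ(n/2 + s) / (π^{n/2} |Γ(-s)|)`. -/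
def fracConst (n : ℕ) (s : ℝ) : ℝ :=
  (4 : ℝ) ^ s * Real.Gamma (n / 2 + s) / (Real.pi ^ ((n : ℝ) / 2) * |Real.Gamma (-s)|)

/-- The fractional gradient `∇^s u(x,y) = -(C^{1/2}/√2) (u(y)-u(x)) / |y-x|^{n/2+s+1} (y-x)`. -/
def fracGrad {n : ℕ} (s : ℝ) (u : Sp n → ℝ) (x y : Sp n) : Sp n :=
  (-(Real.sqrt (fracConst n s) / Real.sqrt 2) *
    ((u y - u x) / ‖y - x‖ ^ ((n : ℝ) / 2 + s + 1))) • (y - x)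

/-- The bilinear form `B_γ[u,v] = ∫∫ ∇^s v · (Θ · ∇^s u) dy dx`, where
`Θ(x,y) = γ(x)^{1/2} γ(y)^{1/2} Id`. -/
def condForm {n : ℕ} {s : ℝ} (γ : Sp n → ℝ) (u v : Hs n s) : ℝ :=
  ∫ x, ∫ y, inner ℝ (fracGrad s v x y)
    ((Real.sqrt (γ x) * Real.sqrt (γ y)) • fracGrad s u x y)

/-- `u` solves the conductivity equation `(∇·)^s(Θ·∇^s u) = 0` in `Ω` (weakly, tested with
`H̃^s(Ω)`), with exterior value `f`: `u - f ∈ H̃^s(Ω)`. -/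
def IsCondSolution {n : ℕ} {s : ℝ} (γ : Sp n → ℝ) (Ω : Set (Sp n)) (f u : Hs n s) : Prop :=
  u - f ∈ Htilde s Ω ∧ ∀ φ ∈ Htilde s Ω, condForm γ u φ = 0

/-- `Λ : X → X^*` is the DN map of the conductivity equation: for every `f` there is a unique
solution `u_f`, and `Λ[f]([g]) = B_γ[u_f, g]` for all `g`. -/
def IsCondDN {n : ℕ} {s : ℝ} (γ : Sp n → ℝ) (Ω : Set (Sp n))
    (Λ : TraceSpace s Ω → TraceSpace s Ω →L[ℝ] ℝ) : Prop :=
  ∀ f : Hs n s, ∃ u : Hs n s, (∀ u', IsCondSolution γ Ω f u' ↔ u' = u) ∧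
    ∀ g : Hs n s, Λ (trace s Ω f) (trace s Ω g) = condForm γ u g

/-- The DN map `Λ_γ^s : X → X^*` of the conductivity equation. -/
def condDN {n : ℕ} (s : ℝ) (γ : Sp n → ℝ) (Ω : Set (Sp n)) :
    TraceSpace s Ω → TraceSpace s Ω →L[ℝ] ℝ :=
  Classical.epsilon (IsCondDN γ Ω)

/-! ### The Schrödinger equation -/

/-- The form `∫_{ℝⁿ} v (-Δ)^s w dx + ∫_Ω q v w dx`. -/
def schrForm {n : ℕ} {s : ℝ} (q : Sp n → ℝ) (Ω : Set (Sp n)) (w v : Hs n s) : ℝ :=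
  fracLaplacianPairing w v + ∫ x in Ω, q x * v x * w x

/-- `w` solves `(-Δ)^s w + q w = 0` in `Ω` (weakly, tested with `H̃^s(Ω)`), with exterior value `f`:
`w - f ∈ H̃^s(Ω)`. -/
def IsSchrSolution {n : ℕ} {s : ℝ} (q : Sp n → ℝ) (Ω : Set (Sp n)) (f w : Hs n s) : Prop :=
  w - f ∈ Htilde s Ω ∧ ∀ φ ∈ Htilde s Ω, schrForm q Ω w φ = 0

/-- `Λ : X → X^*` is the DN map of the Schrödinger equation: for every `f` there is a unique
solution `w_f`, and `Λ[f]([v]) = ∫ v (-Δ)^s w_f dx + ∫_Ω q v w_f dx` for all `v`. -/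
def IsSchrDN {n : ℕ} {s : ℝ} (q : Sp n → ℝ) (Ω : Set (Sp n))
    (Λ : TraceSpace s Ω → TraceSpace s Ω →L[ℝ] ℝ) : Prop :=
  ∀ f : Hs n s, ∃ w : Hs n s, (∀ w', IsSchrSolution q Ω f w' ↔ w' = w) ∧
    ∀ v : Hs n s, Λ (trace s Ω f) (trace s Ω v) = schrForm q Ω w v

/-- The DN map `Λ_q : X → X^*` of the Schrödinger equation. -/
def schrDN {n : ℕ} (s : ℝ) (q : Sp n → ℝ) (Ω : Set (Sp n)) :
    TraceSpace s Ω → TraceSpace s Ω →L[ℝ] ℝ :=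
  Classical.epsilon (IsSchrDN q Ω)

/-- The exponent `n / (2s)`. -/
def critExp (n : ℕ) (s : ℝ) : ℝ≥0∞ := ENNReal.ofReal ((n : ℝ) / (2 * s))

/-- `m = γ^{1/2} - 1`. -/
def mOf {n : ℕ} (γ : Sp n → ℝ) (x : Sp n) : ℝ := Real.sqrt (γ x) - 1

/-- `(-Δ)^s m ∈ L^{n/2s}` for `m = γ^{1/2} - 1`. -/
def fracLaplacianM {n : ℕ} (s : ℝ) (γ : Sp n → ℝ) : Sp n → ℝ :=
  fracLaplacian s (critExp n s) (mOf γ)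

/-- The potential `q_γ = -(-Δ)^s m / γ^{1/2}`. -/
def potential {n : ℕ} (s : ℝ) (γ : Sp n → ℝ) (x : Sp n) : ℝ :=
  -(fracLaplacianM s γ x) / Real.sqrt (γ x)

end FracCalderon

end

open FracCalderon

noncomputable section

namespace FracCalderon

variable {n : ℕ} {s : ℝ}

/-! ### Subordination formulas and the constant -/

/-! Write a = γ^{1/2} = 1 + m and Du(x,y) = (u(y) - u(x)) |y - x|^{-(n/2+s)}. Everything rests on
the pointwise identity D(au) D(av) = a(x) a(y) Du Dv + Da D(auv) (`diffq_mul_mul`). Integrated with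
the factor C_{n,s}/2 it becomes the Liouville reduction ⟨(-Δ)^s(au), av⟩ = B_γ[u,v] + ∫ (-Δ)^s m · a
u v (`IsApprox.pairing_eq`). So if u solves the conductivity equation, then w = au solves the
Schrödinger equation with potential q_γ (`IsApprox.schrForm_eq_zero`). If f is supported in the
exterior, then af = f, because f vanishes on the closure of Ω and m vanishes off it; hence w = w_f
by uniqueness. For v supported in the exterior, av = v and the potential term of A_q[w,v] vanishes,
so the reduction gives A_q[w,v] - B_γ[u,v] = ∫ (-Δ)^s m · u v, and u = f outside Ω.

The forms must match with the exact constant. Plancherel, together with the value of ∫ (1 -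
cos(2πz·ξ)) |z|^{-n-2s} dz found by writing the power as a mixture of Gaussians, identifies the
pairing of H^{-s} and H^s with (C_{n,s}/2) ∫∫ Dw Dv (`lintegral_diffq_eq`, `Hs.pairing_eq`).

The difficulty is the low regularity of m. That (-Δ)^s m lies in L^{n/2s} follows from |ξ|^{2s} =
(1+|ξ|²)^s - μ̂(ξ) with μ a probability measure (`mixGauss`): the first symbol is a Bessel
potential, the second a convolution bounded on every L^p. Since averaging commutes with (-Δ)^s,
mollifying m gives smooth M_k with the same bounds as m and with (-Δ)^s M_k → (-Δ)^s m in L^{n/2s}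
(`exists_isApprox`). The reduction holds for smooth coefficients (`liouville_smooth`). Read with u =
v it controls the energy of M_k u by quantities that converge, thanks to Hölder and the Sobolev
embedding H^s ⊂ L^{2n/(n-2s)} (`exists_sobolev`, `exists_holder`). Hence multiplication by m is
bounded on H^s and is the strong limit of multiplication by M_k (`IsApprox.isHs_mul_and_le`,
`IsApprox.tendsto_mul`).

Both Dirichlet problems are solved by Lax–Milgram on H̃^s(Ω) (`exists_dn_of_coercive`). The
conductivity form is coercive by ellipticity and the fractional Poincaré inequality. The potential
q_γ has no sign, so coercivity of A_q comes from the reduction again: the substitution φ = (1 +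
M_k)u turns it into the conductivity form, with constants uniform in k (`IsApprox.exists_coercive`).
Division is only ever by the smooth functions 1 + M_k, so that test functions stay test functions.
-/

theorem setLIntegral_rpow_sub_one {s R : ℝ} (hs : 0 < s) (hR : 0 ≤ R) :
    ∫⁻ t in Set.Ioo 0 R, ENNReal.ofReal (t ^ (s - 1)) = ENNReal.ofReal (R ^ s / s) := by
  have h := intervalIntegral.intervalIntegrable_rpow' (a := 0) (b := R) (r := s - 1) (by linarith)
  rw [intervalIntegrable_iff_integrableOn_Ioo_of_le hR] at h
  rw [← ofReal_integral_eq_lintegral_ofReal h, ← integral_Ioc_eq_integral_Ioo,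
    ← intervalIntegral.integral_of_le hR, integral_rpow (Or.inl (by linarith))]
  · simp [hs.ne']
  · filter_upwards [ae_restrict_mem measurableSet_Ioo] with t ht
    exact Real.rpow_nonneg ht.1.le _

theorem setLIntegral_mul_exp_neg {l R : ℝ} (hl : 0 ≤ l) (hR : 0 ≤ R) :
    ∫⁻ r in Set.Ioo 0 R, ENNReal.ofReal (l * Real.exp (-(l * r)))
      = ENNReal.ofReal (1 - Real.exp (-(l * R))) := by
  have hc : Continuous fun r : ℝ => l * Real.exp (-(l * r)) := by fun_prop
  have h : IntegrableOn (fun r : ℝ => l * Real.exp (-(l * r))) (Set.Ioo 0 R) :=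
    (hc.integrableOn_Icc (a := 0) (b := R)).mono_set Set.Ioo_subset_Icc_self
  rw [← ofReal_integral_eq_lintegral_ofReal h, ← integral_Ioc_eq_integral_Ioo,
    ← intervalIntegral.integral_of_le hR,
    intervalIntegral.integral_eq_sub_of_hasDerivAt (f := fun r => - Real.exp (-(l * r)))
      (fun x _ => ?_) (hc.intervalIntegrable _ _)]
  · simp only [mul_zero, neg_zero, Real.exp_zero]; congr 1; ring
  · have : HasDerivAt (fun r : ℝ => -(l * r)) (-l) x := by
      have h := ((hasDerivAt_id x).const_mul l).neg
      rw [mul_one] at h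
      exact h
    exact this.exp.neg.congr_deriv (by ring)
  · exact Filter.Eventually.of_forall fun r => by positivity

theorem lintegral_ofReal_rpow_mul_exp {a r : ℝ} (ha : 0 < a) (hr : 0 < r) :
    ∫⁻ t in Set.Ioi (0 : ℝ), ENNReal.ofReal (t ^ (a - 1) * Real.exp (-(r * t)))
      = ENNReal.ofReal ((1 / r) ^ a * Real.Gamma a) := by
  have hint : IntegrableOn (fun t : ℝ => t ^ (a - 1) * Real.exp (-(r * t))) (Set.Ioi 0) := by
    by_contra hn
    have h := integral_undef hn
    rw [Real.integral_rpow_mul_exp_neg_mul_Ioi ha hr] at h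
    have : 0 < (1 / r) ^ a * Real.Gamma a := mul_pos (by positivity) (Real.Gamma_pos_of_pos ha)
    linarith
  rw [← ofReal_integral_eq_lintegral_ofReal hint, Real.integral_rpow_mul_exp_neg_mul_Ioi ha hr]
  filter_upwards [ae_restrict_mem measurableSet_Ioi] with t ht
  have : (0 : ℝ) < t := ht
  positivity

/-- Write 1 - e^{-l/t} as the integral of l e^{-lr} over 0 < r < 1/t and apply Tonelli on the region
tr < 1; what remains is a Gamma integral with exponent 1 - s. The formula is used twice: for the
value of C_{n,s}, and to build the measure `mixTime`. -/
theorem lintegral_rpow_mul_one_sub_exp {s l : ℝ} (hs0 : 0 < s) (hs1 : s < 1) (hl : 0 ≤ l) :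
    ∫⁻ t in Set.Ioi (0 : ℝ), ENNReal.ofReal (t ^ (s - 1) * (1 - Real.exp (-(l / t))))
      = ENNReal.ofReal (l ^ s * (Real.Gamma (1 - s) / s)) := by
  rcases hl.eq_or_lt with rfl | hl'
  · simp [Real.zero_rpow hs0.ne']
  let F : ℝ → ℝ → ℝ≥0∞ := fun t r =>
    {p : ℝ × ℝ | p.1 * p.2 < 1}.indicator
      (fun p => ENNReal.ofReal (p.1 ^ (s - 1)) * ENNReal.ofReal (l * Real.exp (-(l * p.2)))) (t, r)
  have hset : MeasurableSet {p : ℝ × ℝ | p.1 * p.2 < 1} :=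
    measurableSet_lt (by fun_prop) (by fun_prop)
  have hF : Measurable (Function.uncurry F) := by
    refine Measurable.indicator ?_ hset
    fun_prop
  have h1 : ∀ t ∈ Set.Ioi (0 : ℝ), ENNReal.ofReal (t ^ (s - 1) * (1 - Real.exp (-(l / t))))
      = ∫⁻ r in Set.Ioi (0 : ℝ), F t r := by
    intro t ht
    have ht : (0 : ℝ) < t := ht
    have : ∀ r, F t r = (Set.Iio (1 / t)).indicator
        (fun r => ENNReal.ofReal (t ^ (s - 1)) * ENNReal.ofReal (l * Real.exp (-(l * r)))) r := by
      intro r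
      simp only [F, Set.indicator, Set.mem_ofPred_eq, Set.mem_Iio, lt_div_iff₀ ht, mul_comm]
    simp_rw [this]
    rw [lintegral_indicator measurableSet_Iio, Measure.restrict_restrict measurableSet_Iio,
      Set.inter_comm, Set.Ioi_inter_Iio, lintegral_const_mul _ (by fun_prop),
      setLIntegral_mul_exp_neg hl (by positivity), ← ENNReal.ofReal_mul (by positivity)]
    congr 4
    ring
  have h2 : ∀ r ∈ Set.Ioi (0 : ℝ), ∫⁻ t in Set.Ioi (0 : ℝ), F t r
      = ENNReal.ofReal (l / s) *
        ENNReal.ofReal (r ^ ((1 - s) - 1) * Real.exp (-(l * r))) := by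
    intro r hr
    have hr : (0 : ℝ) < r := hr
    have : ∀ t, F t r = (Set.Iio (1 / r)).indicator
        (fun t => ENNReal.ofReal (t ^ (s - 1)) * ENNReal.ofReal (l * Real.exp (-(l * r)))) t := by
      intro t
      simp only [F, Set.indicator, Set.mem_ofPred_eq, Set.mem_Iio, lt_div_iff₀ hr]
    simp_rw [this]
    rw [lintegral_indicator measurableSet_Iio, Measure.restrict_restrict measurableSet_Iio,
      Set.inter_comm, Set.Ioi_inter_Iio, lintegral_mul_const _ (by fun_prop),
      setLIntegral_rpow_sub_one hs0 (by positivity), ← ENNReal.ofReal_mul (by positivity),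
      ← ENNReal.ofReal_mul (by positivity)]
    congr 1
    rw [one_div, Real.inv_rpow hr.le, show (1 - s) - 1 = -s by ring, Real.rpow_neg hr.le]
    ring
  rw [setLIntegral_congr_fun measurableSet_Ioi h1,
    lintegral_lintegral_swap hF.aemeasurable, setLIntegral_congr_fun measurableSet_Ioi h2,
    lintegral_const_mul' _ _ ENNReal.ofReal_ne_top,
    lintegral_ofReal_rpow_mul_exp (by linarith) hl', ← ENNReal.ofReal_mul (by positivity)]
  congr 1
  rw [one_div, Real.inv_rpow hl, Real.rpow_sub hl', Real.rpow_one]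
  have := (Real.rpow_pos_of_pos hl' s).ne'
  field_simp

theorem abs_Gamma_neg {s : ℝ} (hs0 : 0 < s) (hs1 : s < 1) :
    |Real.Gamma (-s)| = Real.Gamma (1 - s) / s := by
  have h := Real.Gamma_add_one (s := -s) (by linarith)
  rw [show -s + 1 = 1 - s by ring] at h
  have hp := Real.Gamma_pos_of_pos (s := 1 - s) (by linarith)
  rw [abs_of_neg (by by_contra hn; push Not at hn; nlinarith), h]
  field_simp

/-- The cosine part is the real part of the Fourier transform of the Gaussian, which is again a
Gaussian. -/
theorem lintegral_one_sub_cos_mul_gaussian {b : ℝ} (hb : 0 < b) (ξ : Sp n) :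
    ∫⁻ z : Sp n, ENNReal.ofReal ((1 - Real.cos (2 * Real.pi * inner ℝ z ξ))
        * Real.exp (-b * ‖z‖ ^ 2))
      = ENNReal.ofReal ((Real.pi / b) ^ ((n : ℝ) / 2)
          * (1 - Real.exp (-((Real.pi * ‖ξ‖) ^ 2 / b)))) := by
  have hg : Integrable (fun z : Sp n => Real.exp (-b * ‖z‖ ^ 2)) := by
    have := GaussianFourier.integrable_cexp_neg_mul_sq_norm_add (V := Sp n) (b := (b : ℂ))
      (by simpa using hb) 0 0
    refine this.norm.congr (Filter.Eventually.of_forall fun z => ?_)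
    simp [Complex.norm_exp]
    norm_cast
    simp
  have hcos : ∫ z : Sp n, Real.cos (2 * Real.pi * inner ℝ z ξ) * Real.exp (-b * ‖z‖ ^ 2)
      = (Real.pi / b) ^ ((n : ℝ) / 2) * Real.exp (-((Real.pi * ‖ξ‖) ^ 2 / b)) := by
    have hi := GaussianFourier.integrable_cexp_neg_mul_sq_norm_add (V := Sp n) (b := (b : ℂ))
      (by simpa using hb) (2 * Real.pi * Complex.I) ξ
    have h := GaussianFourier.integral_cexp_neg_mul_sq_norm_add (V := Sp n) (b := (b : ℂ))
      (by simpa using hb) (2 * Real.pi * Complex.I) ξ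
    have h' := congrArg Complex.re h
    rw [← RCLike.re_eq_complex_re, ← integral_re hi] at h'
    have e1 : ∀ z : Sp n, RCLike.re (Complex.exp (-(b : ℂ) * (‖z‖ : ℂ) ^ 2
        + 2 * Real.pi * Complex.I * ((inner ℝ ξ z : ℝ) : ℂ)))
        = Real.cos (2 * Real.pi * inner ℝ z ξ) * Real.exp (-b * ‖z‖ ^ 2) := by
      intro z
      rw [RCLike.re_eq_complex_re, Complex.exp_re, real_inner_comm ξ z]
      have e2 : (-(b : ℂ) * (‖z‖ : ℂ) ^ 2 + 2 * Real.pi * Complex.I * ((inner ℝ ξ z : ℝ) : ℂ)).re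
          = -b * ‖z‖ ^ 2 := by
        rw [show -(b : ℂ) * (‖z‖ : ℂ) ^ 2 = ((-b * ‖z‖ ^ 2 : ℝ) : ℂ) by push_cast; ring,
          Complex.add_re, Complex.ofReal_re]
        simp
      have e3 : (-(b : ℂ) * (‖z‖ : ℂ) ^ 2 + 2 * Real.pi * Complex.I * ((inner ℝ ξ z : ℝ) : ℂ)).im
          = 2 * Real.pi * inner ℝ ξ z := by
        rw [show -(b : ℂ) * (‖z‖ : ℂ) ^ 2 = ((-b * ‖z‖ ^ 2 : ℝ) : ℂ) by push_cast; ring,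
          Complex.add_im, Complex.ofReal_im]
        simp
      rw [e2, e3]; ring
    simp_rw [e1] at h'
    rw [h', RCLike.re_eq_complex_re, finrank_euclideanSpace_fin,
      show (Real.pi / b : ℂ) ^ ((n : ℂ) / 2) = (((Real.pi / b) ^ ((n : ℝ) / 2) : ℝ) : ℂ) by
        rw [Complex.ofReal_cpow (by positivity)]; push_cast; rfl,
      show ((2 * Real.pi * Complex.I) ^ 2 * (‖ξ‖ : ℂ) ^ 2 / (4 * b) : ℂ)
        = ((-((Real.pi * ‖ξ‖) ^ 2 / b) : ℝ) : ℂ) by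
          push_cast; rw [mul_pow, Complex.I_sq]; field_simp; ring,
      ← Complex.ofReal_exp, ← Complex.ofReal_mul, Complex.ofReal_re]
  have hcosi : Integrable (fun z : Sp n =>
      Real.cos (2 * Real.pi * inner ℝ z ξ) * Real.exp (-b * ‖z‖ ^ 2)) := by
    refine hg.bdd_mul (c := 1) (by fun_prop) ?_
    exact Filter.Eventually.of_forall fun z => by
      simpa using Real.abs_cos_le_one _
  rw [← ofReal_integral_eq_lintegral_ofReal]
  · congr 1
    simp_rw [sub_mul, one_mul]
    rw [integral_sub hg hcosi, hcos, GaussianFourier.integral_rexp_neg_mul_sq_norm hb,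
      finrank_euclideanSpace_fin]
    ring
  · simp_rw [sub_mul, one_mul]
    exact hg.sub hcosi
  · exact Filter.Eventually.of_forall fun z =>
      mul_nonneg (by linarith [Real.cos_le_one (2 * Real.pi * inner ℝ z ξ)]) (Real.exp_pos _).le

theorem fracConst_pos {s : ℝ} (hs0 : 0 < s) (hs1 : s < 1) : 0 < fracConst n s := by
  unfold fracConst
  rw [abs_Gamma_neg hs0 hs1]
  have h1 := Real.Gamma_pos_of_pos (s := 1 - s) (by linarith)
  have h2 := Real.Gamma_pos_of_pos (s := (n : ℝ) / 2 + s) (by positivity)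
  positivity

theorem ae_ne_of_pos (hn : 0 < n) (x : Sp n) : ∀ᵐ z : Sp n, z ≠ x := by
  have : Nonempty (Fin n) := ⟨⟨0, hn⟩⟩
  simp [ae_iff]

/-- Up to Γ(n/2+s), the power |z|^{-(n+2s)} is the integral of t^{n/2+s-1} e^{-t|z|²} dt. After
Tonelli the z-integral is Gaussian and the t-integral is `lintegral_rpow_mul_one_sub_exp` with l =
(π|ξ|)². The factors Γ(n/2+s), π^{n/2} and |Γ(-s)| = Γ(1-s)/s cancel against `fracConst`, and 4^s
absorbs the factor 2 in 2π|ξ|. -/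
theorem lintegral_one_sub_cos_mul_rpow {s : ℝ} (hs0 : 0 < s) (hs1 : s < 1) (hn : 0 < n)
    (ξ : Sp n) :
    ∫⁻ z : Sp n, ENNReal.ofReal (fracConst n s * (1 - Real.cos (2 * Real.pi * inner ℝ z ξ))
        * ‖z‖ ^ (-((n : ℝ) + 2 * s)))
      = ENNReal.ofReal ((2 * Real.pi * ‖ξ‖) ^ (2 * s)) := by
  have hC := fracConst_pos (n := n) hs0 hs1
  have hΓ := Real.Gamma_pos_of_pos (s := (n : ℝ) / 2 + s) (by positivity)
  have hcos : ∀ z : Sp n, 0 ≤ 1 - Real.cos (2 * Real.pi * inner ℝ z ξ) := fun z => by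
    linarith [Real.cos_le_one (2 * Real.pi * inner ℝ z ξ)]
  set G := Real.Gamma ((n : ℝ) / 2 + s)
  have h1 : ∀ᵐ z : Sp n, ENNReal.ofReal (fracConst n s *
        (1 - Real.cos (2 * Real.pi * inner ℝ z ξ)) * ‖z‖ ^ (-((n : ℝ) + 2 * s)))
      = ENNReal.ofReal (fracConst n s / G) * ∫⁻ t in Set.Ioi (0 : ℝ),
        ENNReal.ofReal (t ^ ((n : ℝ) / 2 + s - 1)) *
        ENNReal.ofReal ((1 - Real.cos (2 * Real.pi * inner ℝ z ξ)) * Real.exp (-t * ‖z‖ ^ 2)) := by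
    filter_upwards [ae_ne_of_pos hn 0] with z hz
    have hz' : 0 < ‖z‖ := norm_pos_iff.2 hz
    have := lintegral_ofReal_rpow_mul_exp (a := (n : ℝ) / 2 + s) (r := ‖z‖ ^ 2)
      (by positivity) (by positivity)
    have e : ∀ t ∈ Set.Ioi (0 : ℝ), ENNReal.ofReal (t ^ ((n : ℝ) / 2 + s - 1)) *
        ENNReal.ofReal ((1 - Real.cos (2 * Real.pi * inner ℝ z ξ)) * Real.exp (-t * ‖z‖ ^ 2))
        = ENNReal.ofReal (1 - Real.cos (2 * Real.pi * inner ℝ z ξ)) *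
          ENNReal.ofReal (t ^ ((n : ℝ) / 2 + s - 1) * Real.exp (-(‖z‖ ^ 2 * t))) := by
      intro t ht
      have ht : (0 : ℝ) < t := ht
      rw [← ENNReal.ofReal_mul (by positivity), ← ENNReal.ofReal_mul (hcos z)]
      congr 1
      rw [show -t * ‖z‖ ^ 2 = -(‖z‖ ^ 2 * t) by ring]
      ring
    rw [setLIntegral_congr_fun measurableSet_Ioi e, lintegral_const_mul' _ _ ENNReal.ofReal_ne_top,
      this, ← ENNReal.ofReal_mul (hcos z), ← ENNReal.ofReal_mul (by positivity)]
    congr 1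
    rw [one_div, Real.inv_rpow (by positivity), ← Real.rpow_natCast, ← Real.rpow_mul hz'.le,
      Real.rpow_neg hz'.le, show ((2 : ℕ) : ℝ) * ((n : ℝ) / 2 + s) = n + 2 * s by push_cast; ring]
    simp only [G]
    field_simp
  rw [lintegral_congr_ae h1, lintegral_const_mul' _ _ ENNReal.ofReal_ne_top,
    lintegral_lintegral_swap (by fun_prop)]
  have h2 : ∀ t ∈ Set.Ioi (0 : ℝ), (∫⁻ z : Sp n, ENNReal.ofReal (t ^ ((n : ℝ) / 2 + s - 1)) *
        ENNReal.ofReal ((1 - Real.cos (2 * Real.pi * inner ℝ z ξ)) * Real.exp (-t * ‖z‖ ^ 2)))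
      = ENNReal.ofReal (Real.pi ^ ((n : ℝ) / 2)) *
        ENNReal.ofReal (t ^ (s - 1) * (1 - Real.exp (-((Real.pi * ‖ξ‖) ^ 2 / t)))) := by
    intro t ht
    have ht : (0 : ℝ) < t := ht
    rw [lintegral_const_mul' _ _ ENNReal.ofReal_ne_top, lintegral_one_sub_cos_mul_gaussian ht,
      ← ENNReal.ofReal_mul (by positivity), ← ENNReal.ofReal_mul (by positivity)]
    congr 1
    rw [Real.div_rpow (by positivity) ht.le, show (n : ℝ) / 2 + s - 1 = (n : ℝ) / 2 + (s - 1) by ring,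
      Real.rpow_add ht]
    have := (Real.rpow_pos_of_pos ht ((n : ℝ) / 2)).ne'
    field_simp
  rw [setLIntegral_congr_fun measurableSet_Ioi h2, lintegral_const_mul' _ _ ENNReal.ofReal_ne_top,
    lintegral_rpow_mul_one_sub_exp hs0 hs1 (by positivity), ← ENNReal.ofReal_mul (by positivity),
    ← ENNReal.ofReal_mul (by positivity)]
  congr 1
  unfold fracConst
  rw [abs_Gamma_neg hs0 hs1, ← Real.rpow_natCast (Real.pi * ‖ξ‖), ← Real.rpow_mul (by positivity),
    show 2 * Real.pi * ‖ξ‖ = 2 * (Real.pi * ‖ξ‖) by ring,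
    Real.mul_rpow (x := 2) (by positivity) (by positivity),
    show (2 : ℝ) ^ (2 * s) = 4 ^ s by rw [Real.rpow_mul (by norm_num)]; norm_num]
  have h1 := (Real.Gamma_pos_of_pos (s := 1 - s) (by linarith)).ne'
  have h3 : (0 : ℝ) < Real.pi ^ ((n : ℝ) / 2) := by positivity
  push_cast
  simp only [G] at *
  field_simp

/-! ### The Fourier transform in `L²` -/

abbrev L2C (n : ℕ) : Type := Lp ℂ 2 (volume : Measure (Sp n))

/-- The `L²` transform agrees with the one of tempered distributions, whose definition is this
duality. It allows `L²` transforms to be identified by testing. -/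
theorem integral_schwartz_mul_fourier (U : L2C n) (φ : 𝓢(Sp n, ℂ)) :
    ∫ x, φ x * (𝓕 U : L2C n) x = ∫ x, (𝓕 φ) x * U x := by
  have h := congrArg (fun T => T φ) (Lp.fourier_toTemperedDistribution_eq U)
  simp only [Lp.toTemperedDistribution_apply, TemperedDistribution.fourier_apply,
    smul_eq_mul] at h
  exact h.symm

theorem integral_schwartz_mul_fourierInv (U : L2C n) (φ : 𝓢(Sp n, ℂ)) :
    ∫ x, φ x * (𝓕⁻ U : L2C n) x = ∫ x, (𝓕⁻ φ) x * U x := by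
  have h := congrArg (fun T => T φ) (Lp.fourierInv_toTemperedDistribution_eq U)
  simp only [Lp.toTemperedDistribution_apply, TemperedDistribution.fourierInv_apply,
    smul_eq_mul] at h
  exact h.symm

theorem HasCompactSupport.ofReal_comp {g : Sp n → ℝ} (hc : HasCompactSupport g) :
    HasCompactSupport fun x => (g x : ℂ) :=
  hc.comp_left (g := fun r : ℝ => (r : ℂ)) Complex.ofReal_zero

theorem contDiff_ofReal_comp {g : Sp n → ℝ} (hg : ContDiff ℝ ∞ g) :
    ContDiff ℝ ∞ fun x => (g x : ℂ) :=
  Complex.ofRealCLM.contDiff.comp hg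

/-- A smooth compactly supported real function as a complex Schwartz function. -/
def schwartzOf {g : Sp n → ℝ} (hg : ContDiff ℝ ∞ g) (hc : HasCompactSupport g) : 𝓢(Sp n, ℂ) :=
  (HasCompactSupport.ofReal_comp hc).toSchwartzMap (contDiff_ofReal_comp hg)

@[simp] theorem schwartzOf_apply {g : Sp n → ℝ} (hg : ContDiff ℝ ∞ g) (hc : HasCompactSupport g)
    (x : Sp n) : schwartzOf hg hc x = (g x : ℂ) := rfl

theorem ae_eq_of_integral_schwartz {f g : Sp n → ℂ} (hf : LocallyIntegrable f)
    (hg : LocallyIntegrable g)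
    (h : ∀ φ : 𝓢(Sp n, ℂ), ∫ x, φ x * f x = ∫ x, φ x * g x) : f =ᵐ[volume] g :=
  ae_eq_of_integral_contDiff_smul_eq hf hg fun ψ h1 h2 => by
    simpa using h (schwartzOf h1 h2)

theorem MemLp.locallyIntegrable_two {f : Sp n → ℂ} (hf : MemLp f 2) : LocallyIntegrable f :=
  hf.locallyIntegrable (by norm_num)

/-- Both sides have the same integrals against Schwartz functions: by duality for the `L²`
transform, by Fubini for the integral. This gives pointwise bounds on `L²` transforms of integrable
functions. -/
theorem fourierInv_toLp_ae_eq {h : Sp n → ℂ} (h1 : Integrable h) (h2 : MemLp h 2) :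
    (𝓕⁻ (h2.toLp h : L2C n) : L2C n) =ᵐ[volume] 𝓕⁻ h := by
  have hcont : Continuous (𝓕⁻ h) := by
    rw [Real.fourierInv_eq_fourier_comp_neg]
    exact VectorFourier.fourierIntegral_continuous Real.continuous_fourierChar
      continuous_inner h1.comp_neg
  refine ae_eq_of_integral_schwartz (MemLp.locallyIntegrable_two (Lp.memLp _))
    hcont.locallyIntegrable fun φ => ?_
  rw [integral_schwartz_mul_fourierInv]
  have e1 : ∫ x, (𝓕⁻ φ) x * (h2.toLp h : L2C n) x = ∫ x, (𝓕⁻ φ) x * h x := by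
    refine integral_congr_ae ?_
    filter_upwards [h2.coeFn_toLp] with x hx
    rw [hx]
  rw [e1]
  have := VectorFourier.integral_fourierIntegral_smul_eq_flip (V := Sp n) (W := Sp n)
    (μ := volume) (ν := volume) (e := Real.fourierChar) (L := -innerₗ (Sp n)) (f := φ) (g := h)
    Real.continuous_fourierChar continuous_inner.neg φ.integrable h1
  simp only [smul_eq_mul] at this
  have hflip : (-innerₗ (Sp n)).flip = -innerₗ (Sp n) := by
    ext x y; simp [real_inner_comm]
  rw [hflip] at this
  rw [SchwartzMap.fourierInv_coe]
  exact this

/-- Modulation of a Schwartz function by a character. -/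
theorem fourier_shift (U : L2C n) (z : Sp n) {V : L2C n} (hV : V =ᵐ[volume] fun x => U (x + z)) :
    (𝓕 V : L2C n) =ᵐ[volume] fun ξ => (Real.fourierChar (inner ℝ z ξ) : ℂ) * (𝓕 U : L2C n) ξ := by
  have hchar : Continuous fun ξ : Sp n => (Real.fourierChar (inner ℝ z ξ) : ℂ) := by fun_prop
  have hcharS : ContDiff ℝ ∞ fun ξ : Sp n => (Real.fourierChar (inner ℝ z ξ) : ℂ) := by
    simp_rw [Real.fourierChar_apply]
    exact ((contDiff_ofReal_comp (contDiff_const.mul (contDiff_const.inner ℝ contDiff_id))).mul contDiff_const).cexp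
  have hm : MemLp (fun ξ => (Real.fourierChar (inner ℝ z ξ) : ℂ) * (𝓕 U : L2C n) ξ) 2 := by
    refine (Lp.memLp (𝓕 U : L2C n)).of_le
      (hchar.aestronglyMeasurable.mul (Lp.aestronglyMeasurable _)) ?_
    exact Filter.Eventually.of_forall fun ξ => by
      rw [norm_mul, Circle.norm_coe, one_mul]
  refine ae_eq_of_integral_contDiff_smul_eq (MemLp.locallyIntegrable_two (Lp.memLp _))
    (MemLp.locallyIntegrable_two hm) fun ψ h1 h2 => ?_
  have hψc : HasCompactSupport fun ξ => (Real.fourierChar (inner ℝ z ξ) : ℂ) * (ψ ξ : ℂ) :=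
    (HasCompactSupport.ofReal_comp h2).mul_left
  have hψs : ContDiff ℝ ∞ fun ξ => (Real.fourierChar (inner ℝ z ξ) : ℂ) * (ψ ξ : ℂ) :=
    hcharS.mul (contDiff_ofReal_comp h1)
  have e1 := integral_schwartz_mul_fourier V (schwartzOf h1 h2)
  have e2 := integral_schwartz_mul_fourier U (hψc.toSchwartzMap hψs)
  -- The dual fact for the test function: modulating it by the character translates its transform by
  -- z.
  have e3 : ∀ x, (𝓕 (hψc.toSchwartzMap hψs)) x = (𝓕 (schwartzOf h1 h2)) (x - z) := by
    intro x
    rw [SchwartzMap.fourier_coe, SchwartzMap.fourier_coe, Real.fourier_eq, Real.fourier_eq]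
    refine integral_congr_ae (Filter.Eventually.of_forall fun ξ => ?_)
    simp only [inner_sub_right, neg_sub]
    change Real.fourierChar _ • ((Real.fourierChar (inner ℝ z ξ) : ℂ) * (ψ ξ : ℂ)) = _
    rw [Circle.smul_def, Circle.smul_def, smul_eq_mul, smul_eq_mul, ← mul_assoc,
      sub_eq_neg_add, AddChar.map_add_eq_mul, Circle.coe_mul, real_inner_comm z ξ]
    rfl
  have e4 : ∫ x, (𝓕 (schwartzOf h1 h2)) x * V x = ∫ x, (𝓕 (schwartzOf h1 h2)) (x - z) * U x := by
    refine Eq.trans ?_ (integral_add_right_eq_self (μ := volume)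
      (fun x => (𝓕 (schwartzOf h1 h2)) (x - z) * U x) z)
    refine integral_congr_ae ?_
    filter_upwards [hV] with x hx
    rw [hx, add_sub_cancel_right]
  simp only [Complex.real_smul]
  have l : ∫ x, (ψ x : ℂ) * (𝓕 V : L2C n) x = ∫ x, (schwartzOf h1 h2) x * (𝓕 V : L2C n) x := rfl
  rw [l, e1, e4]
  simp_rw [← e3]
  rw [← e2]
  refine integral_congr_ae (Filter.Eventually.of_forall fun ξ => ?_)
  change (Real.fourierChar (inner ℝ z ξ) : ℂ) * (ψ ξ : ℂ) * (𝓕 U : L2C n) ξ = _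
  simp only
  ring

/-- A real `L²` function as a complex one. -/
def toComplexL2 (u : Lp ℝ 2 (volume : Measure (Sp n))) : L2C n := Complex.ofRealCLM.compLp u

theorem coeFn_toComplexL2 (u : Lp ℝ 2 (volume : Measure (Sp n))) :
    toComplexL2 u =ᵐ[volume] fun x => (u x : ℂ) :=
  Complex.ofRealCLM.coeFn_compLp u

theorem fourierL2_eq (u : Lp ℝ 2 (volume : Measure (Sp n))) :
    fourierL2 u = 𝓕 (toComplexL2 u) := rfl

theorem norm_toComplexL2 (u : Lp ℝ 2 (volume : Measure (Sp n))) : ‖toComplexL2 u‖ = ‖u‖ := by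
  rw [Lp.norm_def, Lp.norm_def]
  congr 1
  refine eLpNorm_congr_norm_ae ?_
  filter_upwards [coeFn_toComplexL2 u] with x hx
  rw [hx]; simp

theorem norm_fourierL2 (u : Lp ℝ 2 (volume : Measure (Sp n))) : ‖fourierL2 u‖ = ‖u‖ := by
  rw [fourierL2_eq, Lp.norm_fourier_eq, norm_toComplexL2]

theorem lintegral_enorm_sq_eq {E : Type*} [NormedAddCommGroup E] {α : Type*} [MeasurableSpace α]
    {μ : Measure α} (f : Lp E 2 μ) : ∫⁻ x, ‖f x‖ₑ ^ 2 ∂μ = ENNReal.ofReal (‖f‖ ^ 2) := by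
  have h := eLpNorm_nnreal_pow_eq_lintegral (f := f) (μ := μ) (p := 2) (by norm_num)
  simp only [NNReal.coe_ofNat, ENNReal.coe_ofNat] at h
  have h' : ∫⁻ x, ‖f x‖ₑ ^ 2 ∂μ = ∫⁻ x, ‖f x‖ₑ ^ (2 : ℝ) ∂μ := by
    simp_rw [← ENNReal.rpow_natCast]; rfl
  rw [h', ← h, Lp.norm_def, ENNReal.ofReal_pow ENNReal.toReal_nonneg,
    ENNReal.ofReal_toReal (Lp.eLpNorm_ne_top f)]
  norm_cast

/-- Plancherel for u(·+z) - u, whose transform is (e^{2πi z·ξ} - 1) û, together with |e^{iθ} - 1|² =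
2(1 - cos θ). -/
theorem lintegral_shift_sub (u : Lp ℝ 2 (volume : Measure (Sp n))) (z : Sp n) :
    ∫⁻ x, ‖u (x + z) - u x‖ₑ ^ 2
      = ∫⁻ ξ, ENNReal.ofReal (2 * (1 - Real.cos (2 * Real.pi * inner ℝ z ξ)))
        * ‖fourierL2 u ξ‖ₑ ^ 2 := by
  have hmp : MeasurePreserving (fun x : Sp n => x + z) volume volume :=
    measurePreserving_add_right volume z
  let v : Lp ℝ 2 (volume : Measure (Sp n)) := ((Lp.memLp u).comp_measurePreserving hmp).toLp _
  have hv : v =ᵐ[volume] fun x => u (x + z) := MemLp.coeFn_toLp _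
  have hV : toComplexL2 v =ᵐ[volume] fun x => toComplexL2 u (x + z) := by
    filter_upwards [coeFn_toComplexL2 v, hv,
      hmp.quasiMeasurePreserving.ae (coeFn_toComplexL2 u)] with x h1 h2 h3
    rw [h1, h2, h3]
  have hF := fourier_shift (toComplexL2 u) z hV
  have e1 : ∫⁻ x, ‖u (x + z) - u x‖ₑ ^ 2 = ∫⁻ x, ‖(v - u) x‖ₑ ^ 2 := by
    refine lintegral_congr_ae ?_
    filter_upwards [hv, Lp.coeFn_sub v u] with x h1 h2
    rw [h2, Pi.sub_apply, h1]
  rw [e1, lintegral_enorm_sq_eq, ← norm_fourierL2, ← lintegral_enorm_sq_eq]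
  refine lintegral_congr_ae ?_
  rw [map_sub]
  filter_upwards [hF, Lp.coeFn_sub (fourierL2 v) (fourierL2 u)] with ξ h1 h2
  rw [h2, Pi.sub_apply, fourierL2_eq, fourierL2_eq, h1, ← sub_one_mul, enorm_mul, mul_pow]
  congr 1
  rw [← ofReal_norm, ← ENNReal.ofReal_pow (norm_nonneg _)]
  congr 1
  rw [Real.fourierChar_apply, ← Complex.normSq_eq_norm_sq, Complex.normSq_apply]
  simp only [Complex.sub_re, Complex.sub_im, Complex.one_re, Complex.one_im, sub_zero]
  rw [Complex.exp_ofReal_mul_I_re, Complex.exp_ofReal_mul_I_im]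
  nlinarith [Real.sin_sq_add_cos_sq (2 * Real.pi * inner ℝ z ξ)]

/-! ### The Gagliardo quotient -/

/-- The weighted difference quotient `(u(y) - u(x)) |y - x|^{-(n/2+s)}`. -/
def diffq (s : ℝ) (u : Sp n → ℝ) (z : Sp n × Sp n) : ℝ :=
  (u z.2 - u z.1) * ‖z.2 - z.1‖ ^ (-((n : ℝ) / 2 + s))

theorem diffq_sq (s : ℝ) (u : Sp n → ℝ) (x y : Sp n) (h : y ≠ x) :
    ‖diffq s u (x, y)‖ₑ ^ 2 = ‖u y - u x‖ₑ ^ 2 * ENNReal.ofReal (‖y - x‖ ^ (-((n : ℝ) + 2 * s))) := by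
  have hp : 0 < ‖y - x‖ := norm_pos_iff.2 (sub_ne_zero.2 h)
  rw [diffq, enorm_mul, mul_pow]
  congr 1
  rw [← ofReal_norm, ← ENNReal.ofReal_pow (norm_nonneg _), Real.norm_of_nonneg (by positivity),
    ← Real.rpow_natCast, ← Real.rpow_mul hp.le]
  congr 2
  push_cast; ring

theorem measurable_diffq (s : ℝ) {u : Sp n → ℝ} (hu : Measurable u) : Measurable (diffq s u) := by
  unfold diffq
  fun_prop

theorem diffq_congr_ae (s : ℝ) {u v : Sp n → ℝ} (h : u =ᵐ[volume] v) :
    diffq s u =ᵐ[(volume : Measure (Sp n)).prod volume] diffq s v := by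
  have h1 : ∀ᵐ z : Sp n × Sp n ∂(volume : Measure (Sp n)).prod volume, u z.1 = v z.1 :=
    Measure.quasiMeasurePreserving_fst.ae h
  have h2 : ∀ᵐ z : Sp n × Sp n ∂(volume : Measure (Sp n)).prod volume, u z.2 = v z.2 :=
    Measure.quasiMeasurePreserving_snd.ae h
  filter_upwards [h1, h2] with z a b
  simp only [diffq, a, b]

/-- Substitute y = x + z, integrate in x by `lintegral_shift_sub` and then in z by
`lintegral_one_sub_cos_mul_rpow`. The equality is in `ℝ≥0∞`, so it needs no finiteness and also
decides which `L²` functions lie in `H^s`. -/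
theorem lintegral_diffq_eq {s : ℝ} (hs0 : 0 < s) (hs1 : s < 1) (hn : 0 < n)
    (u : Lp ℝ 2 (volume : Measure (Sp n))) :
    ENNReal.ofReal (fracConst n s / 2) *
      ∫⁻ z, ‖diffq s u z‖ₑ ^ 2 ∂(volume : Measure (Sp n)).prod volume
      = ∫⁻ ξ, ENNReal.ofReal ((2 * Real.pi * ‖ξ‖) ^ (2 * s)) * ‖fourierL2 u ξ‖ₑ ^ 2 := by
  have hC := fracConst_pos (n := n) hs0 hs1
  have hum : Measurable (u : Sp n → ℝ) := (Lp.stronglyMeasurable u).measurable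
  have hFm : Measurable (fourierL2 u : Sp n → ℂ) := (Lp.stronglyMeasurable _).measurable
  rw [lintegral_prod _ (by have := measurable_diffq s hum; fun_prop)]
  have e1 : ∀ x : Sp n, ∫⁻ y, ‖diffq s u (x, y)‖ₑ ^ 2
      = ∫⁻ z, ‖u (x + z) - u x‖ₑ ^ 2 * ENNReal.ofReal (‖z‖ ^ (-((n : ℝ) + 2 * s))) := by
    intro x
    rw [← lintegral_add_left_eq_self _ x]
    refine lintegral_congr_ae ?_
    filter_upwards [ae_ne_of_pos hn 0] with z hz
    rw [diffq_sq _ _ _ _ (by simpa using hz), add_sub_cancel_left]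
  simp_rw [e1]
  rw [lintegral_lintegral_swap (by fun_prop)]
  have e2 : ∀ z : Sp n, ∫⁻ x, ‖u (x + z) - u x‖ₑ ^ 2
        * ENNReal.ofReal (‖z‖ ^ (-((n : ℝ) + 2 * s)))
      = ∫⁻ ξ, ENNReal.ofReal (2 * (1 - Real.cos (2 * Real.pi * inner ℝ z ξ)))
        * ‖fourierL2 u ξ‖ₑ ^ 2 * ENNReal.ofReal (‖z‖ ^ (-((n : ℝ) + 2 * s))) := by
    intro z
    rw [lintegral_mul_const _ (by fun_prop), lintegral_shift_sub,
      lintegral_mul_const _ (by fun_prop)]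
  simp_rw [e2]
  rw [lintegral_lintegral_swap (by fun_prop), ← lintegral_const_mul' _ _ ENNReal.ofReal_ne_top]
  refine lintegral_congr fun ξ => ?_
  rw [← lintegral_one_sub_cos_mul_rpow hs0 hs1 hn ξ, ← lintegral_const_mul' _ _ ENNReal.ofReal_ne_top,
    ← lintegral_mul_const _ (by fun_prop)]
  refine lintegral_congr fun z => ?_
  have hc : 0 ≤ 1 - Real.cos (2 * Real.pi * inner ℝ z ξ) := by
    linarith [Real.cos_le_one (2 * Real.pi * inner ℝ z ξ)]
  rw [show ∀ a b c d : ℝ≥0∞, a * (b * c * d) = (a * b * d) * c by intros; ring,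
    ← ENNReal.ofReal_mul (by positivity), ← ENNReal.ofReal_mul (by positivity)]
  congr 2
  ring

/-! ### The space `H^s` through difference quotients -/

abbrev vol2 (n : ℕ) : Measure (Sp n × Sp n) := (volume : Measure (Sp n)).prod volume

/-- Half of the constant `C_{n,s}`. -/
def halfConst (n : ℕ) (s : ℝ) : ℝ := fracConst n s / 2

theorem halfConst_pos (hs0 : 0 < s) (hs1 : s < 1) : 0 < halfConst n s :=
  half_pos (fracConst_pos hs0 hs1)

/-- A function in `L²` with square integrable difference quotient. -/
structure IsHs (s : ℝ) (u : Sp n → ℝ) : Prop where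
  memLp : MemLp u 2 volume
  memLp_diffq : MemLp (diffq s u) 2 (vol2 n)

theorem norm_weight_sq (s : ℝ) (ξ : Sp n) :
    ‖weight s ξ‖ₑ ^ 2 = ENNReal.ofReal ((1 + (2 * Real.pi * ‖ξ‖) ^ 2) ^ s) := by
  have : (0 : ℝ) < (1 + (2 * Real.pi * ‖ξ‖) ^ 2) := by positivity
  rw [← ofReal_norm, ← ENNReal.ofReal_pow (norm_nonneg _), weight, Complex.norm_real,
    Real.norm_of_nonneg (by positivity), ← Real.rpow_natCast, ← Real.rpow_mul this.le]
  congr 2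
  push_cast; ring

theorem Hs.norm_eq (u : Hs n s) : ‖u‖ = ‖Hs.weightedFourier u‖ := rfl

theorem Hs.coeFn_weightedFourier (u : Hs n s) :
    Hs.weightedFourier u =ᵐ[volume] fun ξ => weight s ξ * Hs.fourier u ξ :=
  (Hs.memLp u).coeFn_toLp

theorem Hs.norm_sq_eq (u : Hs n s) : ENNReal.ofReal (‖u‖ ^ 2)
    = ∫⁻ ξ, ENNReal.ofReal ((1 + (2 * Real.pi * ‖ξ‖) ^ 2) ^ s) * ‖Hs.fourier u ξ‖ₑ ^ 2 := by
  rw [Hs.norm_eq, ← lintegral_enorm_sq_eq]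
  refine lintegral_congr_ae ?_
  filter_upwards [Hs.coeFn_weightedFourier u] with ξ h
  rw [h, enorm_mul, mul_pow, norm_weight_sq]

theorem Hs.norm_toL2_le (hs0 : 0 < s) (u : Hs n s) : ‖Hs.toL2 u‖ ≤ ‖u‖ := by
  rw [← norm_fourierL2, Hs.norm_eq]
  refine Lp.norm_le_norm_of_ae_le ?_
  filter_upwards [Hs.coeFn_weightedFourier u] with ξ h
  rw [h, norm_mul]
  refine le_mul_of_one_le_left (norm_nonneg _) ?_
  have : (1 : ℝ) ≤ (1 + (2 * Real.pi * ‖ξ‖) ^ 2) ^ (s / 2) :=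
    Real.one_le_rpow (by nlinarith [sq_nonneg (2 * Real.pi * ‖ξ‖)]) (by positivity)
  rw [weight, Complex.norm_real, Real.norm_of_nonneg (by positivity)]
  exact this

theorem measurable_weight (s : ℝ) : Measurable (weight (n := n) s) := by
  unfold weight; fun_prop

theorem one_add_sq_rpow_le (hs0 : 0 < s) (hs1 : s < 1) {r : ℝ} (hr : 0 ≤ r) :
    (1 + r ^ 2) ^ s ≤ 1 + r ^ (2 * s) := by
  have h := Real.rpow_add_le_add_rpow (p := s) (zero_le_one) (sq_nonneg r) hs0.le hs1.le
  have e : (r ^ 2) ^ s = r ^ (2 * s) := by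
    rw [← Real.rpow_natCast, ← Real.rpow_mul hr]; norm_num
  rwa [Real.one_rpow, e] at h

theorem rpow_le_one_add_sq_rpow (hs0 : 0 < s) {r : ℝ} (hr : 0 ≤ r) :
    r ^ (2 * s) ≤ (1 + r ^ 2) ^ s := by
  rw [Real.rpow_mul hr]
  refine Real.rpow_le_rpow (by positivity) ?_ hs0.le
  rw [show (2 : ℝ) = ((2 : ℕ) : ℝ) by norm_num, Real.rpow_natCast]
  linarith

theorem IsHs.congr {u v : Sp n → ℝ} (hu : IsHs s u) (h : u =ᵐ[volume] v) : IsHs s v :=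
  ⟨(memLp_congr_ae h).1 hu.memLp, (memLp_congr_ae (diffq_congr_ae s h)).1 hu.memLp_diffq⟩

theorem memLp_two_of_lintegral {E α : Type*} [NormedAddCommGroup E] [MeasurableSpace α]
    {μ : Measure α} {f : α → E} (hf : AEStronglyMeasurable f μ)
    (h : ∫⁻ x, ‖f x‖ₑ ^ 2 ∂μ < ⊤) : MemLp f 2 μ := by
  refine ⟨hf, ?_⟩
  rw [eLpNorm_lt_top_iff_lintegral_rpow_enorm_lt_top (by norm_num) (by norm_num)]
  simpa using h

theorem MemLp.lintegral_sq_lt_top {E α : Type*} [NormedAddCommGroup E] [MeasurableSpace α]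
    {μ : Measure α} {f : α → E} (hf : MemLp f 2 μ) : ∫⁻ x, ‖f x‖ₑ ^ 2 ∂μ < ⊤ := by
  have h := hf.2
  rw [eLpNorm_lt_top_iff_lintegral_rpow_enorm_lt_top (by norm_num) (by norm_num)] at h
  simpa using h

/-- As t ↦ t^s is subadditive for s ≤ 1, (1 + r²)^s ≤ 1 + r^{2s}; the two terms are paid for by the
`L²` norm and by the difference quotient. -/
theorem IsHs.mem (hs0 : 0 < s) (hs1 : s < 1) (hn : 0 < n)
    {u : Lp ℝ 2 (volume : Measure (Sp n))} (hu : IsHs s u) : u ∈ hsSubmodule n s := by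
  change MemLp (fun ξ => weight s ξ * fourierL2 u ξ) 2 volume
  refine memLp_two_of_lintegral
    ((measurable_weight s).aestronglyMeasurable.mul (Lp.aestronglyMeasurable _)) ?_
  have h1 : ∀ ξ : Sp n, ‖weight s ξ * fourierL2 u ξ‖ₑ ^ 2
      ≤ ‖fourierL2 u ξ‖ₑ ^ 2
        + ENNReal.ofReal ((2 * Real.pi * ‖ξ‖) ^ (2 * s)) * ‖fourierL2 u ξ‖ₑ ^ 2 := by
    intro ξ
    rw [enorm_mul, mul_pow, norm_weight_sq, ← one_add_mul]
    gcongr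
    rw [← ENNReal.ofReal_one, ← ENNReal.ofReal_add zero_le_one (by positivity)]
    exact ENNReal.ofReal_le_ofReal (one_add_sq_rpow_le hs0 hs1 (by positivity))
  refine (lintegral_mono h1).trans_lt ?_
  have hm : Measurable (fourierL2 u : Sp n → ℂ) := (Lp.stronglyMeasurable _).measurable
  rw [lintegral_add_left (by fun_prop), ← lintegral_diffq_eq hs0 hs1 hn u]
  exact ENNReal.add_lt_top.2 ⟨MemLp.lintegral_sq_lt_top (Lp.memLp _), ENNReal.mul_lt_top
    ENNReal.ofReal_lt_top (MemLp.lintegral_sq_lt_top hu.memLp_diffq)⟩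

/-- The element of `H^s` given by a function. -/
def IsHs.toHs (hs0 : 0 < s) (hs1 : s < 1) (hn : 0 < n) {u : Sp n → ℝ} (hu : IsHs s u) : Hs n s :=
  ⟨hu.memLp.toLp u, IsHs.mem hs0 hs1 hn (hu.congr hu.memLp.coeFn_toLp.symm)⟩

theorem IsHs.coeFn_toHs (hs0 : 0 < s) (hs1 : s < 1) (hn : 0 < n) {u : Sp n → ℝ} (hu : IsHs s u) :
    (hu.toHs hs0 hs1 hn : Sp n → ℝ) =ᵐ[volume] u :=
  hu.memLp.coeFn_toLp

theorem Hs.ext_ae {u v : Hs n s} (h : (u : Sp n → ℝ) =ᵐ[volume] v) : u = v :=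
  Hs.toL2_injective (Lp.ext h)

theorem Hs.coeFn_add (u v : Hs n s) : ((u + v : Hs n s) : Sp n → ℝ) =ᵐ[volume] fun x => u x + v x := by
  rw [map_add]; exact Lp.coeFn_add _ _

theorem Hs.coeFn_sub (u v : Hs n s) : ((u - v : Hs n s) : Sp n → ℝ) =ᵐ[volume] fun x => u x - v x := by
  rw [map_sub]; exact Lp.coeFn_sub _ _

theorem Hs.coeFn_smul (c : ℝ) (u : Hs n s) :
    ((c • u : Hs n s) : Sp n → ℝ) =ᵐ[volume] fun x => c * u x := by
  rw [map_smul]; exact Lp.coeFn_smul _ _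

theorem Hs.measurable (u : Hs n s) : Measurable (u : Sp n → ℝ) :=
  (Lp.stronglyMeasurable (Hs.toL2 u)).measurable

theorem Hs.lintegral_diffq_le (hs0 : 0 < s) (hs1 : s < 1) (hn : 0 < n) (u : Hs n s) :
    ENNReal.ofReal (halfConst n s) * ∫⁻ z, ‖diffq s u z‖ₑ ^ 2 ∂vol2 n
      ≤ ENNReal.ofReal (‖u‖ ^ 2) := by
  rw [halfConst, lintegral_diffq_eq hs0 hs1 hn, Hs.norm_sq_eq]
  refine lintegral_mono fun ξ => ?_
  gcongr
  · exact rpow_le_one_add_sq_rpow hs0 (by positivity)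
  · rfl

theorem Hs.isHs (hs0 : 0 < s) (hs1 : s < 1) (hn : 0 < n) (u : Hs n s) : IsHs s (u : Sp n → ℝ) := by
  refine ⟨Lp.memLp _, memLp_two_of_lintegral
    (measurable_diffq s (Hs.measurable u)).aestronglyMeasurable ?_⟩
  have h := (Hs.lintegral_diffq_le hs0 hs1 hn u).trans_lt ENNReal.ofReal_lt_top
  refine ENNReal.lt_top_of_mul_ne_top_right h.ne ?_
  simpa using halfConst_pos (n := n) hs0 hs1

theorem integral_sq_eq_norm_sq {α : Type*} [MeasurableSpace α] {μ : Measure α} {f : α → ℝ}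
    (hf : MemLp f 2 μ) : ∫⁻ x, ‖f x‖ₑ ^ 2 ∂μ = ENNReal.ofReal (∫ x, f x ^ 2 ∂μ) := by
  rw [ofReal_integral_eq_lintegral_ofReal hf.integrable_sq
    (Filter.Eventually.of_forall fun x => sq_nonneg _)]
  refine lintegral_congr fun x => ?_
  rw [← ofReal_norm, ← ENNReal.ofReal_pow (norm_nonneg _), Real.norm_eq_abs, sq_abs]

theorem Hs.norm_toL2_sq (u : Hs n s) : ‖Hs.toL2 u‖ ^ 2 = ∫ x, u x ^ 2 := by
  have h := integral_sq_eq_norm_sq (Lp.memLp (Hs.toL2 u))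
  rw [lintegral_enorm_sq_eq] at h
  exact (ENNReal.ofReal_eq_ofReal_iff (by positivity)
    (integral_nonneg fun x => sq_nonneg _)).1 h

theorem Hs.integral_diffq_le (hs0 : 0 < s) (hs1 : s < 1) (hn : 0 < n) (u : Hs n s) :
    halfConst n s * ∫ z, diffq s u z ^ 2 ∂vol2 n ≤ ‖u‖ ^ 2 := by
  have h := Hs.lintegral_diffq_le hs0 hs1 hn u
  rw [integral_sq_eq_norm_sq (Hs.isHs hs0 hs1 hn u).memLp_diffq,
    ← ENNReal.ofReal_mul (halfConst_pos hs0 hs1).le] at h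
  exact (ENNReal.ofReal_le_ofReal_iff (by positivity)).1 h

theorem Hs.norm_sq_le (hs0 : 0 < s) (hs1 : s < 1) (hn : 0 < n) (u : Hs n s) :
    ‖u‖ ^ 2 ≤ (∫ x, u x ^ 2) + halfConst n s * ∫ z, diffq s u z ^ 2 ∂vol2 n := by
  have hκ := halfConst_pos (n := n) hs0 hs1
  have hi : 0 ≤ ∫ z, diffq s u z ^ 2 ∂vol2 n := integral_nonneg fun _ => sq_nonneg _
  rw [← Hs.norm_toL2_sq, ← ENNReal.ofReal_le_ofReal_iff (by positivity),
    ENNReal.ofReal_add (by positivity) (by positivity), ENNReal.ofReal_mul hκ.le,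
    ← integral_sq_eq_norm_sq (Hs.isHs hs0 hs1 hn u).memLp_diffq, halfConst,
    lintegral_diffq_eq hs0 hs1 hn, ← norm_fourierL2, ← lintegral_enorm_sq_eq, Hs.norm_sq_eq,
    ← lintegral_add_left (by have := (Lp.stronglyMeasurable (fourierL2 (Hs.toL2 u))).measurable; fun_prop)]
  refine lintegral_mono fun ξ => ?_
  rw [← one_add_mul]
  refine mul_le_mul_left ?_ _
  rw [← ENNReal.ofReal_one, ← ENNReal.ofReal_add zero_le_one (by positivity)]
  exact ENNReal.ofReal_le_ofReal (one_add_sq_rpow_le hs0 hs1 (by positivity))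

theorem diffq_add (u v : Sp n → ℝ) (z : Sp n × Sp n) :
    diffq s (fun x => u x + v x) z = diffq s u z + diffq s v z := by
  simp only [diffq]; ring

theorem diffq_const_mul (c : ℝ) (u : Sp n → ℝ) (z : Sp n × Sp n) :
    diffq s (fun x => c * u x) z = c * diffq s u z := by
  simp only [diffq]; ring

theorem integral_add_two_mul_add {α : Type*} [MeasurableSpace α] {μ : Measure α} {f g h : α → ℝ}
    (hf : Integrable f μ) (hg : Integrable g μ) (hh : Integrable h μ) :
    ∫ x, (f x + 2 * g x + h x) ∂μ = (∫ x, f x ∂μ) + 2 * (∫ x, g x ∂μ) + ∫ x, h x ∂μ := by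
  have h1 : Integrable (fun x => f x + 2 * g x) μ := hf.add (hg.const_mul 2)
  rw [integral_add h1 hh, integral_add hf (hg.const_mul 2), integral_const_mul]

theorem Hs.integrable_pairing (hs0 : 0 < s) (w v : Hs n s) :
    Integrable fun ξ => (((2 * Real.pi * ‖ξ‖) ^ (2 * s) : ℝ) : ℂ) * Hs.fourier w ξ *
    (starRingEnd ℂ) (Hs.fourier v ξ) := by
  have h := (Hs.memLp w).integrable_mul (Hs.memLp v)
  refine h.mono ?_ (Filter.Eventually.of_forall fun ξ => ?_)
  · have h1 : Measurable (Hs.fourier w : Sp n → ℂ) := (Lp.stronglyMeasurable _).measurable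
    have h2 : Measurable (Hs.fourier v : Sp n → ℂ) := (Lp.stronglyMeasurable _).measurable
    have h3 : Measurable fun ξ => (starRingEnd ℂ) (Hs.fourier v ξ) :=
      Complex.continuous_conj.measurable.comp h2
    exact Measurable.aestronglyMeasurable (by fun_prop)
  · have hp : (0 : ℝ) < (1 + (2 * Real.pi * ‖ξ‖) ^ 2) := by positivity
    have e : (1 + (2 * Real.pi * ‖ξ‖) ^ 2) ^ s
        = (1 + (2 * Real.pi * ‖ξ‖) ^ 2) ^ (s / 2) * (1 + (2 * Real.pi * ‖ξ‖) ^ 2) ^ (s / 2) := by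
      rw [← Real.rpow_add hp]; congr 1; ring
    have h1 := rpow_le_one_add_sq_rpow hs0 (r := 2 * Real.pi * ‖ξ‖) (by positivity)
    rw [e] at h1
    simp only [Pi.mul_apply, norm_mul, weight, Complex.norm_real, RCLike.norm_conj]
    rw [Real.norm_of_nonneg (by positivity), Real.norm_of_nonneg (by positivity)]
    calc _ ≤ ((1 + (2 * Real.pi * ‖ξ‖) ^ 2) ^ (s / 2) * (1 + (2 * Real.pi * ‖ξ‖) ^ 2) ^ (s / 2))
          * ‖Hs.fourier w ξ‖ * ‖Hs.fourier v ξ‖ := by gcongr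
      _ = _ := by ring

theorem Hs.coeFn_fourier_add (u v : Hs n s) :
    Hs.fourier (u + v) =ᵐ[volume] fun ξ => Hs.fourier u ξ + Hs.fourier v ξ := by
  unfold Hs.fourier
  rw [map_add, map_add]; exact Lp.coeFn_add _ _

theorem Hs.pairing_add_self (hs0 : 0 < s) (w v : Hs n s) :
    fracLaplacianPairing (w + v) (w + v) = fracLaplacianPairing w w
      + 2 * fracLaplacianPairing w v + fracLaplacianPairing v v := by
  have hre : ∀ w v : Hs n s, fracLaplacianPairing w v = ∫ ξ,
      ((((2 * Real.pi * ‖ξ‖) ^ (2 * s) : ℝ) : ℂ) * Hs.fourier w ξ *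
        (starRingEnd ℂ) (Hs.fourier v ξ)).re := fun w v => by
    have := integral_re (Hs.integrable_pairing hs0 w v)
    unfold fracLaplacianPairing
    simpa only [RCLike.re_to_complex] using this.symm
  have hi : ∀ w v : Hs n s, Integrable fun ξ =>
      ((((2 * Real.pi * ‖ξ‖) ^ (2 * s) : ℝ) : ℂ) * Hs.fourier w ξ *
        (starRingEnd ℂ) (Hs.fourier v ξ)).re := fun w v => (Hs.integrable_pairing hs0 w v).re
  simp only [hre]
  rw [← integral_add_two_mul_add (hi w w) (hi w v) (hi v v)]
  refine integral_congr_ae ?_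
  filter_upwards [Hs.coeFn_fourier_add w v] with ξ h
  simp only [h, map_add, Complex.mul_re, Complex.add_re, Complex.add_im, Complex.mul_im,
    Complex.conj_re, Complex.conj_im, Complex.ofReal_re, Complex.ofReal_im]
  ring

theorem Hs.pairing_self (hs0 : 0 < s) (hs1 : s < 1) (hn : 0 < n) (u : Hs n s) :
    fracLaplacianPairing u u = halfConst n s * ∫ z, diffq s u z ^ 2 ∂vol2 n := by
  have hκ := halfConst_pos (n := n) hs0 hs1
  have e : ∀ ξ : Sp n, (((2 * Real.pi * ‖ξ‖) ^ (2 * s) : ℝ) : ℂ) * Hs.fourier u ξ *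
      (starRingEnd ℂ) (Hs.fourier u ξ)
      = (((2 * Real.pi * ‖ξ‖) ^ (2 * s) * ‖Hs.fourier u ξ‖ ^ 2 : ℝ) : ℂ) := by
    intro ξ
    rw [mul_assoc, Complex.mul_conj, Complex.normSq_eq_norm_sq]; push_cast; ring
  have hint := Hs.integrable_pairing hs0 u u
  simp only [e] at hint
  have hint' := hint.re
  simp only [RCLike.re_to_complex, Complex.ofReal_re] at hint'
  unfold fracLaplacianPairing
  simp only [e]
  rw [integral_complex_ofReal, Complex.ofReal_re]
  have h := lintegral_diffq_eq hs0 hs1 hn (Hs.toL2 u)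
  change ENNReal.ofReal (halfConst n s) * _ = _ at h
  rw [integral_sq_eq_norm_sq (Hs.isHs hs0 hs1 hn u).memLp_diffq,
    ← ENNReal.ofReal_mul hκ.le] at h
  have h2 : ∫⁻ ξ, ENNReal.ofReal ((2 * Real.pi * ‖ξ‖) ^ (2 * s)) * ‖fourierL2 (Hs.toL2 u) ξ‖ₑ ^ 2
      = ENNReal.ofReal (∫ ξ, (2 * Real.pi * ‖ξ‖) ^ (2 * s) * ‖Hs.fourier u ξ‖ ^ 2) := by
    rw [ofReal_integral_eq_lintegral_ofReal hint'
      (Filter.Eventually.of_forall fun x => by positivity)]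
    refine lintegral_congr fun ξ => ?_
    rw [ENNReal.ofReal_mul (by positivity), ENNReal.ofReal_pow (norm_nonneg _), ofReal_norm]
    rfl
  rw [h2] at h
  exact ((ENNReal.ofReal_eq_ofReal_iff
    (mul_nonneg hκ.le (integral_nonneg fun _ => sq_nonneg _))
    (integral_nonneg fun _ => by positivity)).1 h).symm

/-- The form `∫∫ a(x) a(y) Du Dv` of difference quotients. -/
def dqForm (s : ℝ) (a u v : Sp n → ℝ) : ℝ :=
  ∫ z, a z.1 * a z.2 * (diffq s u z * diffq s v z) ∂vol2 n

/-- Polarization of `Hs.pairing_self`: both sides expand in the same way at w + v. -/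
theorem Hs.pairing_eq (hs0 : 0 < s) (hs1 : s < 1) (hn : 0 < n) (w v : Hs n s) :
    fracLaplacianPairing w v = halfConst n s * ∫ z, diffq s w z * diffq s v z ∂vol2 n := by
  have h := Hs.pairing_add_self hs0 w v
  rw [Hs.pairing_self hs0 hs1 hn, Hs.pairing_self hs0 hs1 hn, Hs.pairing_self hs0 hs1 hn] at h
  have hw := (Hs.isHs hs0 hs1 hn w).memLp_diffq
  have hv := (Hs.isHs hs0 hs1 hn v).memLp_diffq
  have e : ∫ z, diffq s ((w + v : Hs n s) : Sp n → ℝ) z ^ 2 ∂vol2 n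
      = (∫ z, diffq s w z ^ 2 ∂vol2 n) + 2 * (∫ z, diffq s w z * diffq s v z ∂vol2 n)
        + ∫ z, diffq s v z ^ 2 ∂vol2 n := by
    refine Eq.trans ?_ (integral_add_two_mul_add hw.integrable_sq (hw.integrable_mul hv)
      hv.integrable_sq)
    refine integral_congr_ae ?_
    filter_upwards [diffq_congr_ae s (Hs.coeFn_add w v)] with z hz
    rw [hz, diffq_add]
    ring
  rw [e] at h
  linarith

theorem Hs.parallelogram (u v : Hs n s) :
    ‖u + v‖ * ‖u + v‖ + ‖u - v‖ * ‖u - v‖ = 2 * (‖u‖ * ‖u‖ + ‖v‖ * ‖v‖) := by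
  simp only [Hs.norm_eq, map_add, map_sub]
  simpa only [sq] using parallelogram_law_with_norm ℂ (Hs.weightedFourier u) (Hs.weightedFourier v)

/-- The isometry `Hs.weightedFourier` does not reach all of `L²`, since only real functions are
transformed. So the limit h of the weighted transforms is matched with the real `L²` limit U of the
functions themselves: the transform of U must be h divided by the weight. -/
theorem Hs.completeSpace (hs0 : 0 < s) : CompleteSpace (Hs n s) := by
  refine Metric.complete_of_cauchySeq_tendsto fun u hu => ?_
  have hwc : CauchySeq fun k => Hs.weightedFourier (u k) := by
    rw [Metric.cauchySeq_iff] at hu ⊢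
    intro ε hε
    obtain ⟨N, hN⟩ := hu ε hε
    refine ⟨N, fun i hi j hj => ?_⟩
    have := hN i hi j hj
    rwa [dist_eq_norm, Hs.norm_eq, map_sub, ← dist_eq_norm] at this
  have huc : CauchySeq fun k => Hs.toL2 (u k) := by
    rw [Metric.cauchySeq_iff] at hu ⊢
    intro ε hε
    obtain ⟨N, hN⟩ := hu ε hε
    refine ⟨N, fun i hi j hj => ?_⟩
    have := hN i hi j hj
    rw [dist_eq_norm] at this ⊢
    rw [← map_sub]
    exact (Hs.norm_toL2_le hs0 _).trans_lt this
  obtain ⟨h, hh⟩ := cauchySeq_tendsto_of_complete hwc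
  obtain ⟨U, hU⟩ := cauchySeq_tendsto_of_complete huc
  have hw1 : ∀ ξ : Sp n, 1 ≤ ‖weight s ξ‖ := fun ξ => by
    have : (1 : ℝ) ≤ (1 + (2 * Real.pi * ‖ξ‖) ^ 2) ^ (s / 2) :=
      Real.one_le_rpow (by nlinarith [sq_nonneg (2 * Real.pi * ‖ξ‖)]) (by positivity)
    rwa [weight, Complex.norm_real, Real.norm_of_nonneg (by positivity)]
  have hw0 : ∀ ξ : Sp n, weight s ξ ≠ 0 := fun ξ => norm_pos_iff.1 (zero_lt_one.trans_le (hw1 ξ))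
  have hHm : MemLp (fun ξ => (weight s ξ)⁻¹ * h ξ) 2 volume := by
    refine (Lp.memLp h).of_le ((measurable_weight s).inv.aestronglyMeasurable.mul
      (Lp.aestronglyMeasurable _)) (Filter.Eventually.of_forall fun ξ => ?_)
    rw [norm_mul, norm_inv]
    exact mul_le_of_le_one_left (norm_nonneg _) (inv_le_one_of_one_le₀ (hw1 ξ))
  have hlim : Filter.Tendsto (fun k => fourierL2 (Hs.toL2 (u k))) Filter.atTop (𝓝 (hHm.toLp _)) := by
    rw [tendsto_iff_norm_sub_tendsto_zero] at hh ⊢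
    refine squeeze_zero (fun _ => norm_nonneg _) (fun k => ?_) hh
    refine Lp.norm_le_norm_of_ae_le ?_
    filter_upwards [Lp.coeFn_sub (fourierL2 (Hs.toL2 (u k))) (hHm.toLp _),
      Lp.coeFn_sub (Hs.weightedFourier (u k)) h, hHm.coeFn_toLp,
      Hs.coeFn_weightedFourier (u k)] with ξ h1 h2 h3 h4
    rw [h1, h2, Pi.sub_apply, Pi.sub_apply, h3, h4]
    have e : weight s ξ * Hs.fourier (u k) ξ - h ξ
        = weight s ξ * (fourierL2 (Hs.toL2 (u k)) ξ - (weight s ξ)⁻¹ * h ξ) := by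
      rw [mul_sub, mul_inv_cancel_left₀ (hw0 ξ)]; rfl
    rw [e, norm_mul]
    exact le_mul_of_one_le_left (norm_nonneg _) (hw1 ξ)
  have hcont : Continuous (fourierL2 (n := n)) := by
    refine AddMonoidHomClass.continuous_of_bound fourierL2 1 fun x => ?_
    rw [norm_fourierL2, one_mul]
  have hFU : fourierL2 U = hHm.toLp _ :=
    tendsto_nhds_unique ((hcont.tendsto U).comp hU) hlim
  have hae : (fun ξ => weight s ξ * fourierL2 U ξ) =ᵐ[volume] h := by
    rw [hFU]
    filter_upwards [hHm.coeFn_toLp] with ξ h3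
    rw [h3, mul_inv_cancel_left₀ (hw0 ξ)]
  have hmem : U ∈ hsSubmodule n s := (memLp_congr_ae hae).2 (Lp.memLp h)
  let W : Hs n s := ⟨U, hmem⟩
  refine ⟨W, ?_⟩
  rw [tendsto_iff_norm_sub_tendsto_zero] at hh ⊢
  refine hh.congr fun k => ?_
  rw [Hs.norm_eq, map_sub]
  congr 2
  refine Lp.ext ?_
  filter_upwards [hae, Hs.coeFn_weightedFourier W] with ξ h1 h2
  rw [h2, ← h1]; rfl

/-! ### Products in `H^s` and the Poincaré inequality -/

/-- In polar coordinates the integrand is at most a multiple of r^{1-2s} near 0 and of r^{-1-2s} at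
infinity; these are integrable for s < 1 and s > 0 respectively. -/
theorem integrable_min_mul_rpow (hs0 : 0 < s) (hs1 : s < 1) (hn : 0 < n) {A B : ℝ} (hA : 0 ≤ A)
    (hB : 0 ≤ B) :
    Integrable fun z : Sp n => min A (B * ‖z‖ ^ 2) * ‖z‖ ^ (-((n : ℝ) + 2 * s)) := by
  have : Nonempty (Fin n) := ⟨⟨0, hn⟩⟩
  have hm : ∀ S : Set ℝ, AEStronglyMeasurable
      (fun r : ℝ => r ^ (n - 1) • (min A (B * r ^ 2) * r ^ (-((n : ℝ) + 2 * s))))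
      (volume.restrict S) := fun S => Measurable.aestronglyMeasurable (by fun_prop)
  have key : ∀ r : ℝ, 0 < r → ‖r ^ (n - 1) • (min A (B * r ^ 2) * r ^ (-((n : ℝ) + 2 * s)))‖
      = min A (B * r ^ 2) * r ^ (-1 - 2 * s) := by
    intro r hr
    have hmin : 0 ≤ min A (B * r ^ 2) := le_min hA (by positivity)
    rw [Real.norm_of_nonneg (by positivity), smul_eq_mul, ← Real.rpow_natCast,
      Nat.cast_sub (by omega : 1 ≤ n), mul_left_comm, ← Real.rpow_add hr]
    congr 2
    push_cast; ring
  refine (integrable_fun_norm_addHaar (volume : Measure (Sp n))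
    (f := fun r => min A (B * r ^ 2) * r ^ (-((n : ℝ) + 2 * s)))).2 ?_
  rw [finrank_euclideanSpace_fin, ← Set.Ioc_union_Ioi_eq_Ioi (zero_le_one (α := ℝ)),
    integrableOn_union]
  constructor
  · have h : IntegrableOn (fun r : ℝ => B * r ^ (1 - 2 * s)) (Set.Ioc 0 1) := by
      have := intervalIntegral.intervalIntegrable_rpow' (a := 0) (b := 1) (r := 1 - 2 * s)
        (by linarith)
      rw [intervalIntegrable_iff_integrableOn_Ioc_of_le zero_le_one] at this
      exact this.const_mul B
    refine Integrable.mono' h (hm _) ?_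
    filter_upwards [ae_restrict_mem measurableSet_Ioc] with r hr
    rw [key r hr.1]
    calc _ ≤ (B * r ^ 2) * r ^ (-1 - 2 * s) :=
          mul_le_mul_of_nonneg_right (min_le_right _ _) (Real.rpow_nonneg hr.1.le _)
      _ = _ := by
        rw [mul_assoc, ← Real.rpow_natCast, ← Real.rpow_add hr.1]
        congr 2
        push_cast; ring
  · have h : IntegrableOn (fun r : ℝ => A * r ^ (-1 - 2 * s)) (Set.Ioi 1) :=
      (integrableOn_Ioi_rpow_of_lt (by linarith) zero_lt_one).const_mul A
    refine Integrable.mono' h (hm _) ?_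
    filter_upwards [ae_restrict_mem measurableSet_Ioi] with r hr
    have hr' : (0 : ℝ) < r := zero_lt_one.trans hr
    rw [key r hr']
    exact mul_le_mul_of_nonneg_right (min_le_left _ _) (Real.rpow_nonneg hr'.le _)

/-- Bounded Lipschitz functions. -/
structure BddLip (ψ : Sp n → ℝ) : Prop where
  bdd : ∃ b, ∀ x, |ψ x| ≤ b
  lip : ∃ L : ℝ≥0, LipschitzWith L ψ

theorem BddLip.measurable {ψ : Sp n → ℝ} (h : BddLip ψ) : Measurable ψ := by
  obtain ⟨L, hL⟩ := h.lip
  exact hL.continuous.measurable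

/-- The squared increment is at most min((2b)², L²|z|²), a bound free of x. -/
theorem BddLip.lintegral_diffq (hs0 : 0 < s) (hs1 : s < 1) (hn : 0 < n) {ψ : Sp n → ℝ}
    (h : BddLip ψ) : ∃ C : ℝ≥0∞, C ≠ ⊤ ∧ ∀ x, ∫⁻ y, ‖diffq s ψ (x, y)‖ₑ ^ 2 ≤ C := by
  obtain ⟨b, hb⟩ := h.bdd
  obtain ⟨L, hL⟩ := h.lip
  have hI := integrable_min_mul_rpow hs0 hs1 hn (A := (2 * b) ^ 2) (B := (L : ℝ) ^ 2)
    (sq_nonneg _) (sq_nonneg _)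
  refine ⟨_, hI.lintegral_lt_top.ne, fun x => ?_⟩
  rw [← lintegral_add_left_eq_self _ x]
  refine lintegral_mono_ae ?_
  filter_upwards [ae_ne_of_pos hn 0] with z hz
  rw [diffq_sq _ _ _ _ (by simpa using hz), add_sub_cancel_left,
    ENNReal.ofReal_mul (le_min (sq_nonneg _) (by positivity)), ← ofReal_norm,
    ← ENNReal.ofReal_pow (norm_nonneg _)]
  gcongr
  refine le_min ?_ ?_
  · gcongr
    calc ‖ψ (x + z) - ψ x‖ ≤ ‖ψ (x + z)‖ + ‖ψ x‖ := norm_sub_le _ _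
      _ ≤ b + b := add_le_add (hb _) (hb _)
      _ = 2 * b := by ring
  · rw [← mul_pow]
    gcongr
    simpa using hL.norm_sub_le (x + z) x

theorem diffq_swap_sq (u : Sp n → ℝ) (z : Sp n × Sp n) :
    ‖diffq s u z.swap‖ₑ = ‖diffq s u z‖ₑ := by
  rw [← ofReal_norm, ← ofReal_norm, diffq, diffq, norm_mul, norm_mul, Prod.fst_swap, Prod.snd_swap,
    norm_sub_rev, norm_sub_rev z.1]

theorem aestronglyMeasurable_diffq {u : Sp n → ℝ} (hu : AEStronglyMeasurable u) :
    AEStronglyMeasurable (diffq s u) (vol2 n) :=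
  (measurable_diffq s hu.stronglyMeasurable_mk.measurable).aestronglyMeasurable.congr
    (diffq_congr_ae s hu.ae_eq_mk.symm)

theorem BddLip.memLp_mul_diffq (hs0 : 0 < s) (hs1 : s < 1) (hn : 0 < n) {ψ : Sp n → ℝ}
    (h : BddLip ψ) {u : Sp n → ℝ} (hu : MemLp u 2) :
    MemLp (fun z => u z.1 * diffq s ψ z) 2 (vol2 n) := by
  obtain ⟨C, hC, hK⟩ := h.lintegral_diffq hs0 hs1 hn
  have hm : AEStronglyMeasurable (fun z : Sp n × Sp n => u z.1 * diffq s ψ z) (vol2 n) :=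
    hu.1.comp_fst.mul (measurable_diffq s h.measurable).aestronglyMeasurable
  refine memLp_two_of_lintegral hm ?_
  have hm2 : AEMeasurable (fun z : Sp n × Sp n => ‖u z.1 * diffq s ψ z‖ₑ ^ 2) (vol2 n) :=
    hm.enorm.pow_const 2
  rw [lintegral_prod _ hm2]
  calc _ ≤ ∫⁻ x, ‖u x‖ₑ ^ 2 * C := by
        refine lintegral_mono fun x => ?_
        simp only [enorm_mul, mul_pow]
        rw [lintegral_const_mul' _ _ (by simp)]
        gcongr
        exact hK x
    _ < ⊤ := by
        rw [lintegral_mul_const' _ _ hC]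
        exact ENNReal.mul_lt_top (MemLp.lintegral_sq_lt_top hu) hC.lt_top

theorem memLp_bdd_mul {α : Type*} [MeasurableSpace α] {μ : Measure α} {f g : α → ℝ} {p : ℝ≥0∞}
    (hf : MemLp f p μ) (hg : AEStronglyMeasurable g μ) {b : ℝ} (hb : ∀ᵐ x ∂μ, |g x| ≤ b) :
    MemLp (fun x => g x * f x) p μ := by
  refine (hf.const_mul b).of_le (hg.mul hf.1) ?_
  filter_upwards [hb] with x hx
  rw [norm_mul, norm_mul]
  gcongr
  exact hx.trans (le_abs_self b)

/-- Leibniz rule D(ψu) = ψ(y) Du + u(x) Dψ. In the second term y is integrated first, using the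
bound on Dψ uniform in x. -/
theorem IsHs.lip_mul (hs0 : 0 < s) (hs1 : s < 1) (hn : 0 < n) {ψ u : Sp n → ℝ}
    (h : BddLip ψ) (hu : IsHs s u) : IsHs s fun x => ψ x * u x := by
  obtain ⟨b, hb⟩ := h.bdd
  refine ⟨memLp_bdd_mul hu.memLp h.measurable.aestronglyMeasurable (.of_forall hb), ?_⟩
  have h1 : MemLp (fun z : Sp n × Sp n => ψ z.2 * diffq s u z) 2 (vol2 n) :=
    memLp_bdd_mul hu.memLp_diffq (h.measurable.comp measurable_snd).aestronglyMeasurable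
      (.of_forall fun z => hb z.2)
  refine (memLp_congr_ae (.of_forall fun z => ?_)).1
    (h1.add (h.memLp_mul_diffq hs0 hs1 hn hu.memLp))
  simp only [Pi.add_apply, diffq]; ring

/-- The same Leibniz rule, with each undifferentiated factor bounded. Products of unbounded elements
of `H^s` need not lie in `H^s`, which is why the reduction goes through the truncations `clip`. -/
theorem IsHs.mul_of_bdd {u v : Sp n → ℝ} (hu : IsHs s u) (hv : IsHs s v) {b c : ℝ}
    (hb : ∀ x, |u x| ≤ b) (hc : ∀ x, |v x| ≤ c) : IsHs s fun x => u x * v x := by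
  refine ⟨memLp_bdd_mul hv.memLp hu.memLp.1 (.of_forall hb), ?_⟩
  have h1 : MemLp (fun z : Sp n × Sp n => u z.2 * diffq s v z) 2 (vol2 n) :=
    memLp_bdd_mul hv.memLp_diffq hu.memLp.1.comp_snd (.of_forall fun z => hb z.2)
  have h2 : MemLp (fun z : Sp n × Sp n => v z.1 * diffq s u z) 2 (vol2 n) :=
    memLp_bdd_mul hu.memLp_diffq hv.memLp.1.comp_fst (.of_forall fun z => hc z.1)
  refine (memLp_congr_ae (.of_forall fun z => ?_)).1 (h1.add h2)
  simp only [Pi.add_apply, diffq]; ring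

theorem IsHs.add {u v : Sp n → ℝ} (hu : IsHs s u) (hv : IsHs s v) : IsHs s fun x => u x + v x :=
  ⟨hu.memLp.add hv.memLp, (memLp_congr_ae (.of_forall fun z => (diffq_add u v z).symm)).1
    (hu.memLp_diffq.add hv.memLp_diffq)⟩

theorem IsHs.const_mul {u : Sp n → ℝ} (hu : IsHs s u) (c : ℝ) : IsHs s fun x => c * u x :=
  ⟨hu.memLp.const_mul c, (memLp_congr_ae (.of_forall fun z => (diffq_const_mul c u z).symm)).1
    (hu.memLp_diffq.const_mul c)⟩

/-- Truncation at height `N`. -/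
def clip (N : ℝ) (u : Sp n → ℝ) (x : Sp n) : ℝ := max (-N) (min N (u x))

theorem abs_clip_le {N : ℝ} (hN : 0 ≤ N) (u : Sp n → ℝ) (x : Sp n) : |clip N u x| ≤ N := by
  rw [abs_le]
  exact ⟨le_max_left _ _, max_le (by linarith) (min_le_left _ _)⟩

theorem abs_clip_le_abs {N : ℝ} (hN : 0 ≤ N) (u : Sp n → ℝ) (x : Sp n) : |clip N u x| ≤ |u x| := by
  unfold clip
  rcases abs_cases (u x) with h | h <;> rw [abs_le] <;> constructor <;>
    simp only [le_max_iff, le_min_iff, max_le_iff, min_le_iff] <;> grind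

theorem abs_clip_sub_le (N : ℝ) (u : Sp n → ℝ) (x y : Sp n) :
    |clip N u y - clip N u x| ≤ |u y - u x| := by
  unfold clip
  calc |max (-N) (min N (u y)) - max (-N) (min N (u x))| ≤ |min N (u y) - min N (u x)| := by
        simpa [max_comm] using abs_max_sub_max_le_abs (min N (u y)) (min N (u x)) (-N)
    _ ≤ _ := by
        simpa [min_comm] using abs_min_sub_min_le_max N (u y) N (u x)

theorem abs_diffq_clip_le (N : ℝ) (u : Sp n → ℝ) (z : Sp n × Sp n) :
    |diffq s (clip N u) z| ≤ |diffq s u z| := by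
  simp only [diffq, abs_mul]
  exact mul_le_mul_of_nonneg_right (abs_clip_sub_le N u z.1 z.2) (abs_nonneg _)

theorem aestronglyMeasurable_clip (N : ℝ) {u : Sp n → ℝ} (hu : AEStronglyMeasurable u) :
    AEStronglyMeasurable (clip N u) := by
  have : Continuous fun t : ℝ => max (-N) (min N t) := by fun_prop
  exact this.comp_aestronglyMeasurable hu

theorem IsHs.clip {N : ℝ} (hN : 0 ≤ N) {u : Sp n → ℝ} (hu : IsHs s u) : IsHs s (clip N u) := by
  have hm := aestronglyMeasurable_clip N hu.memLp.1
  exact ⟨hu.memLp.of_le hm (.of_forall fun x => abs_clip_le_abs hN u x),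
    hu.memLp_diffq.of_le (aestronglyMeasurable_diffq hm)
      (.of_forall fun z => abs_diffq_clip_le N u z)⟩

theorem clip_eq {N : ℝ} {u : Sp n → ℝ} {x : Sp n} (h : |u x| ≤ N) : FracCalderon.clip N u x = u x := by
  rw [abs_le] at h
  unfold FracCalderon.clip
  rw [min_eq_right h.2, max_eq_right h.1]

theorem tendsto_clip (u : Sp n → ℝ) (x : Sp n) :
    Filter.Tendsto (fun N : ℕ => FracCalderon.clip (N : ℝ) u x) Filter.atTop (𝓝 (u x)) := by
  refine tendsto_const_nhds.congr' ?_
  obtain ⟨N, hN⟩ := exists_nat_ge |u x|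
  filter_upwards [Filter.eventually_ge_atTop N] with k hk
  exact (clip_eq (hN.trans (by exact_mod_cast hk))).symm

theorem bddLip_of_contDiff {ψ : Sp n → ℝ} (h1 : ContDiff ℝ ∞ ψ) (h2 : HasCompactSupport ψ) :
    BddLip ψ := by
  refine ⟨?_, ?_⟩
  · obtain ⟨C, hC⟩ := h2.exists_bound_of_continuous h1.continuous
    exact ⟨C, hC⟩
  · obtain ⟨C, hC⟩ := ContDiff.lipschitzWith_of_hasCompactSupport h2 h1 (by simp)
    exact ⟨C, hC⟩

theorem BddLip.isHs (hs0 : 0 < s) (hs1 : s < 1) (hn : 0 < n) {ψ : Sp n → ℝ} (h : BddLip ψ)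
    (hc : HasCompactSupport ψ) : IsHs s ψ := by
  have hcont : Continuous ψ := h.lip.elim fun L hL => hL.continuous
  refine ⟨hcont.memLp_of_hasCompactSupport hc, ?_⟩
  obtain ⟨C, hC, hK⟩ := h.lintegral_diffq hs0 hs1 hn
  have hm := measurable_diffq s h.measurable
  refine memLp_two_of_lintegral hm.aestronglyMeasurable ?_
  have hB : MeasurableSet (tsupport ψ) := hc.isCompact.isClosed.measurableSet
  let F : Sp n × Sp n → ℝ≥0∞ := fun z => (tsupport ψ).indicator 1 z.1 * ‖diffq s ψ z‖ₑ ^ 2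
  have hFm : Measurable F :=
    ((measurable_one.indicator hB).comp measurable_fst).mul (by fun_prop)
  have hF : ∫⁻ z, F z ∂vol2 n < ⊤ := by
    rw [lintegral_prod _ hFm.aemeasurable]
    calc _ ≤ ∫⁻ x, (tsupport ψ).indicator 1 x * C := by
          refine lintegral_mono fun x => ?_
          simp only [F]
          rw [lintegral_const_mul _ (by fun_prop)]
          gcongr
          exact hK x
      _ < ⊤ := by
          rw [lintegral_mul_const' _ _ hC, lintegral_indicator_one hB]
          exact ENNReal.mul_lt_top hc.isCompact.measure_lt_top hC.lt_top
  -- The quotient vanishes unless one of the two points lies in the support, and it is symmetric up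
  -- to sign.
  have hle : ∀ z, ‖diffq s ψ z‖ₑ ^ 2 ≤ F z + F z.swap := by
    intro z
    simp only [F, Prod.fst_swap, diffq_swap_sq, ← add_mul]
    by_cases h1 : z.1 ∈ tsupport ψ
    · rw [Set.indicator_of_mem h1]
      exact le_mul_of_one_le_left (by positivity) (by simp)
    by_cases h2 : z.2 ∈ tsupport ψ
    · rw [Set.indicator_of_mem h2]
      exact le_mul_of_one_le_left (by positivity) (by simp)
    · simp [diffq, image_eq_zero_of_notMem_tsupport h1, image_eq_zero_of_notMem_tsupport h2]
  refine (lintegral_mono hle).trans_lt ?_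
  rw [lintegral_add_left hFm, show ∫⁻ z, F z.swap ∂vol2 n = ∫⁻ z, F z ∂vol2 n from
    Measure.measurePreserving_swap.lintegral_comp hFm]
  exact ENNReal.add_lt_top.2 ⟨hF, hF⟩

/-- The algebraic core of the Liouville reduction: a purely pointwise identity, in which the weight
a(x)a(y) of the conductivity form appears by itself. -/
theorem diffq_mul_mul (a u v : Sp n → ℝ) (z : Sp n × Sp n) :
    diffq s (fun x => a x * u x) z * diffq s (fun x => a x * v x) z
      = a z.1 * a z.2 * (diffq s u z * diffq s v z)
        + diffq s a z * diffq s (fun x => a x * (u x * v x)) z := by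
  simp only [diffq]; ring

/-- Fractional Poincaré inequality for functions vanishing outside a bounded set. -/
theorem exists_poincare (hs0 : 0 < s) (hn : 0 < n) {Ω : Set (Sp n)}
    (hΩ : Bornology.IsBounded Ω) : ∃ C : ℝ, 0 < C ∧ ∀ u : Sp n → ℝ, IsHs s u →
      (∀ᵐ x, x ∉ Ω → u x = 0) → ∫ x, u x ^ 2 ≤ C * ∫ z, diffq s u z ^ 2 ∂vol2 n := by
  have : Nonempty (Fin n) := ⟨⟨0, hn⟩⟩
  obtain ⟨R, hR0, hR⟩ := hΩ.subset_ball_lt 0 0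
  -- The ball of radius R about c lies outside the ball of radius R about 0, which contains Ω. There
  -- u = 0, and its points are at distance at most 5R from those of Ω, so integrating the difference
  -- quotient over y in this ball alone already dominates u(x)².
  obtain ⟨c, hc⟩ : ∃ c : Sp n, ‖c‖ = 3 * R := by
    obtain ⟨c, hc⟩ := exists_norm_eq (Sp n) (c := 3 * R) (by positivity)
    exact ⟨c, hc⟩
  set V : ℝ≥0∞ := volume (Metric.ball c R)
  have hV0 : V ≠ 0 := (Metric.measure_ball_pos volume c hR0).ne'
  have hVt : V ≠ ⊤ := measure_ball_lt_top.ne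
  set k : ℝ≥0∞ := ENNReal.ofReal ((5 * R) ^ (-((n : ℝ) + 2 * s)))
  have hk0 : k ≠ 0 := by simp only [k, ne_eq, ENNReal.ofReal_eq_zero, not_le]; positivity
  have hkt : k ≠ ⊤ := ENNReal.ofReal_ne_top
  have hD0 : k * V ≠ 0 := mul_ne_zero hk0 hV0
  have hDt : k * V ≠ ⊤ := ENNReal.mul_ne_top hkt hVt
  have hDpos : 0 < (k * V).toReal := ENNReal.toReal_pos hD0 hDt
  refine ⟨(k * V).toReal⁻¹, inv_pos.2 hDpos, fun u hu h0 => ?_⟩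
  have hp : ∫⁻ x, ‖u x‖ₑ ^ 2 * (k * V) ≤ ∫⁻ z, ‖diffq s u z‖ₑ ^ 2 ∂vol2 n := by
    rw [lintegral_prod _ (hu.memLp_diffq.1.enorm.pow_const 2)]
    refine lintegral_mono_ae ?_
    filter_upwards [h0] with x hx
    by_cases hxΩ : x ∈ Ω
    swap
    · simp [hx hxΩ]
    have hxR : ‖x‖ < R := by simpa using hR hxΩ
    calc ‖u x‖ₑ ^ 2 * (k * V) = ∫⁻ y in Metric.ball c R, ‖u x‖ₑ ^ 2 * k := by
          rw [setLIntegral_const, mul_assoc]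
      _ ≤ ∫⁻ y in Metric.ball c R, ‖diffq s u (x, y)‖ₑ ^ 2 := by
          refine lintegral_mono_ae ?_
          filter_upwards [ae_restrict_mem Metric.isOpen_ball.measurableSet,
            ae_restrict_of_ae h0] with y hy hy0
          rw [mem_ball_iff_norm] at hy
          have hy1 : ‖c‖ - ‖y‖ ≤ ‖y - c‖ := by rw [norm_sub_rev]; exact norm_sub_norm_le _ _
          have hy2 : ‖y‖ - ‖c‖ ≤ ‖y - c‖ := norm_sub_norm_le _ _
          have hyΩ : y ∉ Ω := fun hyΩ => by
            have : ‖y‖ < R := by simpa using hR hyΩ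
            linarith
          have hyx : ‖y‖ - ‖x‖ ≤ ‖y - x‖ := norm_sub_norm_le _ _
          have hyx2 : ‖y - x‖ ≤ ‖y‖ + ‖x‖ := norm_sub_le _ _
          have hpos : 0 < ‖y - x‖ := by linarith
          rw [diffq_sq _ _ _ _ (sub_ne_zero.1 (norm_pos_iff.1 hpos)), hy0 hyΩ, zero_sub, enorm_neg]
          have hn0 : (0 : ℝ) ≤ n := Nat.cast_nonneg n
          have h5 := Real.rpow_le_rpow_of_nonpos hpos (show ‖y - x‖ ≤ 5 * R by linarith)
            (show -((n : ℝ) + 2 * s) ≤ 0 by linarith)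
          gcongr
          exact ENNReal.ofReal_le_ofReal h5
      _ ≤ _ := setLIntegral_le_lintegral _ _
  rw [lintegral_mul_const' _ _ hDt, integral_sq_eq_norm_sq hu.memLp,
    integral_sq_eq_norm_sq hu.memLp_diffq, ← ENNReal.ofReal_toReal hDt,
    ← ENNReal.ofReal_mul (integral_nonneg fun _ => sq_nonneg _),
    ENNReal.ofReal_le_ofReal_iff (integral_nonneg fun _ => sq_nonneg _)] at hp
  rw [inv_mul_eq_div, le_div_iff₀ hDpos]
  exact hp

/-! ### The critical Sobolev embedding -/

theorem exists_lintegral_ball_rpow_le (hsn : 2 * s < n) (hn : 0 < n) :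
    ∃ c : ℝ, 0 < c ∧ ∀ A : ℝ, 0 < A →
      ∫⁻ ξ in Metric.closedBall (0 : Sp n) A, ENNReal.ofReal (‖ξ‖ ^ (-(2 * s)))
        ≤ ENNReal.ofReal (c * A ^ ((n : ℝ) - 2 * s)) := by
  have : Nonempty (Fin n) := ⟨⟨0, hn⟩⟩
  set V : ℝ := (volume : Measure (Sp n)).real (Metric.ball 0 1)
  have hvol : 0 ≤ V := measureReal_nonneg
  have hd : 0 < (n : ℝ) - 2 * s := by linarith
  -- The summand 1 only makes the constant visibly positive, V being known here just to be
  -- nonnegative.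
  refine ⟨n * V / ((n : ℝ) - 2 * s) + 1, by positivity, fun A hA => ?_⟩
  let f : ℝ → ℝ := (Set.Iic A).indicator fun r => r ^ (-(2 * s))
  have hf0 : ∀ r, 0 ≤ r → 0 ≤ f r := fun r hr =>
    by
    simp only [f, Set.indicator]
    split_ifs
    · exact Real.rpow_nonneg hr _
    · exact le_rfl
  have e : ∀ r ∈ Set.Ioi (0 : ℝ), r ^ (n - 1) • f r
      = (Set.Ioc 0 A).indicator (fun r => r ^ ((n : ℝ) - 2 * s - 1)) r := by
    intro r hr
    have hr : (0 : ℝ) < r := hr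
    simp only [f, Set.indicator, Set.mem_Iic, Set.mem_Ioc, hr, true_and, smul_eq_mul]
    split_ifs
    · rw [← Real.rpow_natCast, ← Real.rpow_add hr, Nat.cast_sub (by omega : 1 ≤ n)]
      congr 1
      push_cast; ring
    · simp
  have hi : IntegrableOn (fun r : ℝ => r ^ ((n : ℝ) - 2 * s - 1)) (Set.Ioc 0 A) := by
    have := intervalIntegral.intervalIntegrable_rpow' (a := 0) (b := A)
      (r := (n : ℝ) - 2 * s - 1) (by linarith)
    rwa [intervalIntegrable_iff_integrableOn_Ioc_of_le hA.le] at this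
  have hint : Integrable fun ξ : Sp n => f ‖ξ‖ := by
    rw [integrable_fun_norm_addHaar, finrank_euclideanSpace_fin,
      integrableOn_congr_fun e measurableSet_Ioi]
    exact ((integrable_indicator_iff measurableSet_Ioc).2 hi).integrableOn
  have hval : ∫ ξ : Sp n, f ‖ξ‖ = n * V / ((n : ℝ) - 2 * s) * A ^ ((n : ℝ) - 2 * s) := by
    rw [integral_fun_norm_addHaar, finrank_euclideanSpace_fin,
      setIntegral_congr_fun measurableSet_Ioi e, setIntegral_indicator measurableSet_Ioc,
      Set.inter_eq_right.2 Set.Ioc_subset_Ioi_self, ← intervalIntegral.integral_of_le hA.le,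
      integral_rpow (Or.inl (by linarith)), sub_add_cancel, Real.zero_rpow hd.ne']
    simp only [nsmul_eq_mul, smul_eq_mul, sub_zero]
    ring
  calc _ = ∫⁻ ξ : Sp n, ENNReal.ofReal (f ‖ξ‖) := by
        rw [← lintegral_indicator Metric.isClosed_closedBall.measurableSet]
        refine lintegral_congr fun ξ => ?_
        simp only [f, Set.indicator, mem_closedBall_zero_iff, Set.mem_Iic]
        split_ifs <;> simp
    _ = ENNReal.ofReal (n * V / ((n : ℝ) - 2 * s) * A ^ ((n : ℝ) - 2 * s)) := by
        rw [← ofReal_integral_eq_lintegral_ofReal hint (.of_forall fun ξ => hf0 _ (norm_nonneg _)),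
          hval]
    _ ≤ _ := by
        gcongr
        linarith

theorem lintegral_mul_sq_le {α : Type*} [MeasurableSpace α] {μ : Measure α} {f g : α → ℝ≥0∞}
    (hf : AEMeasurable f μ) (hg : AEMeasurable g μ) :
    (∫⁻ x, f x * g x ∂μ) ^ 2 ≤ (∫⁻ x, f x ^ 2 ∂μ) * ∫⁻ x, g x ^ 2 ∂μ := by
  have h := ENNReal.lintegral_mul_le_Lp_mul_Lq μ Real.HolderConjugate.two_two hf hg
  calc _ ≤ ((∫⁻ x, f x ^ (2 : ℝ) ∂μ) ^ (1 / 2 : ℝ) * (∫⁻ x, g x ^ (2 : ℝ) ∂μ) ^ (1 / 2 : ℝ)) ^ 2 :=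
        pow_le_pow_left' h 2
    _ = _ := by
      rw [mul_pow, ← ENNReal.rpow_natCast, ← ENNReal.rpow_natCast, ← ENNReal.rpow_mul,
        ← ENNReal.rpow_mul]
      norm_num

theorem norm_fourierInv_le (h : Sp n → ℂ) (x : Sp n) : ‖𝓕⁻ h x‖ ≤ ∫ ξ, ‖h ξ‖ := by
  rw [Real.fourierInv_eq]
  refine (norm_integral_le_integral_norm _).trans (le_of_eq ?_)
  congr 1
  ext ξ
  rw [Circle.norm_smul]

/-- Splitting of the frequencies at `A`. -/
theorem measure_lt_le_of_split (U : L2C n) {A B t : ℝ} (ht : 0 < t) (hBt : B ≤ t / 2) (hB : 0 ≤ B)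
    (hU : ∫⁻ ξ in Metric.closedBall (0 : Sp n) A, ‖(𝓕 U : L2C n) ξ‖ₑ ≤ ENNReal.ofReal B) :
    volume {x | t < ‖U x‖} * ENNReal.ofReal (t ^ 2 / 4)
      ≤ ∫⁻ ξ in (Metric.closedBall (0 : Sp n) A)ᶜ, ‖(𝓕 U : L2C n) ξ‖ₑ ^ 2 := by
  have hms : MeasurableSet (Metric.closedBall (0 : Sp n) A) :=
    Metric.isClosed_closedBall.measurableSet
  -- The low frequencies contribute a function L with |L| ≤ B ≤ t/2, so |U| > t forces |U - L| ≥
  -- t/2. Chebyshev and Plancherel for the high frequencies finish.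
  set h : Sp n → ℂ := (Metric.closedBall (0 : Sp n) A).indicator (𝓕 U : L2C n) with hh
  have h2 : MemLp h 2 := (Lp.memLp (𝓕 U : L2C n)).indicator hms
  have hl : ∫⁻ ξ, ‖h ξ‖ₑ ≤ ENNReal.ofReal B := by
    rw [hh]
    simp_rw [enorm_indicator_eq_indicator_enorm]
    rwa [lintegral_indicator hms]
  have h1 : Integrable h := ⟨h2.1, hl.trans_lt ENNReal.ofReal_lt_top⟩
  have hB' : ∫ ξ, ‖h ξ‖ ≤ B := by
    rw [integral_norm_eq_lintegral_enorm h1.1]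
    exact ENNReal.toReal_le_of_le_ofReal hB hl
  set L : L2C n := 𝓕⁻ (h2.toLp h : L2C n)
  have hL : ∀ᵐ x, ‖L x‖ ≤ t / 2 := by
    filter_upwards [fourierInv_toLp_ae_eq h1 h2] with x hx
    rw [hx]
    exact (norm_fourierInv_le h x).trans (hB'.trans hBt)
  have hF : (𝓕 (U - L) : L2C n) =ᵐ[volume]
      (Metric.closedBall (0 : Sp n) A)ᶜ.indicator (𝓕 U : L2C n) := by
    have e : (𝓕 (U - L) : L2C n) = 𝓕 U - h2.toLp h := by
      have : (𝓕 (U - L) : L2C n) = 𝓕 U - 𝓕 L := (Lp.fourierTransformₗᵢ (Sp n) ℂ).map_sub U L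
      rw [this, fourier_fourierInv_eq]
    rw [e]
    filter_upwards [Lp.coeFn_sub (𝓕 U : L2C n) (h2.toLp h), h2.coeFn_toLp] with ξ a b
    rw [a, Pi.sub_apply, b, Set.indicator_compl]
    rfl
  have hnorm : ∫⁻ x, ‖(U - L) x‖ₑ ^ 2
      = ∫⁻ ξ in (Metric.closedBall (0 : Sp n) A)ᶜ, ‖(𝓕 U : L2C n) ξ‖ₑ ^ 2 := by
    rw [lintegral_enorm_sq_eq, ← Lp.norm_fourier_eq, ← lintegral_enorm_sq_eq,
      ← lintegral_indicator hms.compl]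
    refine lintegral_congr_ae ?_
    filter_upwards [hF] with ξ hξ
    rw [hξ]
    by_cases hm : ξ ∈ (Metric.closedBall (0 : Sp n) A)ᶜ <;> simp [hm, Set.indicator]
  rw [← hnorm, mul_comm]
  refine le_trans ?_ (mul_meas_ge_le_lintegral₀
    ((Lp.aestronglyMeasurable (U - L)).enorm.pow_const 2) (ENNReal.ofReal (t ^ 2 / 4)))
  have hset : {x : Sp n | t < ‖U x‖} ≤ᵐ[volume]
      {x : Sp n | ENNReal.ofReal (t ^ 2 / 4) ≤ ‖(U - L) x‖ₑ ^ 2} := by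
    filter_upwards [hL, Lp.coeFn_sub U L] with x hx hs hxt
    have hxt : t < ‖U x‖ := hxt
    change ENNReal.ofReal (t ^ 2 / 4) ≤ ‖(U - L) x‖ₑ ^ 2
    rw [hs, ← ofReal_norm, ← ENNReal.ofReal_pow (norm_nonneg _)]
    apply ENNReal.ofReal_le_ofReal
    have := norm_sub_norm_le (U x) (L x)
    rw [Pi.sub_apply]
    nlinarith
  exact mul_le_mul_right (measure_mono_ae hset) _

/-- The critical Sobolev exponent `2n/(n-2s)`. -/
def sobExp (n : ℕ) (s : ℝ) : ℝ := 2 * n / (n - 2 * s)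

theorem sobExp_gt_two (hs0 : 0 < s) (hsn : 2 * s < n) : 2 < sobExp n s := by
  unfold sobExp
  rw [lt_div_iff₀ (by linarith)]
  linarith

/-- The Sobolev embedding `H^s ⊂ L^{2n/(n-2s)}`. -/
theorem exists_sobolev (hs0 : 0 < s) (hsn : 2 * s < n) (hn : 0 < n) :
    ∃ C : ℝ, 0 < C ∧ ∀ u : Hs n s, ∫⁻ x, ‖u x‖ₑ ^ sobExp n s
      ≤ ENNReal.ofReal (C * ‖u‖ ^ sobExp n s) := by
  obtain ⟨c, hc0, hc⟩ := exists_lintegral_ball_rpow_le hsn hn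
  have hd : 0 < (n : ℝ) - 2 * s := by linarith
  set r := sobExp n s with hr
  have hr2 : 2 < r := sobExp_gt_two hs0 hsn
  set K := Real.sqrt c with hK
  have hK0 : 0 < K := Real.sqrt_pos.2 hc0
  -- The factor r is that of the layer-cake formula, 4 comes from the Chebyshev bound at height t/2,
  -- and the fraction from the integral of t^{r-3} over (0, T) with T = 2KM|ξ|^{(n-2s)/2}.
  refine ⟨4 * r * ((2 * K) ^ (r - 2) / (r - 2)),
    mul_pos (by linarith) (div_pos (by positivity) (by linarith)), fun u => ?_⟩
  rcases (norm_nonneg u).eq_or_lt with h0 | hM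
  · have hu0 : u = 0 := norm_eq_zero.1 h0.symm
    have : ∀ᵐ x, u x = 0 := by
      rw [hu0, map_zero]
      exact Lp.coeFn_zero ℝ 2 volume
    have e : ∫⁻ x, ‖u x‖ₑ ^ r = 0 := by
      rw [lintegral_congr_ae (g := 0) (by
        filter_upwards [this] with x hx
        simp [hx, show 0 < r by linarith])]
      simp
    rw [e]
    exact zero_le
  set M := ‖u‖ with hMdef
  set U : L2C n := toComplexL2 (Hs.toL2 u)
  have hFU : (𝓕 U : L2C n) = Hs.fourier u := rfl
  have hFm : Measurable (Hs.fourier u : Sp n → ℂ) := (Lp.stronglyMeasurable _).measurable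
  -- Cauchy–Schwarz with |ξ|^{-s} · |ξ|^s: the first factor is locally square integrable because 2s
  -- < n, the second is controlled by the `H^s` norm.
  have hlow : ∀ A : ℝ, 0 < A → ∫⁻ ξ in Metric.closedBall (0 : Sp n) A, ‖(𝓕 U : L2C n) ξ‖ₑ
      ≤ ENNReal.ofReal (K * A ^ (((n : ℝ) - 2 * s) / 2) * M) := by
    intro A hA
    rw [← ENNReal.pow_le_pow_left_iff (two_ne_zero), ← ENNReal.ofReal_pow (by positivity)]
    have hmul : ∀ᵐ ξ ∂(volume.restrict (Metric.closedBall (0 : Sp n) A)), ‖(𝓕 U : L2C n) ξ‖ₑ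
        = ENNReal.ofReal (‖ξ‖ ^ (-s)) * (ENNReal.ofReal (‖ξ‖ ^ s) * ‖Hs.fourier u ξ‖ₑ) := by
      filter_upwards [ae_restrict_of_ae (ae_ne_of_pos hn 0)] with ξ hξ
      have hp : 0 < ‖ξ‖ := norm_pos_iff.2 hξ
      rw [← mul_assoc, ← ENNReal.ofReal_mul (by positivity), ← Real.rpow_add hp, neg_add_cancel,
        Real.rpow_zero, ENNReal.ofReal_one, one_mul, hFU]
    rw [lintegral_congr_ae hmul]
    refine (lintegral_mul_sq_le (by fun_prop) (by fun_prop)).trans ?_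
    have e1 : ∫⁻ ξ in Metric.closedBall (0 : Sp n) A, ENNReal.ofReal (‖ξ‖ ^ (-s)) ^ 2
        ≤ ENNReal.ofReal (c * A ^ ((n : ℝ) - 2 * s)) := by
      refine le_trans (le_of_eq ?_) (hc A hA)
      refine lintegral_congr fun ξ => ?_
      rw [← ENNReal.ofReal_pow (by positivity), ← Real.rpow_natCast,
        ← Real.rpow_mul (norm_nonneg _)]
      congr 2
      push_cast; ring
    have e2 : ∫⁻ ξ in Metric.closedBall (0 : Sp n) A,
        (ENNReal.ofReal (‖ξ‖ ^ s) * ‖Hs.fourier u ξ‖ₑ) ^ 2 ≤ ENNReal.ofReal (M ^ 2) := by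
      refine (setLIntegral_le_lintegral _ _).trans ?_
      rw [hMdef, Hs.norm_sq_eq]
      refine lintegral_mono fun ξ => ?_
      rw [mul_pow]
      gcongr
      rw [← ENNReal.ofReal_pow (by positivity)]
      apply ENNReal.ofReal_le_ofReal
      refine le_trans (le_of_eq ?_) ((Real.rpow_le_rpow (norm_nonneg ξ) ?_ (by positivity)).trans
        (rpow_le_one_add_sq_rpow hs0 (r := 2 * Real.pi * ‖ξ‖) (by positivity)))
      · rw [← Real.rpow_natCast, ← Real.rpow_mul (norm_nonneg _)]
        congr 1
        push_cast; ring
      · have := Real.pi_gt_three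
        nlinarith [norm_nonneg ξ]
    refine (mul_le_mul' e1 e2).trans (le_of_eq ?_)
    rw [← ENNReal.ofReal_mul (by positivity)]
    congr 1
    rw [mul_pow, mul_pow, Real.sq_sqrt hc0.le, ← Real.rpow_natCast (A ^ _), ← Real.rpow_mul hA.le]
    congr 3
    push_cast; ring
  have hcoe : ∀ᵐ x, U x = (u x : ℂ) := coeFn_toComplexL2 _
  have hmeas : ∀ t : ℝ, 0 < t → volume {x | t < |u x|} * ENNReal.ofReal (t ^ (r - 1))
      ≤ ∫⁻ ξ, {p : ℝ × Sp n | p.1 < 2 * K * M * ‖p.2‖ ^ (((n : ℝ) - 2 * s) / 2)}.indicator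
        (fun p => 4 * ENNReal.ofReal (p.1 ^ (r - 2 - 1)) * ‖Hs.fourier u p.2‖ₑ ^ 2) (t, ξ) := by
    intro t ht
    -- The cutoff for which the low-frequency bound equals t/2 exactly. The condition |ξ| > A then
    -- becomes t < T(ξ), so the integrals in t and ξ can be exchanged.
    set A := (t / (2 * K * M)) ^ (2 / ((n : ℝ) - 2 * s)) with hA
    have hA0 : 0 < A := by positivity
    have hApow : A ^ (((n : ℝ) - 2 * s) / 2) = t / (2 * K * M) := by
      rw [hA, ← Real.rpow_mul (by positivity), show 2 / ((n : ℝ) - 2 * s) * (((n : ℝ) - 2 * s) / 2)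
        = 1 by field_simp, Real.rpow_one]
    have hsplit := measure_lt_le_of_split U (A := A)
      (B := K * A ^ (((n : ℝ) - 2 * s) / 2) * M) ht (by rw [hApow]; field_simp; rfl)
      (by positivity) (hlow A hA0)
    have hset : (volume : Measure (Sp n)) {x | t < |u x|} = volume {x : Sp n | t < ‖U x‖} := by
      refine measure_congr ?_
      filter_upwards [hcoe] with x hx
      change (t < |u x|) = (t < ‖U x‖)
      rw [hx, Complex.norm_real, Real.norm_eq_abs]
    have e : ENNReal.ofReal (t ^ (r - 1))
        = ENNReal.ofReal (t ^ 2 / 4) * (4 * ENNReal.ofReal (t ^ (r - 2 - 1))) := by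
      rw [show (4 : ℝ≥0∞) = ENNReal.ofReal 4 by simp, ← ENNReal.ofReal_mul (by positivity),
        ← ENNReal.ofReal_mul (by positivity)]
      congr 1
      rw [← Real.rpow_natCast, show r - 1 = ((2 : ℕ) : ℝ) + (r - 2 - 1) by push_cast; ring,
        Real.rpow_add ht]
      ring
    rw [hset, e, ← mul_assoc]
    refine (mul_le_mul_left hsplit _).trans ?_
    rw [← lintegral_indicator Metric.isClosed_closedBall.measurableSet.compl,
      ← lintegral_mul_const _ ((by fun_prop : Measurable fun ξ => ‖(𝓕 U : L2C n) ξ‖ₑ ^ 2).indicator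
        Metric.isClosed_closedBall.measurableSet.compl)]
    refine lintegral_mono fun ξ => ?_
    by_cases hξ : ξ ∈ (Metric.closedBall (0 : Sp n) A)ᶜ
    · have hAξ : A < ‖ξ‖ := by simpa using hξ
      rw [Set.indicator_of_mem hξ, Set.indicator_of_mem]
      · rw [mul_comm, hFU]
      · change t < 2 * K * M * ‖ξ‖ ^ (((n : ℝ) - 2 * s) / 2)
        have : t / (2 * K * M) < ‖ξ‖ ^ (((n : ℝ) - 2 * s) / 2) := by
          rw [← hApow]
          exact Real.rpow_lt_rpow hA0.le hAξ (by positivity)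
        rwa [div_lt_iff₀' (by positivity)] at this
    · rw [Set.indicator_of_notMem hξ, zero_mul]
      exact zero_le
  have hmset : MeasurableSet {p : ℝ × Sp n | p.1 < 2 * K * M * ‖p.2‖ ^ (((n : ℝ) - 2 * s) / 2)} :=
    measurableSet_lt (by fun_prop) (by fun_prop)
  have hlayer := lintegral_rpow_eq_lintegral_meas_lt_mul (μ := volume) (f := fun x => |u x|)
    (.of_forall fun x => abs_nonneg _) (Hs.measurable u).abs.aemeasurable
    (p := r) (by linarith)
  have el : ∀ x, ‖u x‖ₑ ^ r = ENNReal.ofReal (|u x| ^ r) := by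
    intro x
    rw [← ofReal_norm, ENNReal.ofReal_rpow_of_nonneg (norm_nonneg _) (by linarith),
      Real.norm_eq_abs]
  simp_rw [el]
  rw [hlayer]
  have step : ∫⁻ t in Set.Ioi (0 : ℝ), volume {x | t < |u x|} * ENNReal.ofReal (t ^ (r - 1))
      ≤ ENNReal.ofReal (4 * ((2 * K) ^ (r - 2) / (r - 2)) * M ^ r) := by
    refine (setLIntegral_mono' measurableSet_Ioi hmeas).trans ?_
    rw [lintegral_lintegral_swap (Measurable.aemeasurable (by
      refine Measurable.indicator ?_ hmset
      fun_prop))]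
    have inner : ∀ ξ : Sp n, (∫⁻ t in Set.Ioi (0 : ℝ),
        {p : ℝ × Sp n | p.1 < 2 * K * M * ‖p.2‖ ^ (((n : ℝ) - 2 * s) / 2)}.indicator
        (fun p => 4 * ENNReal.ofReal (p.1 ^ (r - 2 - 1)) * ‖Hs.fourier u p.2‖ₑ ^ 2) (t, ξ))
        ≤ ENNReal.ofReal (4 * ((2 * K) ^ (r - 2) / (r - 2)) * M ^ (r - 2)) *
          (ENNReal.ofReal ((1 + (2 * Real.pi * ‖ξ‖) ^ 2) ^ s) * ‖Hs.fourier u ξ‖ₑ ^ 2) := by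
      intro ξ
      set T := 2 * K * M * ‖ξ‖ ^ (((n : ℝ) - 2 * s) / 2) with hT
      have hT0 : 0 ≤ T := by positivity
      have e1 : ∀ t : ℝ, {p : ℝ × Sp n | p.1 < 2 * K * M * ‖p.2‖ ^ (((n : ℝ) - 2 * s) / 2)}.indicator
          (fun p => 4 * ENNReal.ofReal (p.1 ^ (r - 2 - 1)) * ‖Hs.fourier u p.2‖ₑ ^ 2) (t, ξ)
          = (Set.Iio T).indicator (fun t => 4 * ‖Hs.fourier u ξ‖ₑ ^ 2 *
            ENNReal.ofReal (t ^ (r - 2 - 1))) t := by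
        intro t
        simp only [Set.indicator, Set.mem_ofPred_eq, Set.mem_Iio, hT]
        split_ifs
        · ring
        · rfl
      simp_rw [e1]
      rw [lintegral_indicator measurableSet_Iio, Measure.restrict_restrict measurableSet_Iio,
        Set.inter_comm, Set.Ioi_inter_Iio, lintegral_const_mul _ (by fun_prop),
        setLIntegral_rpow_sub_one (by linarith) hT0]
      -- The exponent r is the one for which (r - 2)(n - 2s)/2 = 2s, the power that the `H^s` norm
      -- controls.
      have e2 : T ^ (r - 2) = (2 * K) ^ (r - 2) * M ^ (r - 2) * ‖ξ‖ ^ (2 * s) := by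
        rw [hT, Real.mul_rpow (by positivity) (by positivity),
          Real.mul_rpow (by positivity) hM.le, ← Real.rpow_mul (norm_nonneg _)]
        congr 2
        rw [hr, sobExp]
        field_simp
        ring
      have hnn : 0 ≤ 4 * ((2 * K) ^ (r - 2) / (r - 2)) * M ^ (r - 2) :=
        mul_nonneg (mul_nonneg (by norm_num) (div_nonneg (by positivity) (by linarith)))
          (by positivity)
      have e3 : (4 : ℝ≥0∞) * ‖Hs.fourier u ξ‖ₑ ^ 2 * ENNReal.ofReal (T ^ (r - 2) / (r - 2))
          = ENNReal.ofReal (4 * ((2 * K) ^ (r - 2) / (r - 2)) * M ^ (r - 2)) *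
            (ENNReal.ofReal (‖ξ‖ ^ (2 * s)) * ‖Hs.fourier u ξ‖ₑ ^ 2) := by
        rw [← mul_assoc, ← ENNReal.ofReal_mul hnn, mul_right_comm,
          show (4 : ℝ≥0∞) = ENNReal.ofReal 4 by simp, ← ENNReal.ofReal_mul (by norm_num), e2]
        congr 2
        ring
      rw [e3]
      gcongr
      refine le_trans (Real.rpow_le_rpow (norm_nonneg _) ?_ (by positivity))
        (rpow_le_one_add_sq_rpow hs0 (r := 2 * Real.pi * ‖ξ‖) (by positivity))
      have := Real.pi_gt_three
      nlinarith [norm_nonneg ξ]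
    refine (lintegral_mono inner).trans ?_
    rw [lintegral_const_mul' _ _ ENNReal.ofReal_ne_top, ← Hs.norm_sq_eq,
      ← ENNReal.ofReal_mul (mul_nonneg (mul_nonneg (by norm_num)
        (div_nonneg (by positivity) (by linarith))) (by positivity)), mul_assoc (4 * _) (M ^ (r - 2)),
      ← Real.rpow_natCast, ← Real.rpow_add hM]
    norm_num
  refine (mul_le_mul_right step _).trans (le_of_eq ?_)
  rw [← ENNReal.ofReal_mul (by linarith)]
  congr 1
  ring

/-! ### Existence of the fractional Laplacian -/

/-- Interpolation: |f|^q ≤ b^{q-1} |f|. -/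
theorem memLp_of_integrable_of_bdd {E α : Type*} [NormedAddCommGroup E] [MeasurableSpace α]
    {μ : Measure α} {f : α → E} (hf : Integrable f μ) {b : ℝ} (hb : ∀ x, ‖f x‖ ≤ b) {q : ℝ}
    (hq : 1 ≤ q) : MemLp f (ENNReal.ofReal q) μ := by
  have hq0 : 0 < q := by linarith
  refine ⟨hf.1, ?_⟩
  rw [eLpNorm_lt_top_iff_lintegral_rpow_enorm_lt_top (by simpa using hq0) ENNReal.ofReal_ne_top,
    ENNReal.toReal_ofReal hq0.le]
  have h : ∀ x, ‖f x‖ₑ ^ q ≤ ENNReal.ofReal (b ^ (q - 1)) * ‖f x‖ₑ := by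
    intro x
    have hb0 : 0 ≤ b := (norm_nonneg _).trans (hb x)
    rw [← ofReal_norm, ENNReal.ofReal_rpow_of_nonneg (norm_nonneg _) hq0.le,
      ← ENNReal.ofReal_mul (by positivity)]
    apply ENNReal.ofReal_le_ofReal
    rcases (norm_nonneg (f x)).eq_or_lt with h0 | h0
    · rw [← h0, Real.zero_rpow hq0.ne', mul_zero]
    · calc ‖f x‖ ^ q = ‖f x‖ ^ (q - 1) * ‖f x‖ := by
            rw [← Real.rpow_add_one h0.ne']; congr 1; ring
        _ ≤ _ := mul_le_mul_of_nonneg_right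
          (Real.rpow_le_rpow (norm_nonneg _) (hb x) (by linarith)) (norm_nonneg _)
  refine (lintegral_mono h).trans_lt ?_
  rw [lintegral_const_mul' _ _ ENNReal.ofReal_ne_top]
  exact ENNReal.mul_lt_top ENNReal.ofReal_lt_top hf.2

theorem memLp_two_of_integrable_of_bdd {E α : Type*} [NormedAddCommGroup E] [MeasurableSpace α]
    {μ : Measure α} {f : α → E} (hf : Integrable f μ) {b : ℝ} (hb : ∀ x, ‖f x‖ ≤ b) :
    MemLp f 2 μ := by
  simpa using memLp_of_integrable_of_bdd hf hb (q := 2) (by norm_num)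

/-- The symbol `|2πξ|^{2s}`. -/
def symb (s : ℝ) (ξ : Sp n) : ℝ := (2 * Real.pi * ‖ξ‖) ^ (2 * s)

theorem symb_nonneg (s : ℝ) (ξ : Sp n) : 0 ≤ symb s ξ := by unfold symb; positivity

theorem continuous_symb (hs0 : 0 < s) : Continuous (symb (n := n) s) := by
  unfold symb
  exact Continuous.rpow_const (by fun_prop) fun _ => Or.inr (by positivity)

theorem symb_le (hs0 : 0 < s) (hs1 : s < 1) (ξ : Sp n) :
    symb s ξ ≤ 1 + (2 * Real.pi) ^ 2 * ‖ξ‖ ^ 2 := by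
  refine (rpow_le_one_add_sq_rpow hs0 (by positivity)).trans ?_
  rw [← mul_pow]
  exact (Real.rpow_le_rpow_of_exponent_le (by nlinarith [sq_nonneg (2 * Real.pi * ‖ξ‖)]) hs1.le).trans
    (Real.rpow_one _).le

theorem integrable_symb_mul (hs0 : 0 < s) (hs1 : s < 1) (φ : 𝓢(Sp n, ℂ)) :
    Integrable fun ξ => (symb s ξ : ℂ) * φ ξ := by
  have h0 := φ.integrable (μ := volume).norm
  have h2 := φ.integrable_pow_mul volume 2
  refine (h0.add (h2.const_mul ((2 * Real.pi) ^ 2))).mono' ?_ (.of_forall fun ξ => ?_)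
  · exact (by have := continuous_symb (n := n) hs0; fun_prop : Continuous fun ξ : Sp n =>
      (symb s ξ : ℂ) * φ ξ).aestronglyMeasurable
  · rw [norm_mul, Complex.norm_real, Real.norm_of_nonneg (symb_nonneg s ξ)]
    calc _ ≤ (1 + (2 * Real.pi) ^ 2 * ‖ξ‖ ^ 2) * ‖φ ξ‖ := by gcongr; exact symb_le hs0 hs1 ξ
      _ = _ := by simp only [Pi.add_apply]; ring

theorem exists_bound_symb_mul (hs0 : 0 < s) (hs1 : s < 1) (φ : 𝓢(Sp n, ℂ)) :
    ∃ b : ℝ, ∀ ξ, ‖(symb s ξ : ℂ) * φ ξ‖ ≤ b := by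
  obtain ⟨C0, -, h0⟩ := φ.decay 0 0
  obtain ⟨C2, -, h2⟩ := φ.decay 2 0
  refine ⟨C0 + (2 * Real.pi) ^ 2 * C2, fun ξ => ?_⟩
  have a0 := h0 ξ
  have a2 := h2 ξ
  simp only [norm_iteratedFDeriv_zero, pow_zero, one_mul] at a0 a2
  rw [norm_mul, Complex.norm_real, Real.norm_of_nonneg (symb_nonneg s ξ)]
  calc _ ≤ (1 + (2 * Real.pi) ^ 2 * ‖ξ‖ ^ 2) * ‖φ ξ‖ := by gcongr; exact symb_le hs0 hs1 ξ
    _ = ‖φ ξ‖ + (2 * Real.pi) ^ 2 * (‖ξ‖ ^ 2 * ‖φ ξ‖) := by ring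
    _ ≤ _ := by gcongr

theorem memLp_symb_mul (hs0 : 0 < s) (hs1 : s < 1) (φ : 𝓢(Sp n, ℂ)) :
    MemLp (fun ξ => (symb s ξ : ℂ) * φ ξ) 2 := by
  obtain ⟨b, hb⟩ := exists_bound_symb_mul hs0 hs1 φ
  exact memLp_two_of_integrable_of_bdd (integrable_symb_mul hs0 hs1 φ) hb

theorem fracLaplacianSchwartz_eq (φ : 𝓢(Sp n, ℂ)) :
    fracLaplacianSchwartz s φ = 𝓕⁻ (fun ξ : Sp n => (symb s ξ : ℂ) * (𝓕 φ) ξ) := rfl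

/-- An inverse Fourier integral with hermitian symmetric data is real. -/
theorem conj_fourierInv {f : Sp n → ℂ} (hf : ∀ ξ, (starRingEnd ℂ) (f ξ) = f (-ξ)) (x : Sp n) :
    (starRingEnd ℂ) (𝓕⁻ f x) = 𝓕⁻ f x := by
  rw [Real.fourierInv_eq, ← integral_conj, ← integral_neg_eq_self]
  congr 1
  ext ξ
  rw [Circle.smul_def, Circle.smul_def, smul_eq_mul, smul_eq_mul, map_mul, hf, neg_neg, inner_neg_left,
    AddChar.map_neg_eq_inv, Circle.coe_inv_eq_conj, Complex.conj_conj]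

theorem conj_fourier {g : Sp n → ℂ} (hg : ∀ x, (starRingEnd ℂ) (g x) = g x) (ξ : Sp n) :
    (starRingEnd ℂ) (𝓕 g ξ) = 𝓕 g (-ξ) := by
  rw [Real.fourier_eq, Real.fourier_eq, ← integral_conj]
  congr 1
  ext x
  rw [Circle.smul_def, Circle.smul_def, smul_eq_mul, smul_eq_mul, map_mul, hg, inner_neg_right,
    neg_neg, AddChar.map_neg_eq_inv, Circle.coe_inv_eq_conj, Complex.conj_conj]

theorem conj_multiplier {w : Sp n → ℝ} (hw : ∀ ξ, w (-ξ) = w ξ) {g : Sp n → ℂ}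
    (hg : ∀ x, (starRingEnd ℂ) (g x) = g x) (x : Sp n) :
    (starRingEnd ℂ) (𝓕⁻ (fun ξ => (w ξ : ℂ) * 𝓕 g ξ) x) = 𝓕⁻ (fun ξ => (w ξ : ℂ) * 𝓕 g ξ) x :=
  conj_fourierInv (fun ξ => by rw [map_mul, Complex.conj_ofReal, conj_fourier hg, hw]) x

/-- A reflection exchanges the two transforms and leaves an even symbol alone. This reconciles the
order of transforms in the dual definition of `besselPotential` with the one in
`fracLaplacianSchwartz`. -/
theorem fourier_mul_fourierInv {w : Sp n → ℂ} (hw : ∀ ξ, w (-ξ) = w ξ) (g : Sp n → ℂ) (x : Sp n) :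
    𝓕 (fun ξ => w ξ * 𝓕⁻ g ξ) x = 𝓕⁻ (fun ξ => w ξ * 𝓕 g ξ) x := by
  rw [Real.fourierInv_eq_fourier_comp_neg (fun ξ => w ξ * 𝓕 g ξ)]
  refine congrArg (fun f : Sp n → ℂ => 𝓕 f x) (funext fun ξ => ?_)
  rw [hw, Real.fourierInv_eq_fourier_neg]

/-- The Bessel potential of a function, tested with a Schwartz function. -/
theorem besselPotential_apply_eq {p : ℝ≥0∞} [Fact (1 ≤ p)] (k : ℝ)
    (M : Lp ℂ p (volume : Measure (Sp n))) (φ : 𝓢(Sp n, ℂ)) :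
    TemperedDistribution.besselPotential (Sp n) ℂ k (Lp.toTemperedDistribution M) φ
      = ∫ x, 𝓕⁻ (fun ξ => (((1 + ‖ξ‖ ^ 2) ^ (k / 2) : ℝ) : ℂ) * 𝓕 φ ξ) x * M x := by
  rw [TemperedDistribution.besselPotential, TemperedDistribution.fourierMultiplierCLM_apply_apply,
    Lp.toTemperedDistribution_apply]
  congr 1
  ext x
  rw [smul_eq_mul, SchwartzMap.fourier_coe, SchwartzMap.fourier_coe]
  congr 1
  rw [← fourier_mul_fourierInv (fun ξ => by rw [norm_neg])]
  refine congrArg (fun f : Sp n → ℂ => 𝓕 f x) (funext fun ξ => ?_)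
  have hT : (fun x : Sp n => (((1 + ‖x‖ ^ 2) ^ (k / 2) : ℝ) : ℂ)).HasTemperateGrowth := by fun_prop
  rw [SchwartzMap.smulLeftCLM_apply_apply hT, smul_eq_mul, SchwartzMap.fourierInv_coe]

/-- Elements of `W^{k,p}_c(Ω)` vanish outside the closure of `Ω`. -/
theorem MemSobolevC.ae_eq_zero {k : ℝ} {p : ℝ≥0∞} {Ω : Set (Sp n)} {m : Sp n → ℝ}
    (h : MemSobolevC k p Ω m) : ∀ᵐ x, x ∉ closure Ω → m x = 0 := by
  obtain ⟨hp, M, hM, -, happ⟩ := h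
  have key : ∀ᵐ x, x ∈ (closure Ω)ᶜ → M x = 0 := by
    refine isClosed_closure.isOpen_compl.ae_eq_zero_of_integral_contDiff_smul_eq_zero
      (((Lp.memLp M).locallyIntegrable hp.out).locallyIntegrableOn _) fun φ h1 h2 h3 => ?_
    choose ψ N g hψ hN hg hgn using fun j : ℕ => happ (1 / ((j : ℝ) + 1)) (by positivity)
    have hg0 : Filter.Tendsto g Filter.atTop (𝓝 0) := by
      rw [tendsto_zero_iff_norm_tendsto_zero]
      exact squeeze_zero (fun _ => norm_nonneg _) (fun j => (hgn j).le)
        tendsto_one_div_add_atTop_nhds_zero_nat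
    -- Undoing the Bessel potential recovers M - N j from g j. A test function supported off the
    -- closure of Ω does not see N j, so the value is the same for all j, while by continuity it
    -- tends to 0.
    have e : ∀ j, TemperedDistribution.besselPotential (Sp n) ℂ (-k)
        (Lp.toTemperedDistribution (g j)) (schwartzOf h1 h2) = ∫ x, φ x • M x := by
      intro j
      rw [(TemperedDistribution.besselPotential_neg_apply_eq_iff k _ _).2 (hg j),
        Lp.toTemperedDistribution_apply]
      refine integral_congr_ae ?_
      filter_upwards [Lp.coeFn_sub M (N j), hN j] with x hx hNx
      rw [hx, Pi.sub_apply, hNx, schwartzOf_apply, smul_eq_mul, Complex.real_smul]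
      by_cases hxφ : x ∈ tsupport φ
      · have : ψ j x = 0 := image_eq_zero_of_notMem_tsupport fun hx' =>
          h3 hxφ (subset_closure ((hψ j).2.2 hx'))
        rw [this]; simp
      · rw [image_eq_zero_of_notMem_tsupport hxφ]; simp
    have hlim : Filter.Tendsto (fun j => TemperedDistribution.besselPotential (Sp n) ℂ (-k)
        (Lp.toTemperedDistribution (g j)) (schwartzOf h1 h2)) Filter.atTop (𝓝 0) := by
      have hc : Continuous fun G : Lp ℂ p (volume : Measure (Sp n)) =>
          (Lp.toTemperedDistributionCLM ℂ volume p G)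
            (𝓕 (SchwartzMap.smulLeftCLM ℂ (fun x : Sp n => (((1 + ‖x‖ ^ 2) ^ (-k / 2) : ℝ) : ℂ))
              (𝓕⁻ (schwartzOf h1 h2)))) :=
        (continuous_eval_const _).comp
          (Lp.toTemperedDistributionCLM ℂ volume p).continuous
      have := (hc.tendsto 0).comp hg0
      simpa [TemperedDistribution.besselPotential, Function.comp_def] using this
    simp_rw [e] at hlim
    exact tendsto_nhds_unique tendsto_const_nhds hlim
  filter_upwards [key, hM] with x hx hMx hxΩ
  have := hx hxΩ
  rw [hMx] at this
  exact_mod_cast this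

/-- The density `s / Γ(1-s) t^{s-1} (1 - e^{-1/t})`, of total mass one. -/
def mixDensity (s t : ℝ) : ℝ := s / Real.Gamma (1 - s) * (t ^ (s - 1) * (1 - Real.exp (-(1 / t))))

def mixTime (s : ℝ) : Measure ℝ :=
  (volume.restrict (Set.Ioi (0 : ℝ))).withDensity fun t => ENNReal.ofReal (mixDensity s t)

theorem measurable_mixDensity (s : ℝ) : Measurable (mixDensity s) := by
  unfold mixDensity; fun_prop

theorem mixDensity_nonneg (hs0 : 0 < s) (hs1 : s < 1) {t : ℝ} (ht : 0 < t) : 0 ≤ mixDensity s t := by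
  have := Real.Gamma_pos_of_pos (s := 1 - s) (by linarith)
  have h : Real.exp (-(1 / t)) ≤ 1 := Real.exp_le_one_iff.2 (by simp; positivity)
  unfold mixDensity
  have : 0 ≤ 1 - Real.exp (-(1 / t)) := by linarith
  positivity

theorem isProbabilityMeasure_mixTime (hs0 : 0 < s) (hs1 : s < 1) :
    IsProbabilityMeasure (mixTime s) := by
  constructor
  have hΓ := Real.Gamma_pos_of_pos (s := 1 - s) (by linarith)
  rw [mixTime, withDensity_apply _ MeasurableSet.univ, Measure.restrict_univ]
  simp only [mixDensity]
  simp_rw [ENNReal.ofReal_mul (show 0 ≤ s / Real.Gamma (1 - s) by positivity)]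
  rw [lintegral_const_mul' _ _ ENNReal.ofReal_ne_top,
    lintegral_rpow_mul_one_sub_exp hs0 hs1 zero_le_one, ← ENNReal.ofReal_mul (by positivity)]
  rw [Real.one_rpow, one_mul, ← ENNReal.ofReal_one]
  congr 1
  field_simp

theorem integrableOn_one_sub_exp (hs0 : 0 < s) (hs1 : s < 1) {l : ℝ} (hl : 0 ≤ l) :
    IntegrableOn (fun t : ℝ => t ^ (s - 1) * (1 - Real.exp (-(l / t)))) (Set.Ioi 0) ∧
    ∫ t in Set.Ioi (0 : ℝ), t ^ (s - 1) * (1 - Real.exp (-(l / t)))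
      = l ^ s * (Real.Gamma (1 - s) / s) := by
  have hΓ := Real.Gamma_pos_of_pos (s := 1 - s) (by linarith)
  have h := lintegral_rpow_mul_one_sub_exp hs0 hs1 hl
  have hm : AEStronglyMeasurable (fun t : ℝ => t ^ (s - 1) * (1 - Real.exp (-(l / t))))
      (volume.restrict (Set.Ioi 0)) := Measurable.aestronglyMeasurable (by fun_prop)
  have hnn : 0 ≤ᵐ[volume.restrict (Set.Ioi (0 : ℝ))]
      fun t : ℝ => t ^ (s - 1) * (1 - Real.exp (-(l / t))) := by
    filter_upwards [ae_restrict_mem measurableSet_Ioi] with t ht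
    have ht : (0 : ℝ) < t := ht
    have h : Real.exp (-(l / t)) ≤ 1 := Real.exp_le_one_iff.2 (by simp; positivity)
    have : 0 ≤ 1 - Real.exp (-(l / t)) := by linarith
    change (0 : ℝ) ≤ _
    positivity
  have hint : IntegrableOn (fun t : ℝ => t ^ (s - 1) * (1 - Real.exp (-(l / t)))) (Set.Ioi 0) := by
    refine ⟨hm, ?_⟩
    rw [hasFiniteIntegral_iff_ofReal hnn, h]
    exact ENNReal.ofReal_lt_top
  refine ⟨hint, ?_⟩
  rw [← ofReal_integral_eq_lintegral_ofReal hint hnn] at h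
  exact (ENNReal.ofReal_eq_ofReal_iff (integral_nonneg_of_ae hnn) (by positivity)).1 h

/-- Since e^{-l/t} (1 - e^{-1/t}) = (1 - e^{-(1+l)/t}) - (1 - e^{-l/t}), this is the difference of
the subordination formulas for 1 + l and l. -/
theorem integral_exp_mixTime (hs0 : 0 < s) (hs1 : s < 1) {l : ℝ} (hl : 0 ≤ l) :
    ∫ t, Real.exp (-(l / t)) ∂(mixTime s) = (1 + l) ^ s - l ^ s := by
  have hΓ := Real.Gamma_pos_of_pos (s := 1 - s) (by linarith)
  rw [mixTime, integral_withDensity_eq_integral_toReal_smul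
    (measurable_mixDensity s).ennreal_ofReal (.of_forall fun _ => ENNReal.ofReal_lt_top)]
  obtain ⟨i1, v1⟩ := integrableOn_one_sub_exp hs0 hs1 (l := 1 + l) (by linarith)
  obtain ⟨i0, v0⟩ := integrableOn_one_sub_exp hs0 hs1 hl
  have e : ∀ t ∈ Set.Ioi (0 : ℝ), (ENNReal.ofReal (mixDensity s t)).toReal • Real.exp (-(l / t))
      = s / Real.Gamma (1 - s) * (t ^ (s - 1) * (1 - Real.exp (-((1 + l) / t)))
        - t ^ (s - 1) * (1 - Real.exp (-(l / t)))) := by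
    intro t ht
    have ht : (0 : ℝ) < t := ht
    rw [ENNReal.toReal_ofReal (mixDensity_nonneg hs0 hs1 ht), smul_eq_mul, mixDensity, add_div,
      neg_add, Real.exp_add]
    ring
  rw [setIntegral_congr_fun measurableSet_Ioi e, integral_const_mul, integral_sub i1 i0, v1, v0]
  field_simp

/-- A mixture of centred Gaussians with Fourier transform `(1 + |ξ|²)^s - |ξ|^{2s}`. -/
def mixGauss (n : ℕ) (s : ℝ) : Measure (Sp n) :=
  ((mixTime s).prod (ProbabilityTheory.stdGaussian (Sp n))).map
    fun p => (Real.sqrt (1 / (2 * p.1)) / Real.pi) • p.2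

theorem measurable_mixGauss_map :
    Measurable fun p : ℝ × Sp n => (Real.sqrt (1 / (2 * p.1)) / Real.pi) • p.2 := by
  fun_prop

theorem isProbabilityMeasure_mixGauss (hs0 : 0 < s) (hs1 : s < 1) :
    IsProbabilityMeasure (mixGauss n s) := by
  have := isProbabilityMeasure_mixTime hs0 hs1
  exact Measure.isProbabilityMeasure_map measurable_mixGauss_map.aemeasurable

/-- At a fixed time t the scale √(1/(2t))/π is chosen so that the Gaussian has transform
e^{-|ξ|²/t}; averaging over t is `integral_exp_mixTime` with l = |ξ|². -/
theorem integral_fourierChar_mixGauss (hs0 : 0 < s) (hs1 : s < 1) (ξ : Sp n) :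
    ∫ y, (Real.fourierChar (inner ℝ y ξ) : ℂ) ∂(mixGauss n s)
      = (((1 + ‖ξ‖ ^ 2) ^ s - (‖ξ‖ ^ 2) ^ s : ℝ) : ℂ) := by
  have := isProbabilityMeasure_mixTime hs0 hs1
  have hc : Continuous fun y : Sp n => (Real.fourierChar (inner ℝ y ξ) : ℂ) := by fun_prop
  rw [mixGauss, integral_map measurable_mixGauss_map.aemeasurable hc.aestronglyMeasurable,
    integral_prod _ (by
      refine Integrable.of_bound
        (hc.measurable.comp measurable_mixGauss_map).aestronglyMeasurable 1
        (.of_forall fun p => ?_)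
      rw [Circle.norm_coe]), ← integral_exp_mixTime hs0 hs1 (sq_nonneg ‖ξ‖),
    ← integral_complex_ofReal]
  have hpos : ∀ᵐ t ∂(mixTime s), 0 < t := by
    refine (withDensity_absolutelyContinuous _ _).ae_le ?_
    exact ae_restrict_mem measurableSet_Ioi
  refine integral_congr_ae ?_
  filter_upwards [hpos] with t ht
  have h := ProbabilityTheory.charFun_stdGaussian (E := Sp n)
    ((2 * Real.sqrt (1 / (2 * t))) • ξ)
  rw [charFun_apply] at h
  have e : ∀ z : Sp n, (Real.fourierChar (inner ℝ ((Real.sqrt (1 / (2 * t)) / Real.pi) • z) ξ) : ℂ)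
      = Complex.exp (((inner ℝ z ((2 * Real.sqrt (1 / (2 * t))) • ξ) : ℝ) : ℂ) * Complex.I) := by
    intro z
    rw [Real.fourierChar_apply, real_inner_smul_left, real_inner_smul_right]
    congr 3
    field_simp
  simp only [e]
  have e2 : -((‖(2 * Real.sqrt (1 / (2 * t))) • ξ‖ : ℝ) : ℂ) ^ 2 / 2
      = ((-‖(2 * Real.sqrt (1 / (2 * t))) • ξ‖ ^ 2 / 2 : ℝ) : ℂ) := by push_cast; ring
  rw [h, e2, ← Complex.ofReal_exp]
  congr 2
  rw [norm_smul, mul_pow, Real.norm_of_nonneg (by positivity), mul_pow,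
    Real.sq_sqrt (by positivity)]
  field_simp

/-- Insert the inversion formula for φ and use Fubini. It turns the multiplier into an average of
translates over a probability measure. -/
theorem fourierInv_mix (hs0 : 0 < s) (hs1 : s < 1) (φ : 𝓢(Sp n, ℂ)) (x : Sp n) :
    𝓕⁻ (fun ξ : Sp n => (((1 + ‖ξ‖ ^ 2) ^ s - (‖ξ‖ ^ 2) ^ s : ℝ) : ℂ) * (𝓕 φ) ξ) x
      = ∫ y, φ (x + y) ∂(mixGauss n s) := by
  have := isProbabilityMeasure_mixGauss (n := n) hs0 hs1
  have hφ : ∀ y, φ (x + y) = ∫ ξ, (Real.fourierChar (inner ℝ ξ x) : ℂ) *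
      ((Real.fourierChar (inner ℝ y ξ) : ℂ) * (𝓕 φ) ξ) := by
    intro y
    have h : φ = 𝓕⁻ (𝓕 φ) := (fourierInv_fourier_eq φ).symm
    conv_lhs => rw [h]
    rw [SchwartzMap.fourierInv_coe, Real.fourierInv_eq]
    congr 1
    ext ξ
    rw [Circle.smul_def, smul_eq_mul, inner_add_right, AddChar.map_add_eq_mul, Circle.coe_mul,
      real_inner_comm y ξ, mul_assoc]
  simp_rw [hφ]
  rw [integral_integral_swap]
  · rw [Real.fourierInv_eq]
    congr 1
    ext ξ
    rw [integral_const_mul, integral_mul_const, integral_fourierChar_mixGauss hs0 hs1,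
      Circle.smul_def, smul_eq_mul]
  · have h1 : Integrable (fun p : Sp n × Sp n => (1 : ℂ) * (𝓕 φ) p.2)
        ((mixGauss n s).prod volume) :=
      (integrable_const (1 : ℂ)).mul_prod (𝓕 φ).integrable
    refine h1.mono (Continuous.aestronglyMeasurable ?_) (.of_forall fun p => ?_)
    · have := (𝓕 φ).continuous
      simp only [Function.uncurry_def]
      fun_prop
    · simp [Function.uncurry_def, Circle.norm_coe]

theorem symb_eq (ξ : Sp n) : symb s ξ = (2 * Real.pi) ^ (2 * s) *
    ((1 + ‖ξ‖ ^ 2) ^ (2 * s / 2) - ((1 + ‖ξ‖ ^ 2) ^ s - (‖ξ‖ ^ 2) ^ s)) := by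
  rw [symb, Real.mul_rpow (by positivity) (norm_nonneg _), ← Real.rpow_natCast ‖ξ‖ 2,
    ← Real.rpow_mul (norm_nonneg _)]
  simp

/-- The Bessel potential of a Schwartz function. -/
def bessel (s : ℝ) (φ : 𝓢(Sp n, ℂ)) : Sp n → ℂ :=
  𝓕⁻ (fun ξ : Sp n => (((1 + ‖ξ‖ ^ 2) ^ (2 * s / 2) : ℝ) : ℂ) * (𝓕 φ) ξ)

theorem bessel_eq_schwartz (φ : 𝓢(Sp n, ℂ)) : ∃ ψ : 𝓢(Sp n, ℂ), bessel s φ = ψ := by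
  refine ⟨𝓕⁻ (SchwartzMap.smulLeftCLM ℂ (fun x : Sp n => (((1 + ‖x‖ ^ 2) ^ (2 * s / 2) : ℝ) : ℂ))
    (𝓕 φ)), ?_⟩
  have hT : (fun x : Sp n => (((1 + ‖x‖ ^ 2) ^ (2 * s / 2) : ℝ) : ℂ)).HasTemperateGrowth := by
    fun_prop
  rw [SchwartzMap.fourierInv_coe, bessel]
  congr 1
  ext ξ
  rw [SchwartzMap.smulLeftCLM_apply_apply hT, smul_eq_mul]

theorem integrable_bessel_mul (φ : 𝓢(Sp n, ℂ)) :
    Integrable fun ξ : Sp n => (((1 + ‖ξ‖ ^ 2) ^ (2 * s / 2) : ℝ) : ℂ) * φ ξ := by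
  have hT : (fun x : Sp n => (((1 + ‖x‖ ^ 2) ^ (2 * s / 2) : ℝ) : ℂ)).HasTemperateGrowth := by
    fun_prop
  refine (SchwartzMap.smulLeftCLM ℂ (fun x : Sp n => (((1 + ‖x‖ ^ 2) ^ (2 * s / 2) : ℝ) : ℂ))
    φ).integrable.congr (.of_forall fun ξ => ?_)
  rw [SchwartzMap.smulLeftCLM_apply_apply hT, smul_eq_mul]

theorem Integrable.fourierChar_smul {f : Sp n → ℂ} (hf : Integrable f) (x : Sp n) :
    Integrable fun ξ => Real.fourierChar (inner ℝ ξ x) • f ξ := by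
  refine hf.mono ?_ (.of_forall fun ξ => by simp)
  have : Continuous fun ξ : Sp n => Real.fourierChar (inner ℝ ξ x) := by fun_prop
  exact this.aestronglyMeasurable.smul hf.1

/-- The splitting `symb_eq` of the symbol. Averaging over a probability measure is a contraction on
every `L^p`, so the Bessel potential alone decides whether (-Δ)^s m lies in `L^p`; no multiplier
theorem is needed. -/
theorem fracLaplacianSchwartz_eq_bessel (hs0 : 0 < s) (hs1 : s < 1) (φ : 𝓢(Sp n, ℂ)) (x : Sp n) :
    fracLaplacianSchwartz s φ x = (((2 * Real.pi) ^ (2 * s) : ℝ) : ℂ) *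
      (bessel s φ x - ∫ y, φ (x + y) ∂(mixGauss n s)) := by
  have hi := (integrable_bessel_mul (s := s) (𝓕 φ)).sub
    ((integrable_symb_mul hs0 hs1 (𝓕 φ)).const_mul (((2 * Real.pi) ^ (2 * s) : ℝ) : ℂ)⁻¹)
  have hp : (((2 * Real.pi) ^ (2 * s) : ℝ) : ℂ) ≠ 0 := by
    exact_mod_cast (by positivity : (2 * Real.pi) ^ (2 * s) ≠ 0)
  rw [← fourierInv_mix hs0 hs1, bessel, Real.fourierInv_eq, Real.fourierInv_eq,
    fracLaplacianSchwartz_eq, Real.fourierInv_eq, ← integral_sub, ← integral_const_mul]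
  · congr 1
    ext ξ
    simp only [Circle.smul_def, smul_eq_mul]
    rw [symb_eq]
    push_cast
    ring
  · exact Integrable.fourierChar_smul (integrable_bessel_mul _) x
  · refine Integrable.fourierChar_smul (hi.congr (.of_forall fun ξ => ?_)) x
    simp only [Pi.sub_apply]
    rw [symb_eq]
    push_cast at hp ⊢
    field_simp
    ring

/-! ### Averages of translates over a finite measure, tested with Schwartz functions. -/

theorem integrable_shift_prod {m : Sp n → ℝ} (hm : Measurable m) (hi : Integrable m)
    (ν : Measure (Sp n)) [IsFiniteMeasure ν] :
    Integrable (fun p : Sp n × Sp n => m (p.1 - p.2)) (volume.prod ν) := by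
  have hms : Measurable fun p : Sp n × Sp n => m (p.1 - p.2) :=
    hm.comp (measurable_fst.sub measurable_snd)
  rw [integrable_prod_iff' hms.aestronglyMeasurable]
  refine ⟨.of_forall fun y => hi.comp_sub_right y, ?_⟩
  have : ∀ y : Sp n, ∫ x, ‖m (x - y)‖ = ∫ x, ‖m x‖ := fun y =>
    integral_sub_right_eq_self (fun x => ‖m x‖) y
  simp only [this]
  exact integrable_const _

/-- Translates averaged over a probability measure. -/
def avg (ν : Measure (Sp n)) (m : Sp n → ℝ) (x : Sp n) : ℝ := ∫ y, m (x - y) ∂ν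

theorem integrable_avg {m : Sp n → ℝ} (hm : Measurable m) (hi : Integrable m)
    (ν : Measure (Sp n)) [IsFiniteMeasure ν] : Integrable (avg ν m) :=
  (integrable_shift_prod hm hi ν).integral_prod_left

theorem abs_avg_le {m : Sp n → ℝ} {b : ℝ} (hb : ∀ x, |m x| ≤ b)
    (ν : Measure (Sp n)) [IsProbabilityMeasure ν] (x : Sp n) : ‖avg ν m x‖ ≤ b := by
  refine (norm_integral_le_of_norm_le_const (C := b) (.of_forall fun y => ?_)).trans ?_
  · exact hb _
  · simp

theorem integral_avg_mul {m : Sp n → ℝ} (hm : Measurable m) (hi : Integrable m)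
    (ν : Measure (Sp n)) [IsFiniteMeasure ν] (φ : 𝓢(Sp n, ℂ)) :
    ∫ x, (avg ν m x : ℂ) * φ x = ∫ x, (m x : ℂ) * ∫ y, φ (x + y) ∂ν := by
  obtain ⟨C, -, hC⟩ := φ.decay 0 0
  simp only [norm_iteratedFDeriv_zero, pow_zero, one_mul] at hC
  have h1 : ∀ x, (avg ν m x : ℂ) * φ x = ∫ y, (m (x - y) : ℂ) * φ x ∂ν := fun x => by
    rw [avg, ← integral_complex_ofReal, integral_mul_const]
  simp_rw [h1]
  have hφm : Measurable φ := φ.continuous.measurable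
  rw [integral_integral_swap]
  · have h2 : ∀ y : Sp n, ∫ x, (m (x - y) : ℂ) * φ x = ∫ x, (m x : ℂ) * φ (x + y) := fun y => by
      rw [← integral_sub_right_eq_self (fun x => (m x : ℂ) * φ (x + y)) y]
      simp
    simp_rw [h2]
    rw [← integral_integral_swap]
    · simp_rw [integral_const_mul]
    · have h0 : Integrable (fun p : Sp n × Sp n => m p.1 * (1 : ℝ)) (volume.prod ν) :=
        hi.mul_prod (integrable_const 1)
      refine (h0.norm.mul_const C).mono' ?_ (.of_forall fun p => ?_)
      · exact (((Complex.measurable_ofReal.comp (hm.comp measurable_fst))).mul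
          (hφm.comp (measurable_fst.add measurable_snd))).aestronglyMeasurable
      · simp only [Function.uncurry_def, norm_mul, Complex.norm_real, mul_one]
        exact mul_le_mul_of_nonneg_left (hC _) (norm_nonneg _)
  · refine ((integrable_shift_prod hm hi ν).norm.mul_const C).mono' ?_ (.of_forall fun p => ?_)
    · exact ((Complex.measurable_ofReal.comp (hm.comp (measurable_fst.sub measurable_snd))).mul
          (hφm.comp measurable_fst)).aestronglyMeasurable
    · simp only [Function.uncurry_def, norm_mul, Complex.norm_real]
      exact mul_le_mul_of_nonneg_left (hC _) (norm_nonneg _)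

theorem one_le_exp_of (hs0 : 0 < s) (hsn : 2 * s < n) : 1 < (n : ℝ) / (2 * s) := by
  rw [lt_div_iff₀ (by positivity)]; linarith

theorem one_le_critExp (hs0 : 0 < s) (hsn : 2 * s < n) : 1 ≤ critExp n s := by
  rw [critExp, ENNReal.one_le_ofReal]
  exact (one_le_exp_of hs0 hsn).le

theorem bessel_real {φ : 𝓢(Sp n, ℂ)} (h : ∀ x, (starRingEnd ℂ) (φ x) = φ x) (x : Sp n) :
    (starRingEnd ℂ) (bessel s φ x) = bessel s φ x := by
  rw [bessel, SchwartzMap.fourier_coe]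
  exact conj_multiplier (fun ξ => by rw [norm_neg]) h x

theorem fracLaplacianSchwartz_real {φ : 𝓢(Sp n, ℂ)} (h : ∀ x, (starRingEnd ℂ) (φ x) = φ x)
    (x : Sp n) :
    (starRingEnd ℂ) (fracLaplacianSchwartz s φ x) = fracLaplacianSchwartz s φ x := by
  rw [fracLaplacianSchwartz_eq, SchwartzMap.fourier_coe]
  exact conj_multiplier (fun ξ => by simp [symb]) h x

theorem MemLp.integrable_mul_schwartz {p : ℝ≥0∞} (hp : 1 ≤ p) {h : Sp n → ℂ} (hh : MemLp h p)
    (φ : 𝓢(Sp n, ℂ)) : Integrable fun x => h x * φ x := by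
  have := ENNReal.HolderConjugate.conjExponent hp
  exact hh.integrable_mul (φ.memLp p.conjExponent)

/-- A compactly supported bounded function of `W^{2s,p}` has a fractional Laplacian in `L^p`. -/
theorem exists_isFracLaplacian (hs0 : 0 < s) (hs1 : s < 1) (hsn : 2 * s < n) {Ω : Set (Sp n)}
    {m : Sp n → ℝ} (hmm : Measurable m) (hi : Integrable m) {b : ℝ} (hb : ∀ x, |m x| ≤ b)
    (hm : MemSobolevC (2 * s) (critExp n s) Ω m) :
    ∃ g, IsFracLaplacian s (critExp n s) m g := by
  obtain ⟨hp, M, hM, ⟨h, hh⟩, -⟩ := hm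
  have := isProbabilityMeasure_mixGauss (n := n) hs0 hs1
  have hbes : ∀ φ : 𝓢(Sp n, ℂ), ∫ x, h x * φ x = ∫ x, (m x : ℂ) * bessel s φ x := by
    intro φ
    have e := congrArg (fun T => T φ) hh
    simp only [besselPotential_apply_eq, Lp.toTemperedDistribution_apply] at e
    calc ∫ x, h x * φ x = ∫ x, φ x • h x := by
          congr 1; ext x; rw [smul_eq_mul, mul_comm]
      _ = _ := e.symm
      _ = _ := by
          refine integral_congr_ae ?_
          filter_upwards [hM] with x hx
          rw [hx, mul_comm, bessel, SchwartzMap.fourier_coe]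
  -- The Bessel potential h is a priori complex valued. Against a real test function its integral is
  -- real, because m and the even multiplier are.
  have hreal : ∀ᵐ x, (h x).im = 0 := by
    have hl : LocallyIntegrable (fun x => (h x).im) (volume : Measure (Sp n)) :=
      ((Lp.memLp h).im).locallyIntegrable hp.out
    refine ae_eq_zero_of_integral_contDiff_smul_eq_zero hl fun φ h1 h2 => ?_
    have hint := MemLp.integrable_mul_schwartz hp.out (Lp.memLp h) (schwartzOf h1 h2)
    have e : ∫ x, φ x • (h x).im = (∫ x, h x * schwartzOf h1 h2 x).im := by
      refine Eq.trans ?_ (integral_im hint)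
      congr 1
      ext x
      rw [schwartzOf_apply, smul_eq_mul, mul_comm]
      simp
    rw [e, hbes, ← Complex.conj_eq_iff_im, ← integral_conj]
    congr 1
    ext x
    rw [map_mul, Complex.conj_ofReal, bessel_real fun x => by rw [schwartzOf_apply]; simp]
  have hK : MemLp (avg (mixGauss n s) m) (critExp n s) volume :=
    memLp_of_integrable_of_bdd (integrable_avg hmm hi _) (abs_avg_le hb _)
      (one_le_exp_of hs0 hsn).le
  refine ⟨fun x => (2 * Real.pi) ^ (2 * s) * ((h x).re - avg (mixGauss n s) m x),
    ((Lp.memLp h).re.sub hK).const_mul _, fun φ => ?_⟩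
  have i1 := MemLp.integrable_mul_schwartz hp.out (Lp.memLp h) φ
  have i2 := MemLp.integrable_mul_schwartz hp.out hK.ofReal φ
  obtain ⟨ψ, hψ⟩ := bessel_eq_schwartz (s := s) φ
  have hmb : ∀ {f : Sp n → ℂ} {C : ℝ}, AEStronglyMeasurable f volume → (∀ x, ‖f x‖ ≤ C) →
      Integrable fun x => (m x : ℂ) * f x := fun {f C} hf hC =>
    hi.ofReal.mul_bdd hf (.of_forall hC)
  obtain ⟨C, -, hC⟩ := φ.decay 0 0
  obtain ⟨C', -, hC'⟩ := ψ.decay 0 0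
  simp only [norm_iteratedFDeriv_zero, pow_zero, one_mul] at hC hC'
  have i3 : Integrable fun x => (m x : ℂ) * bessel s φ x := by
    rw [hψ]
    exact hmb ψ.continuous.aestronglyMeasurable hC'
  have i4 : Integrable fun x => (m x : ℂ) * ∫ y, φ (x + y) ∂(mixGauss n s) := by
    refine hmb (C := C) ?_ fun x => ?_
    · have : StronglyMeasurable (Function.uncurry fun x y : Sp n => φ (x + y)) :=
        (φ.continuous.comp (continuous_fst.add continuous_snd)).stronglyMeasurable
      exact this.integral_prod_right.aestronglyMeasurable
    · refine (norm_integral_le_of_norm_le_const (C := C) (.of_forall fun y => hC _)).trans ?_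
      simp
  calc ∫ x, (((2 * Real.pi) ^ (2 * s) * ((h x).re - avg (mixGauss n s) m x) : ℝ) : ℂ) * φ x
      = ∫ x, (((2 * Real.pi) ^ (2 * s) : ℝ) : ℂ) *
          (h x * φ x - (avg (mixGauss n s) m x : ℂ) * φ x) := by
        refine integral_congr_ae ?_
        filter_upwards [hreal] with x hx
        have : h x = ((h x).re : ℂ) := Complex.ext rfl (by simpa using hx)
        conv_rhs => rw [this]
        push_cast
        ring
    _ = (((2 * Real.pi) ^ (2 * s) : ℝ) : ℂ) * ((∫ x, h x * φ x) -
          ∫ x, (avg (mixGauss n s) m x : ℂ) * φ x) := by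
        rw [integral_const_mul]
        congr 1
        exact integral_sub i1 i2
    _ = (((2 * Real.pi) ^ (2 * s) : ℝ) : ℂ) * ((∫ x, (m x : ℂ) * bessel s φ x) -
          ∫ x, (m x : ℂ) * ∫ y, φ (x + y) ∂(mixGauss n s)) := by
        rw [hbes, integral_avg_mul hmm hi]
    _ = _ := by
        rw [← integral_sub i3 i4, ← integral_const_mul]
        congr 1
        ext x
        rw [fracLaplacianSchwartz_eq_bessel hs0 hs1]
        ring

/-! ### Averages of translates -/

theorem measurable_avg {m : Sp n → ℝ} (hm : Measurable m) (ν : Measure (Sp n)) [SFinite ν] :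
    Measurable (avg ν m) := by
  have h : StronglyMeasurable (Function.uncurry fun x y : Sp n => m (x - y)) :=
    (hm.comp (measurable_fst.sub measurable_snd)).stronglyMeasurable
  exact h.integral_prod_right.measurable

theorem enorm_integral_rpow_le {α : Type*} [MeasurableSpace α] {ν : Measure α}
    [IsProbabilityMeasure ν] {f : α → ℝ} (hf : AEStronglyMeasurable f ν) {q : ℝ} (hq : 1 ≤ q) :
    ‖∫ y, f y ∂ν‖ₑ ^ q ≤ ∫⁻ y, ‖f y‖ₑ ^ q ∂ν := by
  have hq0 : 0 < q := by linarith
  have h := eLpNorm_le_eLpNorm_of_exponent_le (μ := ν) (p := 1) (q := ENNReal.ofReal q)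
    (by simpa using hq) hf
  rw [eLpNorm_one_eq_lintegral_enorm, eLpNorm_eq_lintegral_rpow_enorm_toReal
    (by simpa using hq0) ENNReal.ofReal_ne_top, ENNReal.toReal_ofReal hq0.le] at h
  calc ‖∫ y, f y ∂ν‖ₑ ^ q ≤ ((∫⁻ y, ‖f y‖ₑ ^ q ∂ν) ^ (1 / q)) ^ q :=
        ENNReal.rpow_le_rpow ((enorm_integral_le_lintegral_enorm _).trans h) hq0.le
    _ = _ := by rw [← ENNReal.rpow_mul, one_div_mul_cancel hq0.ne', ENNReal.rpow_one]

theorem integrable_rpow_norm {g : Sp n → ℝ} {q : ℝ} (hq : 1 ≤ q)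
    (hgq : MemLp g (ENNReal.ofReal q)) : Integrable fun x => ‖g x‖ ^ q := by
  have hq0 : 0 < q := by linarith
  have := hgq.integrable_norm_rpow (by simpa using hq0) ENNReal.ofReal_ne_top
  rwa [ENNReal.toReal_ofReal hq0.le] at this

theorem ae_integrable_shift {g : Sp n → ℝ} (hg : Measurable g) {q : ℝ} (hq : 1 ≤ q)
    (hgq : MemLp g (ENNReal.ofReal q)) (ν : Measure (Sp n)) [IsFiniteMeasure ν] :
    ∀ᵐ x, Integrable (fun y => g (x - y)) ν := by
  have hq0 : 0 < q := by linarith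
  have h := (integrable_shift_prod (hg.norm.pow_const q) (integrable_rpow_norm hq hgq)
    ν).prod_right_ae
  filter_upwards [h] with x hx
  refine ((integrable_const (1 : ℝ)).add hx).mono'
    (hg.comp (measurable_const.sub measurable_id)).aestronglyMeasurable (.of_forall fun y => ?_)
  simp only [Pi.add_apply]
  rcases le_total ‖g (x - y)‖ 1 with h1 | h1
  · have : 0 ≤ ‖g (x - y)‖ ^ q := by positivity
    linarith
  · have := Real.self_le_rpow_of_one_le h1 hq
    linarith

/-- Jensen for the probability measure and Tonelli: the error of averaging is at most the mean error
of translating. -/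
theorem lintegral_avg_sub_le {g : Sp n → ℝ} (hg : Measurable g) {q : ℝ} (hq : 1 ≤ q)
    (hgq : MemLp g (ENNReal.ofReal q)) (ν : Measure (Sp n)) [IsProbabilityMeasure ν] :
    ∫⁻ x, ‖avg ν g x - g x‖ₑ ^ q ≤ ∫⁻ y, (∫⁻ x, ‖g (x - y) - g x‖ₑ ^ q) ∂ν := by
  have hm : Measurable fun z : Sp n × Sp n => ‖g (z.1 - z.2) - g z.1‖ₑ ^ q :=
    (((hg.comp (measurable_fst.sub measurable_snd)).sub (hg.comp measurable_fst)).enorm).pow_const q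
  rw [← lintegral_lintegral_swap hm.aemeasurable]
  refine lintegral_mono_ae ?_
  filter_upwards [ae_integrable_shift hg hq hgq ν] with x hx
  have e : avg ν g x - g x = ∫ y, (g (x - y) - g x) ∂ν := by
    rw [integral_sub hx (integrable_const _)]
    simp [avg]
  rw [e]
  exact enorm_integral_rpow_le (hx.sub (integrable_const _)).1 hq

theorem memLp_avg {g : Sp n → ℝ} (hg : Measurable g) {q : ℝ} (hq : 1 ≤ q)
    (hgq : MemLp g (ENNReal.ofReal q)) (ν : Measure (Sp n)) [IsProbabilityMeasure ν] :
    MemLp (avg ν g) (ENNReal.ofReal q) := by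
  have hq0 : 0 < q := by linarith
  refine ⟨(measurable_avg hg ν).aestronglyMeasurable, ?_⟩
  have hfin := (eLpNorm_lt_top_iff_lintegral_rpow_enorm_lt_top (by simpa using hq0)
    ENNReal.ofReal_ne_top).1 hgq.2
  rw [eLpNorm_lt_top_iff_lintegral_rpow_enorm_lt_top (by simpa using hq0) ENNReal.ofReal_ne_top]
  rw [ENNReal.toReal_ofReal hq0.le] at hfin ⊢
  have hm : Measurable fun z : Sp n × Sp n => ‖g (z.1 - z.2)‖ₑ ^ q :=
    ((hg.comp (measurable_fst.sub measurable_snd)).enorm).pow_const q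
  calc ∫⁻ x, ‖avg ν g x‖ₑ ^ q ≤ ∫⁻ x, ∫⁻ y, ‖g (x - y)‖ₑ ^ q ∂ν :=
        lintegral_mono fun x => enorm_integral_rpow_le
          (hg.comp (measurable_const.sub measurable_id)).aestronglyMeasurable hq
    _ = ∫⁻ y, (∫⁻ x, ‖g (x - y)‖ₑ ^ q) ∂ν := lintegral_lintegral_swap hm.aemeasurable
    _ = ∫⁻ _y, (∫⁻ x, ‖g x‖ₑ ^ q) ∂ν := by
        congr 1; ext y
        exact lintegral_sub_right_eq_self (fun x => ‖g x‖ₑ ^ q) y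
    _ < ⊤ := by simpa using hfin

theorem integral_avg_mul_eq {g : Sp n → ℝ} {ν : Measure (Sp n)} [SFinite ν] {Φ : Sp n → ℂ}
    (h : Integrable (fun z : Sp n × Sp n => (g (z.1 - z.2) : ℂ) * Φ z.1) (volume.prod ν)) :
    ∫ x, (avg ν g x : ℂ) * Φ x = ∫ y, (∫ x, (g x : ℂ) * Φ (x + y)) ∂ν := by
  have h1 : ∀ x, (avg ν g x : ℂ) * Φ x = ∫ y, (g (x - y) : ℂ) * Φ x ∂ν := fun x => by
    rw [avg, ← integral_complex_ofReal, integral_mul_const]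
  simp_rw [h1]
  rw [integral_integral_swap h]
  congr 1
  ext y
  rw [← integral_sub_right_eq_self (fun x => (g x : ℂ) * Φ (x + y)) y]
  simp

theorem fracLaplacianSchwartz_shift (φ : 𝓢(Sp n, ℂ)) (y x : Sp n) :
    fracLaplacianSchwartz s (SchwartzMap.compSubConstCLM ℂ (-y) φ) x
      = fracLaplacianSchwartz s φ (x + y) := by
  have h : ∀ ξ, 𝓕 (SchwartzMap.compSubConstCLM ℂ (-y) φ) ξ
      = (Real.fourierChar (inner ℝ ξ y) : ℂ) * 𝓕 φ ξ := by
    intro ξ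
    rw [SchwartzMap.fourier_coe, SchwartzMap.fourier_coe, Real.fourier_eq, Real.fourier_eq,
      ← integral_const_mul, ← integral_sub_right_eq_self (fun v => Real.fourierChar
        (-inner ℝ v ξ) • (SchwartzMap.compSubConstCLM ℂ (-y) φ) v) y]
    refine integral_congr_ae (.of_forall fun v => ?_)
    simp only [SchwartzMap.compSubConstCLM_apply, sub_neg_eq_add, sub_add_cancel, Circle.smul_def,
      smul_eq_mul, inner_sub_left]
    rw [show -(inner ℝ v ξ - inner ℝ y ξ) = inner ℝ ξ y + -inner ℝ v ξ by
      rw [real_inner_comm y ξ]; ring, AddChar.map_add_eq_mul, Circle.coe_mul]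
    ring
  rw [fracLaplacianSchwartz_eq, fracLaplacianSchwartz_eq, Real.fourierInv_eq, Real.fourierInv_eq]
  refine integral_congr_ae (.of_forall fun ξ => ?_)
  simp only [h, Circle.smul_def, smul_eq_mul, inner_add_right, AddChar.map_add_eq_mul,
    Circle.coe_mul]
  ring

theorem fracLaplacianSchwartz_bdd (φ : 𝓢(Sp n, ℂ)) :
    ∃ C, ∀ x, ‖fracLaplacianSchwartz s φ x‖ ≤ C :=
  ⟨_, norm_fourierInv_le _⟩

theorem continuous_fracLaplacianSchwartz (hs0 : 0 < s) (hs1 : s < 1) (φ : 𝓢(Sp n, ℂ)) :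
    Continuous (fracLaplacianSchwartz s φ) := by
  rw [fracLaplacianSchwartz_eq, Real.fourierInv_eq_fourier_comp_neg]
  exact VectorFourier.fourierIntegral_continuous Real.continuous_fourierChar
    continuous_inner (integrable_symb_mul hs0 hs1 _).comp_neg

/-- The fractional Laplacian commutes with averages of translates. -/
theorem IsFracLaplacian.avg (hs0 : 0 < s) (hs1 : s < 1) (hsn : 2 * s < n) {m g : Sp n → ℝ}
    (hmm : Measurable m) (hi : Integrable m) (hgm : Measurable g)
    (h : IsFracLaplacian s (critExp n s) m g) (ν : Measure (Sp n)) [IsProbabilityMeasure ν] :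
    IsFracLaplacian s (critExp n s) (avg ν m) (avg ν g) := by
  have hq1 := one_le_exp_of hs0 hsn
  set q := (n : ℝ) / (2 * s) with hq
  have hgq : MemLp g (ENNReal.ofReal q) := h.1
  refine ⟨memLp_avg hgm hq1.le hgq ν, fun φ => ?_⟩
  have hφm : Measurable φ := φ.continuous.measurable
  have hFm : Measurable (fracLaplacianSchwartz s φ) :=
    (continuous_fracLaplacianSchwartz hs0 hs1 φ).measurable
  have hc := Real.HolderConjugate.conjExponent hq1
  rw [integral_avg_mul_eq, integral_avg_mul_eq]
  · congr 1
    ext y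
    have := h.2 (SchwartzMap.compSubConstCLM ℂ (-y) φ)
    simpa only [fracLaplacianSchwartz_shift, SchwartzMap.compSubConstCLM_apply, sub_neg_eq_add]
      using this
  · obtain ⟨C, hC⟩ := fracLaplacianSchwartz_bdd (s := s) φ
    refine ((integrable_shift_prod hmm hi ν).norm.mul_const C).mono' ?_ (.of_forall fun z => ?_)
    · exact ((Complex.measurable_ofReal.comp (hmm.comp (measurable_fst.sub measurable_snd))).mul
          (hFm.comp measurable_fst)).aestronglyMeasurable
    · rw [norm_mul, Complex.norm_real]
      exact mul_le_mul_of_nonneg_left (hC _) (norm_nonneg _)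
  -- Integrability on the product space by Young's inequality, |g φ| ≤ |g|^q/q + |φ|^{q'}/q', each
  -- term being a translate of an integrable function times a finite measure.
  · have i1 := integrable_shift_prod (hgm.norm.pow_const q) (integrable_rpow_norm hq1.le hgq) ν
    have i2 : Integrable (fun x => ‖φ x‖ ^ q.conjExponent) := by
      have h0 : 0 < q.conjExponent := hc.symm.pos
      have := (φ.memLp (ENNReal.ofReal q.conjExponent) volume).integrable_norm_rpow
        (by simpa using h0) ENNReal.ofReal_ne_top
      rwa [ENNReal.toReal_ofReal h0.le] at this
    have i3 : Integrable (fun z : Sp n × Sp n => ‖φ z.1‖ ^ q.conjExponent * (1 : ℝ))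
      (volume.prod ν) := i2.mul_prod (integrable_const 1)
    refine ((i1.div_const q).add (i3.div_const q.conjExponent)).mono' ?_ (.of_forall fun z => ?_)
    · exact ((Complex.measurable_ofReal.comp (hgm.comp (measurable_fst.sub measurable_snd))).mul
          (hφm.comp measurable_fst)).aestronglyMeasurable
    · rw [norm_mul, Complex.norm_real]
      simpa using Real.young_inequality_of_nonneg (norm_nonneg (g (z.1 - z.2)))
        (norm_nonneg (φ z.1)) hc

/-- Continuity of translations in `L^p`. -/
theorem exists_shift_sub_le {g : Sp n → ℝ} {q : ℝ} (hq : 1 ≤ q)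
    (hgq : MemLp g (ENNReal.ofReal q)) {ε : ℝ≥0∞} (hε : 0 < ε) :
    ∃ r > 0, ∀ y : Sp n, ‖y‖ < r → ∫⁻ x, ‖g (x - y) - g x‖ₑ ^ q ≤ ε := by
  have hq0 : 0 < q := by linarith
  have hp : Fact (1 ≤ ENNReal.ofReal q) := ⟨by simpa using hq⟩
  let F : C(Sp n, C(Sp n, Sp n)) :=
    ContinuousMap.curry ⟨fun z : Sp n × Sp n => z.2 - z.1, by fun_prop⟩
  have hF : ∀ y, MeasurePreserving (F y) (volume : Measure (Sp n)) volume := fun y =>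
    measurePreserving_sub_right volume y
  have ht : Filter.Tendsto (fun y => Lp.compMeasurePreserving (F y) (hF y) (hgq.toLp g)) (𝓝 0)
      (𝓝 (Lp.compMeasurePreserving (F 0) (hF 0) (hgq.toLp g))) :=
    tendsto_const_nhds.compMeasurePreservingLp (F.continuous.tendsto 0) hF (hF 0)
      ENNReal.ofReal_ne_top
  have ht2 := (EMetric.tendsto_nhds.1 ht) (ε ^ (1 / q)) (ENNReal.rpow_pos_of_nonneg hε (by positivity))
  obtain ⟨r, hr, h⟩ := Metric.eventually_nhds_iff.1 ht2
  refine ⟨r, hr, fun y hy => ?_⟩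
  have h1 := h (y := y) (by simpa using hy)
  rw [Lp.toLp_compMeasurePreserving, Lp.toLp_compMeasurePreserving, Lp.edist_toLp_toLp,
    eLpNorm_eq_lintegral_rpow_enorm_toReal (by simpa using hq0) ENNReal.ofReal_ne_top,
    ENNReal.toReal_ofReal hq0.le, ENNReal.rpow_lt_rpow_iff (by positivity)] at h1
  refine le_trans (le_of_eq ?_) h1.le
  congr 1
  ext x
  simp [F]

/-! ### Mollification -/

/-- The probability measure with density a normalized bump function. -/
def bumpMeasure (ρ : ContDiffBump (0 : Sp n)) : Measure (Sp n) :=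
  volume.withDensity fun y => ENNReal.ofReal (ρ.normed volume y)

theorem isProbabilityMeasure_bumpMeasure (ρ : ContDiffBump (0 : Sp n)) :
    IsProbabilityMeasure (bumpMeasure ρ) := by
  refine ⟨?_⟩
  rw [bumpMeasure, withDensity_apply _ MeasurableSet.univ, Measure.restrict_univ,
    ← ofReal_integral_eq_lintegral_ofReal ρ.integrable_normed
      (.of_forall fun y => ρ.nonneg_normed y), ρ.integral_normed, ENNReal.ofReal_one]

/-- Links two descriptions of mollification: smoothness, support and almost everywhere convergence
come from the convolution, `L^q` convergence and the fractional Laplacian from the average. -/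
theorem avg_bumpMeasure (ρ : ContDiffBump (0 : Sp n)) (m : Sp n → ℝ) :
    avg (bumpMeasure ρ) m
      = convolution (ρ.normed volume) m (ContinuousLinearMap.lsmul ℝ ℝ) volume := by
  ext x
  rw [avg, bumpMeasure, integral_withDensity_eq_integral_toReal_smul
    ρ.continuous_normed.measurable.ennreal_ofReal (.of_forall fun _ => ENNReal.ofReal_lt_top),
    convolution_def]
  congr 1
  ext y
  rw [ENNReal.toReal_ofReal (ρ.nonneg_normed y)]
  rfl

theorem ae_norm_lt_bumpMeasure (ρ : ContDiffBump (0 : Sp n)) :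
    ∀ᵐ y ∂bumpMeasure ρ, ‖y‖ < ρ.rOut := by
  rw [bumpMeasure, ae_withDensity_iff ρ.continuous_normed.measurable.ennreal_ofReal]
  refine .of_forall fun y hy => ?_
  have h : y ∈ Function.support (ρ.normed volume) := fun h0 => hy (by rw [h0]; simp)
  rw [ρ.support_normed_eq] at h
  simpa using h

theorem avg_mem_Icc {m : Sp n → ℝ} (hm : Measurable m) {lo hi : ℝ} (hb : ∀ x, m x ∈ Set.Icc lo hi)
    (ν : Measure (Sp n)) [IsProbabilityMeasure ν] (x : Sp n) : avg ν m x ∈ Set.Icc lo hi := by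
  have hint : Integrable (fun y => m (x - y)) ν :=
    Integrable.of_bound (C := max |lo| |hi|)
      (hm.comp (measurable_const.sub measurable_id)).aestronglyMeasurable
      (.of_forall fun y => abs_le_max_abs_abs (hb _).1 (hb _).2)
  constructor
  · have := integral_mono (integrable_const lo) hint fun y => (hb _).1
    simpa [avg] using this
  · have := integral_mono hint (integrable_const hi) fun y => (hb _).2
    simpa [avg] using this

/-- Smooth approximations of a function together with its fractional Laplacian. -/
structure IsApprox (s lo hi : ℝ) (m g : Sp n → ℝ) (M G : ℕ → Sp n → ℝ) : Prop where
  contDiff : ∀ k, ContDiff ℝ ∞ (M k)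
  hasCompactSupport : ∀ k, HasCompactSupport (M k)
  mem_Icc : ∀ k x, M k x ∈ Set.Icc lo hi
  tendsto_ae : ∀ᵐ x, Filter.Tendsto (fun k => M k x) Filter.atTop (𝓝 (m x))
  isFracLaplacian : ∀ k, IsFracLaplacian s (critExp n s) (M k) (G k)
  memLp : MemLp g (critExp n s)
  tendsto : Filter.Tendsto (fun k => eLpNorm (fun x => G k x - g x) (critExp n s) volume)
    Filter.atTop (𝓝 0)

theorem IsFracLaplacian.congr {p : ℝ≥0∞} {m m' g g' : Sp n → ℝ} (h : IsFracLaplacian s p m g)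
    (hm : m =ᵐ[volume] m') (hg : g =ᵐ[volume] g') : IsFracLaplacian s p m' g' := by
  refine ⟨(memLp_congr_ae hg).1 h.1, fun φ => ?_⟩
  have e1 : ∫ x, (g x : ℂ) * φ x = ∫ x, (g' x : ℂ) * φ x :=
    integral_congr_ae (by filter_upwards [hg] with x hx; rw [hx])
  have e2 : ∫ x, (m x : ℂ) * fracLaplacianSchwartz s φ x
      = ∫ x, (m' x : ℂ) * fracLaplacianSchwartz s φ x :=
    integral_congr_ae (by filter_upwards [hm] with x hx; rw [hx])
  rw [← e1, ← e2, h.2]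

/-- Mollification keeps the bounds `lo`, `hi` and compact support, and commutes with the fractional
Laplacian; convergence of the Laplacians in `L^{n/2s}` is then continuity of translations. -/
theorem exists_isApprox (hs0 : 0 < s) (hs1 : s < 1) (hsn : 2 * s < n) {m g : Sp n → ℝ}
    (hmm : Measurable m) {lo hi : ℝ} (hb : ∀ x, m x ∈ Set.Icc lo hi) (hc : HasCompactSupport m)
    (h : IsFracLaplacian s (critExp n s) m g) : ∃ M G, IsApprox s lo hi m g M G := by
  have hq1 := (one_le_exp_of hs0 hsn).le
  have him : Integrable m := by
    rw [← integrableOn_iff_integrable_of_support_subset (subset_tsupport m)]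
    exact Measure.integrableOn_of_bounded (M := max |lo| |hi|) hc.isCompact.measure_lt_top.ne
      hmm.aestronglyMeasurable
      (.of_forall fun x => abs_le_max_abs_abs (hb x).1 (hb x).2)
  wlog hgm : Measurable g generalizing g
  · obtain ⟨g', hg', e⟩ := h.1.1
    obtain ⟨M, G, hMG⟩ := this (h.congr (.refl _ _) e) hg'.measurable
    refine ⟨M, G, ⟨hMG.1, hMG.2, hMG.3, hMG.4, hMG.5, h.1, ?_⟩⟩
    refine hMG.tendsto.congr fun k => eLpNorm_congr_ae ?_
    filter_upwards [e] with x hx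
    rw [hx]
  -- The ratio 2 of outer to inner radius stays fixed; the almost everywhere convergence below
  -- requires this ratio to be bounded.
  let ρ : ℕ → ContDiffBump (0 : Sp n) := fun k =>
    ⟨1 / ((k : ℝ) + 1), 2 * (1 / ((k : ℝ) + 1)), by positivity, by
      have : 0 < 1 / ((k : ℝ) + 1) := by positivity
      linarith⟩
  have hρ : Filter.Tendsto (fun k => (ρ k).rOut) Filter.atTop (𝓝 0) := by
    have := (tendsto_one_div_add_atTop_nhds_zero_nat (𝕜 := ℝ)).const_mul 2
    rwa [mul_zero] at this
  have hν := fun k => isProbabilityMeasure_bumpMeasure (ρ k)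
  refine ⟨fun k => avg (bumpMeasure (ρ k)) m, fun k => avg (bumpMeasure (ρ k)) g,
    fun k => ?_, fun k => ?_, fun k => avg_mem_Icc hmm hb _, ?_,
    fun k => h.avg hs0 hs1 hsn hmm him hgm _, h.1, ?_⟩
  · rw [avg_bumpMeasure]
    exact (ρ k).hasCompactSupport_normed.contDiff_convolution_left _ (ρ k).contDiff_normed
      him.locallyIntegrable
  · rw [avg_bumpMeasure]
    exact (ρ k).hasCompactSupport_normed.convolution _ hc
  · simp_rw [avg_bumpMeasure]
    exact ContDiffBump.ae_convolution_tendsto_right_of_locallyIntegrable (K := 2) hρ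
      (.of_forall fun k => le_rfl) him.locallyIntegrable
  · set q := (n : ℝ) / (2 * s) with hq
    have hq0 : 0 < q := by linarith
    have hgq : MemLp g (ENNReal.ofReal q) := h.1
    have hz : Filter.Tendsto (fun k => ∫⁻ x, ‖avg (bumpMeasure (ρ k)) g x - g x‖ₑ ^ q)
        Filter.atTop (𝓝 0) := by
      rw [ENNReal.tendsto_nhds_zero]
      intro ε hε
      obtain ⟨r, hr, hr'⟩ := exists_shift_sub_le hq1 hgq hε
      filter_upwards [hρ.eventually_lt_const hr] with k hk
      refine (lintegral_avg_sub_le hgm hq1 hgq _).trans ?_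
      calc _ ≤ ∫⁻ _y, ε ∂(bumpMeasure (ρ k)) := lintegral_mono_ae (by
            filter_upwards [ae_norm_lt_bumpMeasure (ρ k)] with y hy
            exact hr' y (hy.trans hk))
        _ = ε := by simp
    have := (ENNReal.continuous_rpow_const (y := 1 / q)).tendsto 0 |>.comp hz
    rw [ENNReal.zero_rpow_of_pos (by positivity)] at this
    refine this.congr fun k => ?_
    rw [critExp, eLpNorm_eq_lintegral_rpow_enorm_toReal (by simpa using hq0) ENNReal.ofReal_ne_top,
      ENNReal.toReal_ofReal hq0.le]
    rfl

/-! ### Pairing with a smooth function -/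

theorem pairing_comm (hs0 : 0 < s) (hs1 : s < 1) (hn : 0 < n) (w v : Hs n s) :
    fracLaplacianPairing w v = fracLaplacianPairing v w := by
  rw [Hs.pairing_eq hs0 hs1 hn, Hs.pairing_eq hs0 hs1 hn]
  simp_rw [mul_comm]

theorem re_fracLaplacianSchwartz {ψ : Sp n → ℝ} (h1 : ContDiff ℝ ∞ ψ) (h2 : HasCompactSupport ψ)
    (x : Sp n) : (((fracLaplacianSchwartz s (schwartzOf h1 h2) x).re : ℝ) : ℂ)
      = fracLaplacianSchwartz s (schwartzOf h1 h2) x :=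
  Complex.conj_eq_iff_re.1 (fracLaplacianSchwartz_real (fun x => by rw [schwartzOf_apply]; simp) x)

theorem memLp_fracLaplacianSchwartz (hs0 : 0 < s) (hs1 : s < 1) (φ : 𝓢(Sp n, ℂ)) :
    MemLp (fracLaplacianSchwartz s φ) 2 :=
  (memLp_congr_ae (fourierInv_toLp_ae_eq (integrable_symb_mul hs0 hs1 (𝓕 φ))
    (memLp_symb_mul hs0 hs1 (𝓕 φ)))).1 (Lp.memLp _)

/-- Plancherel with the symbol attached to the smooth factor: |2πξ|^{2s} times the transform of ψ is
integrable and square integrable, so its inverse transform is the classical integral. -/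
theorem pairing_smooth (hs0 : 0 < s) (hs1 : s < 1) {ψ : Sp n → ℝ}
    (h1 : ContDiff ℝ ∞ ψ) (h2 : HasCompactSupport ψ) {Ψ : Hs n s} (hΨ : Ψ =ᵐ[volume] ψ)
    (w : Hs n s) : fracLaplacianPairing Ψ w
      = ∫ x, (fracLaplacianSchwartz s (schwartzOf h1 h2) x).re * w x := by
  set φ := schwartzOf h1 h2 with hφ
  have m1 := integrable_symb_mul hs0 hs1 (𝓕 φ)
  have m2 := memLp_symb_mul hs0 hs1 (𝓕 φ)
  have hF : Hs.fourier Ψ =ᵐ[volume] ⇑(𝓕 φ : 𝓢(Sp n, ℂ)) := by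
    have e : toComplexL2 (Hs.toL2 Ψ) = φ.toLp 2 volume := by
      apply Lp.ext
      filter_upwards [coeFn_toComplexL2 (Hs.toL2 Ψ), φ.coeFn_toLp 2 volume, hΨ] with x hx hy hz
      rw [hx, hy, hz, hφ, schwartzOf_apply]
    have e2 : Hs.fourier Ψ = (𝓕 φ).toLp 2 volume := by
      rw [Hs.fourier, fourierL2_eq, e, SchwartzMap.toLp_fourier_eq]
    rw [e2]
    exact (𝓕 φ).coeFn_toLp 2 volume
  have e1 : fracLaplacianPairing Ψ w = (inner ℂ (Hs.fourier w) (m2.toLp)).re := by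
    rw [fracLaplacianPairing, L2.inner_def]
    congr 1
    refine integral_congr_ae ?_
    filter_upwards [hF, m2.coeFn_toLp] with ξ hξ hξ2
    rw [hξ2, hξ, RCLike.inner_apply]
    rfl
  have e2 : inner ℂ (Hs.fourier w) (m2.toLp)
      = inner ℂ (toComplexL2 (Hs.toL2 w)) (𝓕⁻ (m2.toLp) : L2C n) := by
    rw [Hs.fourier, fourierL2_eq, ← Lp.inner_fourier_eq (toComplexL2 (Hs.toL2 w))]
    rw [fourier_fourierInv_eq]
  rw [e1, e2, L2.inner_def]
  have e3 : ∫ x, inner ℂ (toComplexL2 (Hs.toL2 w) x) ((𝓕⁻ (m2.toLp) : L2C n) x)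
      = ∫ x, (((fracLaplacianSchwartz s φ x).re * w x : ℝ) : ℂ) := by
    refine integral_congr_ae ?_
    filter_upwards [coeFn_toComplexL2 (Hs.toL2 w), fourierInv_toLp_ae_eq m1 m2] with x hx hy
    rw [hx, hy, RCLike.inner_apply, Complex.conj_ofReal, Complex.ofReal_mul,
      re_fracLaplacianSchwartz]
    rfl
  rw [e3, integral_complex_ofReal, Complex.ofReal_re]

/-- Both functions have the same integral against every test function φ: move the operator from φ to
ψ by symmetry of the pairing. -/
theorem IsFracLaplacian.ae_eq_smooth (hs0 : 0 < s) (hs1 : s < 1) (hn : 0 < n) {p : ℝ≥0∞}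
    (hp : 1 ≤ p) {ψ g : Sp n → ℝ} (h1 : ContDiff ℝ ∞ ψ) (h2 : HasCompactSupport ψ)
    (h : IsFracLaplacian s p ψ g) :
    g =ᵐ[volume] fun x => (fracLaplacianSchwartz s (schwartzOf h1 h2) x).re := by
  refine ae_eq_of_integral_contDiff_smul_eq (h.1.locallyIntegrable hp)
    ((memLp_fracLaplacianSchwartz hs0 hs1 _).re.locallyIntegrable (by norm_num)) fun φ k1 k2 => ?_
  have a1 := (bddLip_of_contDiff h1 h2).isHs hs0 hs1 hn h2
  have a2 := (bddLip_of_contDiff k1 k2).isHs hs0 hs1 hn k2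
  have c1 := a1.coeFn_toHs hs0 hs1 hn
  have c2 := a2.coeFn_toHs hs0 hs1 hn
  have e1 := pairing_smooth hs0 hs1 h1 h2 c1 (a2.toHs hs0 hs1 hn)
  have e2 := pairing_smooth hs0 hs1 k1 k2 c2 (a1.toHs hs0 hs1 hn)
  rw [pairing_comm hs0 hs1 hn, e2] at e1
  have e3 := h.2 (schwartzOf k1 k2)
  have e4 : ∫ x, φ x • g x = ∫ x, (fracLaplacianSchwartz s (schwartzOf k1 k2) x).re * ψ x := by
    have : ((∫ x, φ x • g x : ℝ) : ℂ)
        = ((∫ x, (fracLaplacianSchwartz s (schwartzOf k1 k2) x).re * ψ x : ℝ) : ℂ) := by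
      rw [← integral_complex_ofReal, ← integral_complex_ofReal]
      refine Eq.trans ?_ (e3.trans ?_)
      · congr 1; ext x; simp [mul_comm]
      · congr 1; ext x
        rw [Complex.ofReal_mul, re_fracLaplacianSchwartz, mul_comm]
    exact_mod_cast this
  rw [e4]
  refine Eq.trans (integral_congr_ae ?_) (e1.trans (integral_congr_ae ?_))
  · filter_upwards [c1] with x hx; rw [hx]
  · filter_upwards [c2] with x hx; rw [hx, smul_eq_mul, mul_comm]

/-- For smooth ψ the function g is also in `L²` by `IsFracLaplacian.ae_eq_smooth`, so it may be
paired with every w in `H^s`, not just with Schwartz functions. -/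
theorem IsFracLaplacian.pairing_eq (hs0 : 0 < s) (hs1 : s < 1) (hn : 0 < n) {p : ℝ≥0∞}
    (hp : 1 ≤ p) {ψ g : Sp n → ℝ} (h1 : ContDiff ℝ ∞ ψ) (h2 : HasCompactSupport ψ)
    (h : IsFracLaplacian s p ψ g) {w : Sp n → ℝ} (hw : IsHs s w) :
    halfConst n s * ∫ z, diffq s ψ z * diffq s w z ∂vol2 n = ∫ x, g x * w x := by
  have a1 := (bddLip_of_contDiff h1 h2).isHs hs0 hs1 hn h2
  have c1 := a1.coeFn_toHs hs0 hs1 hn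
  have c2 := hw.coeFn_toHs hs0 hs1 hn
  have e1 := pairing_smooth hs0 hs1 h1 h2 c1 (hw.toHs hs0 hs1 hn)
  rw [Hs.pairing_eq hs0 hs1 hn] at e1
  refine Eq.trans ?_ (e1.trans (integral_congr_ae ?_))
  · congr 1
    refine integral_congr_ae ?_
    filter_upwards [diffq_congr_ae s c1, diffq_congr_ae s c2] with z hz hz2
    rw [hz, hz2]
  · filter_upwards [c2, h.ae_eq_smooth hs0 hs1 hn hp h1 h2] with x hx hx2
    rw [hx, hx2]

/-! ### Bounded bilinear forms on `H^s` -/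

theorem integral_abs_mul_le_sqrt {α : Type*} [MeasurableSpace α] {μ : Measure α} {f g : α → ℝ}
    (hf : MemLp f 2 μ) (hg : MemLp g 2 μ) :
    ∫ x, |f x * g x| ∂μ ≤ √(∫ x, f x ^ 2 ∂μ) * √(∫ x, g x ^ 2 ∂μ) := by
  have h := integral_mul_norm_le_Lp_mul_Lq (μ := μ) (f := f) (g := g) Real.HolderConjugate.two_two
    (by simpa using hf) (by simpa using hg)
  simpa [abs_mul, Real.sqrt_eq_rpow] using h

theorem holderTriple_ofReal {a b c : ℝ} (ha : 0 < a) (hb : 0 < b) (hc : 0 < c)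
    (h : a⁻¹ + b⁻¹ = c⁻¹) :
    ENNReal.HolderTriple (ENNReal.ofReal a) (ENNReal.ofReal b) (ENNReal.ofReal c) := by
  refine ⟨?_⟩
  rw [← ENNReal.ofReal_inv_of_pos ha, ← ENNReal.ofReal_inv_of_pos hb,
    ← ENNReal.ofReal_inv_of_pos hc, ← ENNReal.ofReal_add (by positivity) (by positivity), h]

theorem exists_eLpNorm_le (hs0 : 0 < s) (hsn : 2 * s < n) (hn : 0 < n) :
    ∃ C : ℝ, 0 < C ∧ ∀ u : Hs n s, eLpNorm u (ENNReal.ofReal (sobExp n s)) volume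
      ≤ ENNReal.ofReal (C * ‖u‖) := by
  obtain ⟨C, hC, h⟩ := exists_sobolev hs0 hsn hn
  have hr : 0 < sobExp n s := by linarith [sobExp_gt_two hs0 hsn]
  refine ⟨C ^ (1 / sobExp n s), by positivity, fun u => ?_⟩
  rw [eLpNorm_eq_lintegral_rpow_enorm_toReal (by simpa using hr) ENNReal.ofReal_ne_top,
    ENNReal.toReal_ofReal hr.le]
  refine (ENNReal.rpow_le_rpow (h u) (by positivity)).trans ?_
  rw [ENNReal.ofReal_rpow_of_nonneg (by positivity) (by positivity),
    Real.mul_rpow hC.le (by positivity), ← Real.rpow_mul (norm_nonneg u),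
    mul_one_div_cancel hr.ne', Real.rpow_one]

/-- The Hölder and Sobolev inequalities for `∫ g u v`. -/
theorem exists_holder (hs0 : 0 < s) (hsn : 2 * s < n) (hn : 0 < n) :
    ∃ C : ℝ, 0 < C ∧ ∀ (g : Sp n → ℝ) (_ : MemLp g (critExp n s)) (u v : Hs n s),
      Integrable (fun x => g x * u x * v x) ∧
      ∫ x, |g x * u x * v x| ≤ C * (eLpNorm g (critExp n s) volume).toReal * ‖u‖ * ‖v‖ := by
  obtain ⟨C, hC, h⟩ := exists_eLpNorm_le hs0 hsn hn
  refine ⟨C * C, by positivity, fun g hg u v => ?_⟩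
  set r := sobExp n s with hr
  have hr2 : 2 < r := sobExp_gt_two hs0 hsn
  have hn' : (0 : ℝ) < n := by exact_mod_cast hn
  have hd : (0 : ℝ) < n - 2 * s := by linarith
  -- With r = 2n/(n-2s), the three Hölder exponents satisfy 2s/n + 1/r + 1/r = 1.
  have T1 : ENNReal.HolderTriple (critExp n s) (ENNReal.ofReal r) (ENNReal.ofReal (r / (r - 1))) := by
    refine holderTriple_ofReal (by positivity) (by linarith)
      (div_pos (by linarith) (by linarith)) ?_
    rw [hr, sobExp]
    field_simp
    ring
  have T2 : ENNReal.HolderTriple (ENNReal.ofReal (r / (r - 1))) (ENNReal.ofReal r) 1 := by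
    have := holderTriple_ofReal (a := r / (r - 1)) (b := r) (c := 1)
      (div_pos (by linarith) (by linarith)) (by linarith) one_pos (by
        have : r - 1 ≠ 0 := by linarith
        have : r ≠ 0 := by linarith
        field_simp
        ring)
    simpa using this
  have mu : MemLp u (ENNReal.ofReal r) := ⟨(Lp.memLp (Hs.toL2 u)).1, (h u).trans_lt ENNReal.ofReal_lt_top⟩
  have mv : MemLp v (ENNReal.ofReal r) := ⟨(Lp.memLp (Hs.toL2 v)).1, (h v).trans_lt ENNReal.ofReal_lt_top⟩
  have i : Integrable (fun x => g x * u x * v x) := by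
    have h1 : MemLp (fun x => g x * u x) (ENNReal.ofReal (r / (r - 1))) volume := mu.smul hg
    exact memLp_one_iff_integrable.1 (mv.smul h1)
  refine ⟨i, ?_⟩
  have e1 : eLpNorm (fun x => g x * u x * v x) 1 volume
      ≤ eLpNorm g (critExp n s) volume * ENNReal.ofReal (C * ‖u‖) * ENNReal.ofReal (C * ‖v‖) := by
    refine (eLpNorm_smul_le_mul_eLpNorm (p := ENNReal.ofReal (r / (r - 1)))
      (q := ENNReal.ofReal r) mv.1 (hg.1.mul mu.1)).trans ?_
    refine mul_le_mul' ?_ (h v)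
    refine (eLpNorm_smul_le_mul_eLpNorm (p := critExp n s) (q := ENNReal.ofReal r) mu.1 hg.1).trans ?_
    exact mul_le_mul' le_rfl (h u)
  have e2 : ∫ x, |g x * u x * v x| = (eLpNorm (fun x => g x * u x * v x) 1 volume).toReal := by
    rw [eLpNorm_one_eq_lintegral_enorm]
    exact integral_norm_eq_lintegral_enorm i.1
  rw [e2]
  refine (ENNReal.toReal_mono (by
    exact ENNReal.mul_ne_top (ENNReal.mul_ne_top hg.2.ne ENNReal.ofReal_ne_top)
      ENNReal.ofReal_ne_top) e1).trans (le_of_eq ?_)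
  rw [ENNReal.toReal_mul, ENNReal.toReal_mul, ENNReal.toReal_ofReal (by positivity),
    ENNReal.toReal_ofReal (by positivity)]
  ring

theorem exists_mulBilin (hs0 : 0 < s) (hsn : 2 * s < n) (hn : 0 < n) {g : Sp n → ℝ}
    (hg : MemLp g (critExp n s)) :
    ∃ B : Hs n s →L[ℝ] Hs n s →L[ℝ] ℝ, ∀ u v, B u v = ∫ x, g x * u x * v x := by
  obtain ⟨C, -, h⟩ := exists_holder hs0 hsn hn
  refine ⟨LinearMap.mkContinuous₂ (LinearMap.mk₂ ℝ (fun u v : Hs n s => ∫ x, g x * u x * v x)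
    ?_ ?_ ?_ ?_) (C * (eLpNorm g (critExp n s) volume).toReal) ?_, fun u v => rfl⟩
  · intro u u' v
    refine Eq.trans (integral_congr_ae ?_) (integral_add (h g hg u v).1 (h g hg u' v).1)
    filter_upwards [Hs.coeFn_add u u'] with x hx
    rw [hx]; ring
  · intro c u v
    refine Eq.trans (integral_congr_ae ?_) (integral_const_mul c _)
    filter_upwards [Hs.coeFn_smul c u] with x hx
    rw [hx]; ring
  · intro u v v'
    refine Eq.trans (integral_congr_ae ?_) (integral_add (h g hg u v).1 (h g hg u v').1)
    filter_upwards [Hs.coeFn_add v v'] with x hx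
    rw [hx]; ring
  · intro c u v
    refine Eq.trans (integral_congr_ae ?_) (integral_const_mul c _)
    filter_upwards [Hs.coeFn_smul c v] with x hx
    rw [hx]; ring
  · intro u v
    exact (norm_integral_le_integral_norm _).trans (h g hg u v).2

theorem ae_vol2_of_ae {P : Sp n → Prop} (h : ∀ᵐ x, P x) :
    ∀ᵐ z : Sp n × Sp n ∂vol2 n, P z.1 ∧ P z.2 :=
  (Measure.quasiMeasurePreserving_fst.ae h).and (Measure.quasiMeasurePreserving_snd.ae h)

theorem aestronglyMeasurable_prod_mul {a : Sp n → ℝ} (ha : AEStronglyMeasurable a) :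
    AEStronglyMeasurable (fun z : Sp n × Sp n => a z.1 * a z.2) (vol2 n) :=
  ha.comp_fst.mul ha.comp_snd

theorem ae_abs_prod_mul_le {a : Sp n → ℝ} {b : ℝ} (hb : ∀ᵐ x, |a x| ≤ b) :
    ∀ᵐ z : Sp n × Sp n ∂vol2 n, |a z.1 * a z.2| ≤ b ^ 2 := by
  filter_upwards [ae_vol2_of_ae hb] with z hz
  rw [abs_mul, sq]
  exact mul_le_mul hz.1 hz.2 (abs_nonneg _) ((abs_nonneg _).trans hz.1)

theorem integrable_dqForm {a u v : Sp n → ℝ} (ha : AEStronglyMeasurable a) {b : ℝ}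
    (hb : ∀ᵐ x, |a x| ≤ b) (hu : IsHs s u) (hv : IsHs s v) :
    Integrable (fun z => a z.1 * a z.2 * (diffq s u z * diffq s v z)) (vol2 n) :=
  (hu.memLp_diffq.integrable_mul hv.memLp_diffq).bdd_mul (aestronglyMeasurable_prod_mul ha)
    (ae_abs_prod_mul_le hb)

theorem exists_dqBilin (hs0 : 0 < s) (hs1 : s < 1) (hn : 0 < n) {a : Sp n → ℝ}
    (ha : AEStronglyMeasurable a) {b : ℝ} (hb : ∀ᵐ x, |a x| ≤ b) :
    ∃ B : Hs n s →L[ℝ] Hs n s →L[ℝ] ℝ, (∀ u v, B u v = halfConst n s * dqForm s a u v) ∧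
      ∀ u v, |B u v| ≤ b ^ 2 * ‖u‖ * ‖v‖ := by
  have hκ := halfConst_pos (n := n) hs0 hs1
  have hi := fun u v : Hs n s => integrable_dqForm ha hb (u.isHs hs0 hs1 hn) (v.isHs hs0 hs1 hn)
  have hbd : ∀ u v : Hs n s, ‖halfConst n s * dqForm s a u v‖ ≤ b ^ 2 * ‖u‖ * ‖v‖ := by
    intro u v
    have hu := u.isHs hs0 hs1 hn
    have hv := v.isHs hs0 hs1 hn
    have h1 : |dqForm s a u v| ≤ b ^ 2 * ∫ z, |diffq s u z * diffq s v z| ∂vol2 n := by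
      rw [← integral_const_mul]
      refine (norm_integral_le_integral_norm _).trans (integral_mono_ae (hi u v).norm
        ((hu.memLp_diffq.integrable_mul hv.memLp_diffq).norm.const_mul _) ?_)
      filter_upwards [ae_abs_prod_mul_le hb] with z hz
      rw [Real.norm_eq_abs, abs_mul]
      exact mul_le_mul_of_nonneg_right hz (abs_nonneg _)
    have h2 := integral_abs_mul_le_sqrt hu.memLp_diffq hv.memLp_diffq
    have h3 : ∀ w : Hs n s, √(halfConst n s) * √(∫ z, diffq s w z ^ 2 ∂vol2 n) ≤ ‖w‖ := by
      intro w
      rw [← Real.sqrt_mul hκ.le]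
      exact Real.sqrt_le_iff.2 ⟨norm_nonneg _, Hs.integral_diffq_le hs0 hs1 hn w⟩
    rw [Real.norm_eq_abs, abs_mul, abs_of_pos hκ]
    calc halfConst n s * |dqForm s a u v|
        ≤ halfConst n s * (b ^ 2 * (√(∫ z, diffq s u z ^ 2 ∂vol2 n)
            * √(∫ z, diffq s v z ^ 2 ∂vol2 n))) := by gcongr; exact h1.trans (by gcongr)
      _ = b ^ 2 * (√(halfConst n s) * √(∫ z, diffq s u z ^ 2 ∂vol2 n))
            * (√(halfConst n s) * √(∫ z, diffq s v z ^ 2 ∂vol2 n)) := by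
          nth_rw 1 [← Real.mul_self_sqrt hκ.le]; ring
      _ ≤ _ := by gcongr <;> exact h3 _
  refine ⟨LinearMap.mkContinuous₂ (LinearMap.mk₂ ℝ
    (fun u v : Hs n s => halfConst n s * dqForm s a u v) ?_ ?_ ?_ ?_) (b ^ 2) hbd,
    fun u v => rfl, hbd⟩
  · intro u u' v
    rw [← mul_add]
    congr 1
    refine Eq.trans (integral_congr_ae ?_) (integral_add (hi u v) (hi u' v))
    filter_upwards [diffq_congr_ae s (Hs.coeFn_add u u')] with z hz
    rw [hz, diffq_add]; ring
  · intro c u v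
    rw [smul_eq_mul, mul_left_comm]
    congr 1
    refine Eq.trans (integral_congr_ae ?_) (integral_const_mul c _)
    filter_upwards [diffq_congr_ae s (Hs.coeFn_smul c u)] with z hz
    rw [hz, diffq_const_mul]; ring
  · intro u v v'
    rw [← mul_add]
    congr 1
    refine Eq.trans (integral_congr_ae ?_) (integral_add (hi u v) (hi u v'))
    filter_upwards [diffq_congr_ae s (Hs.coeFn_add v v')] with z hz
    rw [hz, diffq_add]; ring
  · intro c u v
    rw [smul_eq_mul, mul_left_comm]
    congr 1
    refine Eq.trans (integral_congr_ae ?_) (integral_const_mul c _)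
    filter_upwards [diffq_congr_ae s (Hs.coeFn_smul c v)] with z hz
    rw [hz, diffq_const_mul]; ring

/-! ### The Liouville reduction for smooth coefficients -/

theorem tendsto_clip_fst_mul (u v : Sp n → ℝ) (x : Sp n) :
    Filter.Tendsto (fun N : ℕ => FracCalderon.clip (N : ℝ) u x * FracCalderon.clip (N : ℝ) v x)
      Filter.atTop (𝓝 (u x * v x)) :=
  (tendsto_clip u x).mul (tendsto_clip v x)

theorem IsHs.integrable_mul_mul (hs0 : 0 < s) (hs1 : s < 1) (hsn : 2 * s < n) (hn : 0 < n)
    {g u v : Sp n → ℝ} (hg : MemLp g (critExp n s)) (hu : IsHs s u) (hv : IsHs s v) :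
    Integrable fun x => g x * u x * v x := by
  obtain ⟨C, -, h⟩ := exists_holder hs0 hsn hn
  refine (h g hg (hu.toHs hs0 hs1 hn) (hv.toHs hs0 hs1 hn)).1.congr ?_
  filter_upwards [hu.coeFn_toHs hs0 hs1 hn, hv.coeFn_toHs hs0 hs1 hn] with x hx hy
  rw [hx, hy]

theorem tendsto_diffq {u : ℕ → Sp n → ℝ} {v : Sp n → ℝ} {z : Sp n × Sp n}
    (h1 : Filter.Tendsto (fun k => u k z.1) Filter.atTop (𝓝 (v z.1)))
    (h2 : Filter.Tendsto (fun k => u k z.2) Filter.atTop (𝓝 (v z.2))) :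
    Filter.Tendsto (fun k => diffq s (u k) z) Filter.atTop (𝓝 (diffq s v z)) :=
  (h2.sub h1).mul_const _

theorem diffq_mul (a u : Sp n → ℝ) (z : Sp n × Sp n) :
    diffq s (fun x => a x * u x) z = a z.2 * diffq s u z + u z.1 * diffq s a z := by
  unfold diffq; ring

/-- The Liouville reduction `B_{a²}[u, v] = ⟨(-Δ)^s (a u), a v⟩ - ∫ ((-Δ)^s a) a u v` for
`a = c + ψ` with `ψ` smooth and compactly supported. -/
theorem liouville_smooth (hs0 : 0 < s) (hs1 : s < 1) (hsn : 2 * s < n) (hn : 0 < n)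
    {ψ g : Sp n → ℝ} (h1 : ContDiff ℝ ∞ ψ) (h2 : HasCompactSupport ψ)
    (hg : IsFracLaplacian s (critExp n s) ψ g) (c : ℝ) {u v : Sp n → ℝ}
    (hu : IsHs s u) (hv : IsHs s v) :
    halfConst n s * ∫ z, diffq s (fun x => (c + ψ x) * u x) z
        * diffq s (fun x => (c + ψ x) * v x) z ∂vol2 n
      = halfConst n s * dqForm s (fun x => c + ψ x) u v
        + ∫ x, g x * ((c + ψ x) * (u x * v x)) := by
  set a : Sp n → ℝ := fun x => c + ψ x with ha
  have hψ := bddLip_of_contDiff h1 h2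
  have hal : BddLip a := by
    obtain ⟨⟨b, hb⟩, L, hL⟩ := hψ
    refine ⟨⟨|c| + b, fun x => (abs_add_le _ _).trans (by have := hb x; linarith)⟩, L, ?_⟩
    exact LipschitzWith.of_dist_le_mul fun x y => by
      simpa [ha] using hL.dist_le_mul x y
  obtain ⟨b, hb⟩ := hal.bdd
  have hb0 : 0 ≤ b := (abs_nonneg _).trans (hb 0)
  have ham : AEStronglyMeasurable a volume := hal.measurable.aestronglyMeasurable
  have hda : ∀ z, diffq s a z = diffq s ψ z := fun z => by simp [diffq, ha]
  have hp := one_le_critExp hs0 hsn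
  -- For bounded u and v the product a u v is in `H^s` and may be paired with ψ. Then
  -- `diffq_mul_mul` is integrated term by term; the constant c drops out of Da.
  have bounded : ∀ {u v : Sp n → ℝ} {N : ℝ}, IsHs s u → IsHs s v → (∀ x, |u x| ≤ N) →
      (∀ x, |v x| ≤ N) →
      halfConst n s * ∫ z, diffq s (fun x => a x * u x) z * diffq s (fun x => a x * v x) z ∂vol2 n
      = halfConst n s * dqForm s a u v + ∫ x, g x * (a x * (u x * v x)) := by
    intro u v N hu hv hN hN'
    have huv := IsHs.lip_mul hs0 hs1 hn hal (hu.mul_of_bdd hv hN hN')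
    rw [← hg.pairing_eq hs0 hs1 hn hp h1 h2 huv, ← mul_add]
    congr 1
    refine Eq.trans ?_ (integral_add (integrable_dqForm ham (.of_forall hb) hu hv)
      (((hψ.isHs hs0 hs1 hn h2).memLp_diffq).integrable_mul huv.memLp_diffq))
    congr 1
    ext z
    rw [diffq_mul_mul, hda]
  -- Dominating functions independent of the truncation height N, by the Leibniz rule and because
  -- truncation is 1-Lipschitz.
  have hdom : ∀ {u : Sp n → ℝ}, IsHs s u →
      MemLp (fun z => b * |diffq s u z| + |u z.1 * diffq s a z|) 2 (vol2 n) := fun {u} hu =>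
    (hu.memLp_diffq.abs.const_mul b).add (BddLip.memLp_mul_diffq hs0 hs1 hn hal hu.memLp).abs
  have hdom2 : ∀ (u : Sp n → ℝ) (N : ℕ) (z : Sp n × Sp n),
      |diffq s (fun x => a x * FracCalderon.clip (N : ℝ) u x) z|
        ≤ b * |diffq s u z| + |u z.1 * diffq s a z| := by
    intro u N z
    rw [diffq_mul]
    refine (abs_add_le _ _).trans (add_le_add ?_ ?_)
    · rw [abs_mul]
      exact mul_le_mul (hb _) (abs_diffq_clip_le _ _ _) (abs_nonneg _) hb0
    · rw [abs_mul, abs_mul]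
      exact mul_le_mul_of_nonneg_right (abs_clip_le_abs (Nat.cast_nonneg N) _ _) (abs_nonneg _)
  have huc := fun N : ℕ => hu.clip (Nat.cast_nonneg (α := ℝ) N)
  have hvc := fun N : ℕ => hv.clip (Nat.cast_nonneg (α := ℝ) N)
  have L1 : Filter.Tendsto (fun N : ℕ => ∫ z, diffq s (fun x => a x * FracCalderon.clip (N : ℝ) u x) z
      * diffq s (fun x => a x * FracCalderon.clip (N : ℝ) v x) z ∂vol2 n) Filter.atTop
      (𝓝 (∫ z, diffq s (fun x => a x * u x) z * diffq s (fun x => a x * v x) z ∂vol2 n)) := by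
    refine tendsto_integral_of_dominated_convergence
      (fun z => (b * |diffq s u z| + |u z.1 * diffq s a z|)
        * (b * |diffq s v z| + |v z.1 * diffq s a z|))
      (fun N => ((IsHs.lip_mul hs0 hs1 hn hal (huc N)).memLp_diffq.1).mul
        ((IsHs.lip_mul hs0 hs1 hn hal (hvc N)).memLp_diffq.1))
      ((hdom hu).integrable_mul (hdom hv)) (fun N => .of_forall fun z => ?_) (.of_forall fun z => ?_)
    · rw [norm_mul]
      exact mul_le_mul (hdom2 u N z) (hdom2 v N z) (norm_nonneg _)
        ((abs_nonneg _).trans (hdom2 u N z))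
    · exact (tendsto_diffq ((tendsto_clip u _).const_mul _) ((tendsto_clip u _).const_mul _)).mul
        (tendsto_diffq ((tendsto_clip v _).const_mul _) ((tendsto_clip v _).const_mul _))
  have L2 : Filter.Tendsto (fun N : ℕ => dqForm s a (FracCalderon.clip (N : ℝ) u)
      (FracCalderon.clip (N : ℝ) v)) Filter.atTop (𝓝 (dqForm s a u v)) := by
    refine tendsto_integral_of_dominated_convergence
      (fun z => |a z.1 * a z.2| * (|diffq s u z| * |diffq s v z|))
      (fun N => (integrable_dqForm ham (.of_forall hb) (huc N) (hvc N)).1)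
      ?_ (fun N => .of_forall fun z => ?_) (.of_forall fun z => ?_)
    · refine (integrable_dqForm ham (.of_forall hb) hu hv).norm.congr (.of_forall fun z => ?_)
      simp only [norm_mul, Real.norm_eq_abs, abs_mul]
    · rw [norm_mul, norm_mul (diffq s _ z)]
      exact mul_le_mul_of_nonneg_left (mul_le_mul (abs_diffq_clip_le _ _ _)
        (abs_diffq_clip_le _ _ _) (norm_nonneg _) (abs_nonneg _)) (norm_nonneg _)
    · exact ((tendsto_diffq (tendsto_clip u _) (tendsto_clip u _)).mul
        (tendsto_diffq (tendsto_clip v _) (tendsto_clip v _))).const_mul _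
  have L3 : Filter.Tendsto (fun N : ℕ => ∫ x, g x * (a x * (FracCalderon.clip (N : ℝ) u x
      * FracCalderon.clip (N : ℝ) v x))) Filter.atTop (𝓝 (∫ x, g x * (a x * (u x * v x)))) := by
    refine tendsto_integral_of_dominated_convergence (fun x => b * |g x * u x * v x|)
      (fun N => hg.1.1.mul (ham.mul ((huc N).memLp.1.mul (hvc N).memLp.1)))
      ((hu.integrable_mul_mul hs0 hs1 hsn hn hg.1 hv).abs.const_mul b)
      (fun N => .of_forall fun x => ?_) (.of_forall fun x => ?_)
    · simp only [norm_mul, Real.norm_eq_abs, abs_mul]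
      calc |g x| * (|a x| * (|FracCalderon.clip (N : ℝ) u x| * |FracCalderon.clip (N : ℝ) v x|))
          ≤ |g x| * (b * (|u x| * |v x|)) := by
            exact mul_le_mul_of_nonneg_left (mul_le_mul (hb x)
              (mul_le_mul (abs_clip_le_abs (Nat.cast_nonneg N) u x)
                (abs_clip_le_abs (Nat.cast_nonneg N) v x) (abs_nonneg _) (abs_nonneg _))
              (by positivity) hb0) (abs_nonneg _)
        _ = _ := by ring
    · exact ((tendsto_clip_fst_mul u v x).const_mul _).const_mul _
  refine tendsto_nhds_unique (L1.const_mul (halfConst n s))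
    (((L2.const_mul (halfConst n s)).add L3).congr fun N => ?_)
  exact (bounded (huc N) (hvc N) (abs_clip_le (Nat.cast_nonneg N) u)
    (abs_clip_le (Nat.cast_nonneg N) v)).symm

/-! ### Multipliers approximated by smooth functions -/

theorem IsFracLaplacian.sub {p : ℝ≥0∞} (hp : 1 ≤ p) (hs0 : 0 < s) (hs1 : s < 1)
    {m m' g g' : Sp n → ℝ} (hm : Integrable m) (hm' : Integrable m')
    (h : IsFracLaplacian s p m g) (h' : IsFracLaplacian s p m' g') :
    IsFracLaplacian s p (fun x => m x - m' x) (fun x => g x - g' x) := by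
  refine ⟨h.1.sub h'.1, fun φ => ?_⟩
  obtain ⟨C, hC⟩ := fracLaplacianSchwartz_bdd (s := s) φ
  have hF := (continuous_fracLaplacianSchwartz hs0 hs1 φ).aestronglyMeasurable (μ := volume)
  have i1 : Integrable fun x => (m x : ℂ) * fracLaplacianSchwartz s φ x :=
    hm.ofReal.mul_bdd hF (.of_forall hC)
  have i2 : Integrable fun x => (m' x : ℂ) * fracLaplacianSchwartz s φ x :=
    hm'.ofReal.mul_bdd hF (.of_forall hC)
  have j1 := MemLp.integrable_mul_schwartz hp h.1.ofReal φ
  have j2 := MemLp.integrable_mul_schwartz hp h'.1.ofReal φ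
  refine Eq.trans ?_ (((integral_sub j1 j2).trans ?_).trans ((integral_sub i1 i2).symm.trans ?_))
  · congr 1; ext x; push_cast; simp only [Complex.coe_algebraMap]; ring
  · congr 1
    · exact h.2 φ
    · exact h'.2 φ
  · congr 1; ext x; push_cast; ring

namespace IsApprox

variable {lo hi : ℝ} {m g : Sp n → ℝ} {M G : ℕ → Sp n → ℝ}

theorem aestronglyMeasurable (h : IsApprox s lo hi m g M G) : AEStronglyMeasurable m :=
  aestronglyMeasurable_of_tendsto_ae Filter.atTop
    (fun k => (h.contDiff k).continuous.aestronglyMeasurable) h.tendsto_ae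

theorem abs_le (h : IsApprox s lo hi m g M G) (k : ℕ) (x : Sp n) : |M k x| ≤ max |lo| |hi| :=
  abs_le_max_abs_abs (h.mem_Icc k x).1 (h.mem_Icc k x).2

theorem ae_abs_le (h : IsApprox s lo hi m g M G) : ∀ᵐ x, |m x| ≤ max |lo| |hi| := by
  filter_upwards [h.tendsto_ae] with x hx
  exact le_of_tendsto hx.abs (.of_forall fun k => h.abs_le k x)

theorem integrable (h : IsApprox s lo hi m g M G) (k : ℕ) : Integrable (M k) :=
  (h.contDiff k).continuous.integrable_of_hasCompactSupport (h.hasCompactSupport k)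

theorem sub (h : IsApprox s lo hi m g M G) (hs0 : 0 < s) (hs1 : s < 1) (hsn : 2 * s < n) (j : ℕ) :
    IsApprox s (lo - hi) (hi - lo) (fun x => m x - M j x) (fun x => g x - G j x)
      (fun k x => M k x - M j x) (fun k x => G k x - G j x) where
  contDiff k := (h.contDiff k).sub (h.contDiff j)
  hasCompactSupport k := (h.hasCompactSupport k).sub (h.hasCompactSupport j)
  mem_Icc k x := by
    have h1 := h.mem_Icc k x
    have h2 := h.mem_Icc j x
    exact ⟨by linarith [h1.1, h2.2], by linarith [h1.2, h2.1]⟩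
  tendsto_ae := by
    filter_upwards [h.tendsto_ae] with x hx
    exact hx.sub_const _
  isFracLaplacian k := (h.isFracLaplacian k).sub (one_le_critExp hs0 hsn) hs0 hs1
    (h.integrable k) (h.integrable j) (h.isFracLaplacian j)
  memLp := h.memLp.sub (h.isFracLaplacian j).1
  tendsto := by simpa using h.tendsto

end IsApprox

/-- Convergence of `∫ G_k c_k u v` for `G_k → g` in `L^{n/2s}` and bounded `c_k → c`. -/
theorem tendsto_integral_mul_mul (hs0 : 0 < s) (hs1 : s < 1) (hsn : 2 * s < n) (hn : 0 < n)
    {g : Sp n → ℝ} {G : ℕ → Sp n → ℝ} (hg : MemLp g (critExp n s))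
    (hG : ∀ k, MemLp (G k) (critExp n s))
    (hlim : Filter.Tendsto (fun k => eLpNorm (fun x => G k x - g x) (critExp n s) volume)
      Filter.atTop (𝓝 0)) {c : Sp n → ℝ} {c' : ℕ → Sp n → ℝ} {b : ℝ}
    (hc' : ∀ k, AEStronglyMeasurable (c' k)) (hb : ∀ k, ∀ᵐ x, |c' k x| ≤ b)
    (hc : ∀ᵐ x, Filter.Tendsto (fun k => c' k x) Filter.atTop (𝓝 (c x)))
    {u v : Sp n → ℝ} (hu : IsHs s u) (hv : IsHs s v) :
    Filter.Tendsto (fun k => ∫ x, G k x * (c' k x * (u x * v x))) Filter.atTop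
      (𝓝 (∫ x, g x * (c x * (u x * v x)))) := by
  obtain ⟨C, hC, hH⟩ := exists_holder hs0 hsn hn
  have hint : ∀ {f : Sp n → ℝ} (k : ℕ), MemLp f (critExp n s) →
      Integrable fun x => f x * (c' k x * (u x * v x)) := by
    intro f k hf
    refine ((hu.integrable_mul_mul hs0 hs1 hsn hn hf hv).bdd_mul (hc' k) (hb k)).congr
      (.of_forall fun x => ?_)
    ring
  have L1 : Filter.Tendsto (fun k => ∫ x, g x * (c' k x * (u x * v x))) Filter.atTop
      (𝓝 (∫ x, g x * (c x * (u x * v x)))) := by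
    refine tendsto_integral_of_dominated_convergence (fun x => b * |g x * u x * v x|)
      (fun k => (hint k hg).1) ((hu.integrable_mul_mul hs0 hs1 hsn hn hg hv).abs.const_mul b)
      (fun k => ?_) ?_
    · filter_upwards [hb k] with x hx
      simp only [norm_mul, Real.norm_eq_abs, abs_mul]
      calc |g x| * (|c' k x| * (|u x| * |v x|)) = |c' k x| * (|g x| * |u x| * |v x|) := by ring
        _ ≤ _ := by gcongr
    · filter_upwards [hc] with x hx
      exact (hx.mul_const _).const_mul _
  have L2 : Filter.Tendsto (fun k => ∫ x, (G k x - g x) * (c' k x * (u x * v x))) Filter.atTop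
      (𝓝 0) := by
    set U := hu.toHs hs0 hs1 hn
    set V := hv.toHs hs0 hs1 hn
    have hb0 : 0 ≤ b := by
      obtain ⟨x, hx⟩ := (hb 0).exists
      exact (abs_nonneg _).trans hx
    refine squeeze_zero_norm (a := fun k => b * (C * (eLpNorm (fun x => G k x - g x) (critExp n s)
      volume).toReal * ‖U‖ * ‖V‖)) (fun k => ?_) ?_
    · have hd : MemLp (fun x => G k x - g x) (critExp n s) := (hG k).sub hg
      have h1 := (hH _ hd U V).2
      refine le_trans ?_ (mul_le_mul_of_nonneg_left h1 hb0)
      rw [← integral_const_mul]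
      refine (norm_integral_le_integral_norm _).trans (integral_mono_ae (hint k hd).norm
        ((hH _ hd U V).1.abs.const_mul b) ?_)
      filter_upwards [hb k, hu.coeFn_toHs hs0 hs1 hn, hv.coeFn_toHs hs0 hs1 hn] with x hx h1 h2
      rw [h1, h2]
      simp only [norm_mul, Real.norm_eq_abs, abs_mul]
      calc |G k x - g x| * (|c' k x| * (|u x| * |v x|))
          = |c' k x| * (|G k x - g x| * |u x| * |v x|) := by ring
        _ ≤ _ := by gcongr
    · have := ((((ENNReal.tendsto_toReal ENNReal.zero_ne_top).comp hlim).const_mul C).mul_const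
        ‖U‖).mul_const ‖V‖ |>.const_mul b
      simpa using this
  have := L2.add L1
  rw [zero_add] at this
  refine this.congr fun k => ?_
  refine Eq.trans (integral_add (hint k ((hG k).sub hg)) (hint k hg)).symm ?_
  congr 1
  ext x
  rw [Pi.sub_apply]
  ring

theorem tendsto_dqForm {a : Sp n → ℝ} {a' : ℕ → Sp n → ℝ} {b : ℝ}
    (ha : ∀ k, AEStronglyMeasurable (a' k)) (hb : ∀ k, ∀ᵐ x, |a' k x| ≤ b)
    (hlim : ∀ᵐ x, Filter.Tendsto (fun k => a' k x) Filter.atTop (𝓝 (a x)))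
    {u v : Sp n → ℝ} (hu : IsHs s u) (hv : IsHs s v) :
    Filter.Tendsto (fun k => dqForm s (a' k) u v) Filter.atTop (𝓝 (dqForm s a u v)) := by
  refine tendsto_integral_of_dominated_convergence
    (fun z => b ^ 2 * |diffq s u z * diffq s v z|)
    (fun k => (integrable_dqForm (ha k) (hb k) hu hv).1)
    ((hu.memLp_diffq.integrable_mul hv.memLp_diffq).abs.const_mul _) (fun k => ?_) ?_
  · filter_upwards [ae_abs_prod_mul_le (hb k)] with z hz
    rw [norm_mul]
    exact mul_le_mul_of_nonneg_right hz (norm_nonneg _)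
  · filter_upwards [ae_vol2_of_ae hlim] with z hz
    exact (hz.1.mul hz.2).mul_const _

namespace IsApprox

variable {lo hi : ℝ} {m g : Sp n → ℝ} {M G : ℕ → Sp n → ℝ}

/-- `liouville_smooth` with c = 0 and v = u expresses the energy of M_k u through a weighted energy
of u and an integral against G_k. Both converge, and Fatou passes the bound to m u. An inequality is
enough, since it is applied to differences that tend to zero. -/
theorem isHs_mul_and_le (h : IsApprox s lo hi m g M G) (hs0 : 0 < s) (hs1 : s < 1)
    (hsn : 2 * s < n) (hn : 0 < n) {u : Sp n → ℝ} (hu : IsHs s u) :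
    IsHs s (fun x => m x * u x) ∧
      halfConst n s * ∫ z, diffq s (fun x => m x * u x) z ^ 2 ∂vol2 n
        ≤ halfConst n s * dqForm s m u u + ∫ x, g x * (m x * (u x * u x)) := by
  have hκ := halfConst_pos (n := n) hs0 hs1
  set R := halfConst n s * dqForm s m u u + ∫ x, g x * (m x * (u x * u x)) with hR
  have hMu : ∀ k, IsHs s fun x => M k x * u x := fun k =>
    IsHs.lip_mul hs0 hs1 hn (bddLip_of_contDiff (h.contDiff k) (h.hasCompactSupport k)) hu
  have hlim : Filter.Tendsto (fun k => halfConst n s *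
      ∫ z, diffq s (fun x => M k x * u x) z ^ 2 ∂vol2 n) Filter.atTop (𝓝 R) := by
    refine (((tendsto_dqForm (fun k => (h.contDiff k).continuous.aestronglyMeasurable)
      (fun k => .of_forall (h.abs_le k)) h.tendsto_ae hu hu).const_mul (halfConst n s)).add
      (tendsto_integral_mul_mul hs0 hs1 hsn hn h.memLp (fun k => (h.isFracLaplacian k).1) h.tendsto
        (fun k => (h.contDiff k).continuous.aestronglyMeasurable)
        (fun k => .of_forall (h.abs_le k)) h.tendsto_ae hu hu)).congr fun k => ?_
    have := liouville_smooth hs0 hs1 hsn hn (h.contDiff k) (h.hasCompactSupport k)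
      (h.isFracLaplacian k) 0 hu hu
    simp only [zero_add] at this
    rw [← this]
    simp_rw [sq]
  have hR0 : 0 ≤ R := ge_of_tendsto' hlim fun k => by positivity
  have hlim2 : Filter.Tendsto (fun k => ∫⁻ z, ‖diffq s (fun x => M k x * u x) z‖ₑ ^ 2 ∂vol2 n)
      Filter.atTop (𝓝 (ENNReal.ofReal (R / halfConst n s))) := by
    refine (ENNReal.tendsto_ofReal (hlim.div_const (halfConst n s))).congr fun k => ?_
    rw [mul_div_cancel_left₀ _ hκ.ne', integral_sq_eq_norm_sq (hMu k).memLp_diffq]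
  have hmeas : AEStronglyMeasurable (diffq s fun x => m x * u x) (vol2 n) :=
    aestronglyMeasurable_diffq (h.aestronglyMeasurable.mul hu.memLp.1)
  have hfat : ∫⁻ z, ‖diffq s (fun x => m x * u x) z‖ₑ ^ 2 ∂vol2 n
      ≤ ENNReal.ofReal (R / halfConst n s) := by
    rw [← hlim2.liminf_eq]
    refine le_trans (lintegral_mono_ae ?_) (lintegral_liminf_le' fun k =>
      ((hMu k).memLp_diffq.1.enorm.pow_const 2))
    filter_upwards [ae_vol2_of_ae h.tendsto_ae] with z hz
    have : Filter.Tendsto (fun k => ‖diffq s (fun x => M k x * u x) z‖ₑ ^ 2) Filter.atTop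
        (𝓝 (‖diffq s (fun x => m x * u x) z‖ₑ ^ 2)) :=
      ((ENNReal.continuous_pow 2).tendsto _).comp
        (tendsto_diffq (hz.1.mul_const _) (hz.2.mul_const _)).enorm
    exact this.liminf_eq.ge
  have hHs : IsHs s fun x => m x * u x :=
    ⟨memLp_bdd_mul hu.memLp h.aestronglyMeasurable h.ae_abs_le,
      memLp_two_of_lintegral hmeas (hfat.trans_lt ENNReal.ofReal_lt_top)⟩
  refine ⟨hHs, ?_⟩
  rw [integral_sq_eq_norm_sq hHs.memLp_diffq,
    ENNReal.ofReal_le_ofReal_iff (div_nonneg hR0 hκ.le), le_div_iff₀ hκ] at hfat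
  rwa [mul_comm]

theorem isHs_mul (h : IsApprox s lo hi m g M G) (hs0 : 0 < s) (hs1 : s < 1)
    (hsn : 2 * s < n) (hn : 0 < n) {u : Sp n → ℝ} (hu : IsHs s u) :
    IsHs s (fun x => m x * u x) := (h.isHs_mul_and_le hs0 hs1 hsn hn hu).1

/-- Apply `isHs_mul_and_le` to m - M_j, whose approximations are M_k - M_j: the bound on the energy
of (m - M_j)u tends to 0, because m - M_j is bounded and tends to 0 almost everywhere and g - G_j →
0 in `L^{n/2s}`. -/
theorem tendsto_mul (h : IsApprox s lo hi m g M G) (hs0 : 0 < s) (hs1 : s < 1)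
    (hsn : 2 * s < n) (hn : 0 < n) {c : ℝ} {u : Sp n → ℝ} (hu : IsHs s u) {U : ℕ → Hs n s}
    {V : Hs n s} (hU : ∀ k, U k =ᵐ[volume] fun x => (c + M k x) * u x)
    (hV : V =ᵐ[volume] fun x => (c + m x) * u x) :
    Filter.Tendsto U Filter.atTop (𝓝 V) := by
  have hκ := halfConst_pos (n := n) hs0 hs1
  set b := max |lo - hi| |hi - lo|
  have hsub := fun j => h.sub hs0 hs1 hsn j
  have hmeas : ∀ j, AEStronglyMeasurable fun x => m x - M j x := fun j =>
    (hsub j).aestronglyMeasurable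
  have hbd : ∀ j, ∀ᵐ x, |m x - M j x| ≤ b := fun j => (hsub j).ae_abs_le
  have hz : ∀ᵐ x, Filter.Tendsto (fun j => m x - M j x) Filter.atTop (𝓝 0) := by
    filter_upwards [h.tendsto_ae] with x hx
    simpa using hx.const_sub (m x)
  have hG0 : Filter.Tendsto (fun k => eLpNorm (fun x => (g x - G k x) - 0) (critExp n s) volume)
      Filter.atTop (𝓝 0) := by
    refine h.tendsto.congr fun k => ?_
    rw [← eLpNorm_neg]
    congr 1
    ext x
    simp
  have L1 := tendsto_dqForm (s := s) hmeas hbd hz hu hu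
  have L2 := tendsto_integral_mul_mul hs0 hs1 hsn hn (g := fun _ => 0) MemLp.zero
    (fun k => (hsub k).memLp) hG0 hmeas hbd hz hu hu
  have L3 : Filter.Tendsto (fun j => ∫ x, ((m x - M j x) * u x) ^ 2) Filter.atTop
      (𝓝 (∫ x, (0 * u x) ^ 2)) := by
    refine tendsto_integral_of_dominated_convergence (fun x => b ^ 2 * u x ^ 2)
      (fun j => ((hmeas j).mul hu.memLp.1).pow 2) (hu.memLp.integrable_sq.const_mul _)
      (fun j => ?_) ?_
    · filter_upwards [hbd j] with x hx
      rw [Real.norm_of_nonneg (sq_nonneg _), mul_pow]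
      exact mul_le_mul_of_nonneg_right (sq_le_sq' (_root_.abs_le.1 hx).1 (_root_.abs_le.1 hx).2) (sq_nonneg _)
    · filter_upwards [hz] with x hx
      exact (hx.mul_const _).pow 2
  have L := L3.add ((L1.const_mul (halfConst n s)).add L2)
  have hzero : (∫ x, (0 * u x) ^ 2) + (halfConst n s * dqForm s (fun _ => 0) u u
      + ∫ x : Sp n, (0 : ℝ) * (0 * (u x * u x))) = 0 := by simp [dqForm]
  rw [hzero] at L
  rw [tendsto_iff_norm_sub_tendsto_zero]
  have hsq : Filter.Tendsto (fun k => ‖U k - V‖ ^ 2) Filter.atTop (𝓝 0) := by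
    refine squeeze_zero (fun k => sq_nonneg _) (fun k => ?_) L
    have e : ((U k - V : Hs n s) : Sp n → ℝ) =ᵐ[volume] fun x => (-1) * ((m x - M k x) * u x) := by
      filter_upwards [Hs.coeFn_sub (U k) V, hU k, hV] with x h1 h2 h3
      rw [h1, h2, h3]; ring
    refine (Hs.norm_sq_le hs0 hs1 hn _).trans (add_le_add (le_of_eq ?_) ?_)
    · refine integral_congr_ae ?_
      filter_upwards [e] with x hx
      rw [hx]; ring
    · refine le_trans (le_of_eq ?_) ((hsub k).isHs_mul_and_le hs0 hs1 hsn hn hu).2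
      congr 1
      refine integral_congr_ae ?_
      filter_upwards [diffq_congr_ae s e] with z hz
      rw [hz, diffq_const_mul]; ring
  have := hsq.sqrt
  simpa [Real.sqrt_sq] using this

theorem isHs_const_add_mul (h : IsApprox s lo hi m g M G) (hs0 : 0 < s) (hs1 : s < 1)
    (hsn : 2 * s < n) (hn : 0 < n) (c : ℝ) {u : Sp n → ℝ} (hu : IsHs s u) :
    IsHs s (fun x => (c + m x) * u x) := by
  simpa only [add_mul] using (hu.const_mul c).add (h.isHs_mul hs0 hs1 hsn hn hu)

theorem isHs_const_add_mul_smooth (h : IsApprox s lo hi m g M G) (hs0 : 0 < s) (hs1 : s < 1)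
    (hn : 0 < n) (c : ℝ) (k : ℕ) {u : Sp n → ℝ} (hu : IsHs s u) :
    IsHs s (fun x => (c + M k x) * u x) := by
  simpa only [add_mul] using (hu.const_mul c).add
    (IsHs.lip_mul hs0 hs1 hn (bddLip_of_contDiff (h.contDiff k) (h.hasCompactSupport k)) hu)

theorem pairing_smooth (h : IsApprox s lo hi m g M G) (hs0 : 0 < s) (hs1 : s < 1)
    (hsn : 2 * s < n) (hn : 0 < n) (c : ℝ) (k : ℕ) {u v : Sp n → ℝ} (hu : IsHs s u) (hv : IsHs s v)
    {U V : Hs n s} (hU : U =ᵐ[volume] fun x => (c + M k x) * u x)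
    (hV : V =ᵐ[volume] fun x => (c + M k x) * v x) :
    fracLaplacianPairing U V = halfConst n s * dqForm s (fun x => c + M k x) u v
      + ∫ x, G k x * ((c + M k x) * (u x * v x)) := by
  rw [← liouville_smooth hs0 hs1 hsn hn (h.contDiff k) (h.hasCompactSupport k)
    (h.isFracLaplacian k) c hu hv, Hs.pairing_eq hs0 hs1 hn]
  congr 1
  refine integral_congr_ae ?_
  filter_upwards [diffq_congr_ae s hU, diffq_congr_ae s hV] with z h1 h2
  rw [h1, h2]

end IsApprox

theorem exists_pairingBilin (hs0 : 0 < s) (hs1 : s < 1) (hn : 0 < n) :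
    ∃ B : Hs n s →L[ℝ] Hs n s →L[ℝ] ℝ, ∀ u v, B u v = fracLaplacianPairing u v := by
  obtain ⟨B, hB, -⟩ := exists_dqBilin hs0 hs1 hn (a := fun _ : Sp n => (1 : ℝ)) (b := 1)
    aestronglyMeasurable_const (.of_forall fun _ => by simp)
  refine ⟨B, fun u v => ?_⟩
  rw [hB, Hs.pairing_eq hs0 hs1 hn]
  simp [dqForm]

theorem tendsto_bilin {E : Type*} [NormedAddCommGroup E] [NormedSpace ℝ E] (B : E →L[ℝ] E →L[ℝ] ℝ)
    {U V : ℕ → E} {u v : E} (hU : Filter.Tendsto U Filter.atTop (𝓝 u))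
    (hV : Filter.Tendsto V Filter.atTop (𝓝 v)) :
    Filter.Tendsto (fun k => B (U k) (V k)) Filter.atTop (𝓝 (B u v)) :=
  (B.isBoundedBilinearMap.continuous.tendsto (u, v)).comp (hU.prodMk_nhds hV)

/-- The Liouville reduction. -/
theorem IsApprox.pairing_eq {lo hi : ℝ} {m g : Sp n → ℝ} {M G : ℕ → Sp n → ℝ}
    (h : IsApprox s lo hi m g M G) (hs0 : 0 < s) (hs1 : s < 1)
    (hsn : 2 * s < n) (hn : 0 < n) (c : ℝ) {u v : Sp n → ℝ} (hu : IsHs s u) (hv : IsHs s v)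
    {U V : Hs n s} (hU : U =ᵐ[volume] fun x => (c + m x) * u x)
    (hV : V =ᵐ[volume] fun x => (c + m x) * v x) :
    fracLaplacianPairing U V = halfConst n s * dqForm s (fun x => c + m x) u v
      + ∫ x, g x * ((c + m x) * (u x * v x)) := by
  obtain ⟨B, hB⟩ := exists_pairingBilin (n := n) hs0 hs1 hn
  let U' := fun k => (h.isHs_const_add_mul_smooth hs0 hs1 hn c k hu).toHs hs0 hs1 hn
  let V' := fun k => (h.isHs_const_add_mul_smooth hs0 hs1 hn c k hv).toHs hs0 hs1 hn
  have hU' : ∀ k, U' k =ᵐ[volume] fun x => (c + M k x) * u x := fun k => IsHs.coeFn_toHs _ _ _ _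
  have hV' : ∀ k, V' k =ᵐ[volume] fun x => (c + M k x) * v x := fun k => IsHs.coeFn_toHs _ _ _ _
  have tU := h.tendsto_mul hs0 hs1 hsn hn hu hU' hU
  have tV := h.tendsto_mul hs0 hs1 hsn hn hv hV' hV
  have L := tendsto_bilin B tU tV
  rw [← hB]
  have hmeas : ∀ k, AEStronglyMeasurable (fun x => c + M k x) volume := fun k =>
    ((h.contDiff k).continuous.const_add c).aestronglyMeasurable
  have hbd : ∀ k, ∀ᵐ x, |c + M k x| ≤ |c| + max |lo| |hi| := fun k =>
    .of_forall fun x => (abs_add_le _ _).trans (by have := h.abs_le k x; linarith)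
  have hl : ∀ᵐ x, Filter.Tendsto (fun k => c + M k x) Filter.atTop (𝓝 (c + m x)) := by
    filter_upwards [h.tendsto_ae] with x hx
    exact hx.const_add c
  have L1 := (tendsto_dqForm hmeas hbd hl hu hv).const_mul (halfConst n s)
  have L2 := tendsto_integral_mul_mul hs0 hs1 hsn hn h.memLp
      (fun k => (h.isFracLaplacian k).1) h.tendsto hmeas hbd hl hu hv
  refine tendsto_nhds_unique L ((L1.add L2).congr fun k => ?_)
  exact ((hB _ _).trans (h.pairing_smooth hs0 hs1 hsn hn c k hu hv (hU' k) (hV' k))).symm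

/-! ### Abstract Dirichlet problems -/

/-- Lax–Milgram on V gives v in V with B v = B f on V; the solution is f - v. -/
theorem exists_solution_of_coercive {E : Type*} [NormedAddCommGroup E] [InnerProductSpace ℝ E]
    [CompleteSpace E] {V : Submodule ℝ E} (hV : IsClosed (V : Set E)) {B : E →L[ℝ] E →L[ℝ] ℝ}
    {δ : ℝ} (hδ : 0 < δ) (hB : ∀ φ ∈ V, δ * ‖φ‖ ^ 2 ≤ B φ φ) (f : E) :
    ∃ u, u - f ∈ V ∧ ∀ φ ∈ V, B u φ = 0 := by
  have : CompleteSpace V := hV.completeSpace_coe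
  let B' : V →L[ℝ] V →L[ℝ] ℝ :=
    ((ContinuousLinearMap.compL ℝ V E ℝ).flip V.subtypeL).comp (B.comp V.subtypeL)
  have hB' : ∀ v w : V, B' v w = B v w := fun v w => rfl
  have hc : IsCoercive B' := ⟨δ, hδ, fun v => by
    rw [hB', mul_assoc, ← sq]; exact hB v v.2⟩
  let F : StrongDual ℝ V := (B f).comp V.subtypeL
  let r : V := (InnerProductSpace.toDual ℝ V).symm F
  let v : V := hc.continuousLinearEquivOfBilin.symm r
  refine ⟨f - v, by simp, fun φ hφ => ?_⟩
  have h1 : inner ℝ (hc.continuousLinearEquivOfBilin v) (⟨φ, hφ⟩ : V) = B' v ⟨φ, hφ⟩ :=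
    hc.continuousLinearEquivOfBilin_apply v ⟨φ, hφ⟩
  rw [ContinuousLinearEquiv.apply_symm_apply, InnerProductSpace.toDual_symm_apply] at h1
  rw [map_sub, sub_apply, sub_eq_zero]
  exact h1

/-- The parallelogram law `hE` makes E a Hilbert space inside the proof only. The solution depends
just on the class of f, and B u vanishes on V, so it descends to the quotient. -/
theorem exists_dn_of_coercive {E : Type*} [NormedAddCommGroup E] [NormedSpace ℝ E] [CompleteSpace E]
    (hE : ∀ x y : E, ‖x + y‖ * ‖x + y‖ + ‖x - y‖ * ‖x - y‖ = 2 * (‖x‖ * ‖x‖ + ‖y‖ * ‖y‖))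
    {V : Submodule ℝ E} (hV : IsClosed (V : Set E)) {B : E →L[ℝ] E →L[ℝ] ℝ}
    {δ : ℝ} (hδ : 0 < δ) (hB : ∀ φ ∈ V, δ * ‖φ‖ ^ 2 ≤ B φ φ) :
    ∃ Λ : E ⧸ V → (E ⧸ V →L[ℝ] ℝ), ∀ f : E, ∃ u : E,
      (∀ u', (u' - f ∈ V ∧ ∀ φ ∈ V, B u' φ = 0) ↔ u' = u) ∧
        ∀ g : E, Λ (V.mkQ f) (V.mkQ g) = B u g := by
  have hex : ∀ f : E, ∃ u, u - f ∈ V ∧ ∀ φ ∈ V, B u φ = 0 := by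
    let _ := InnerProductSpace.ofNorm ℝ hE
    exact exists_solution_of_coercive hV hδ hB
  have huniq : ∀ {u u' f : E}, (u - f ∈ V ∧ ∀ φ ∈ V, B u φ = 0) →
      (u' - f ∈ V ∧ ∀ φ ∈ V, B u' φ = 0) → u' = u := by
    intro u u' f h h'
    have hd : u' - u ∈ V := by
      have := V.sub_mem h'.1 h.1
      rwa [sub_sub_sub_cancel_right] at this
    have h0 := hB _ hd
    rw [show B (u' - u) (u' - u) = B u' (u' - u) - B u (u' - u) by
      rw [map_sub B, sub_apply], h'.2 _ hd, h.2 _ hd, sub_zero] at h0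
    have : ‖u' - u‖ ^ 2 ≤ 0 := by nlinarith [sq_nonneg ‖u' - u‖]
    have h1 : ‖u' - u‖ = 0 := by nlinarith [norm_nonneg (u' - u)]
    exact sub_eq_zero.1 (norm_eq_zero.1 h1)
  choose S hS using hex
  let Λ : E ⧸ V → (E ⧸ V →L[ℝ] ℝ) := fun x =>
    ⟨V.liftQ (B (S x.out) : E →ₗ[ℝ] ℝ) fun φ hφ => (hS x.out).2 φ hφ,
      (V.isOpenQuotientMap_mkQ.isQuotientMap.continuous_iff).2 (B (S x.out)).continuous⟩
  refine ⟨Λ, fun f => ⟨S f, fun u' => ⟨fun h => huniq (hS f) h, fun h => h ▸ hS f⟩, fun g => ?_⟩⟩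
  have hf : (V.mkQ f).out - f ∈ V := by
    rw [← Submodule.Quotient.eq]
    exact Quotient.out_eq _
  have e : S (V.mkQ f).out = S f := by
    refine huniq (hS f) ⟨?_, (hS _).2⟩
    have := V.add_mem (hS (V.mkQ f).out).1 hf
    rwa [sub_add_sub_cancel] at this
  change B (S (V.mkQ f).out) g = B (S f) g
  rw [e]

/-! ### The forms of the two equations -/

/-- The additional power of |y - x| in the fractional gradient cancels the length of the vector y -
x, and (√C/√2)² = C/2. On the diagonal both sides are 0. -/
theorem inner_fracGrad (hs0 : 0 < s) (hs1 : s < 1) (γ u v : Sp n → ℝ) (x y : Sp n) :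
    inner ℝ (fracGrad s v x y) ((Real.sqrt (γ x) * Real.sqrt (γ y)) • fracGrad s u x y)
      = halfConst n s * (√(γ x) * √(γ y) * (diffq s u (x, y) * diffq s v (x, y))) := by
  have hC := fracConst_pos (n := n) hs0 hs1
  rw [fracGrad, fracGrad, real_inner_smul_left, real_inner_smul_right, real_inner_smul_right,
    real_inner_self_eq_norm_sq, diffq, diffq, halfConst]
  rcases eq_or_ne y x with rfl | hxy
  · simp
  have hr : 0 < ‖y - x‖ := norm_pos_iff.2 (sub_ne_zero.2 hxy)
  have e1 : ‖y - x‖ ^ ((n : ℝ) / 2 + s + 1) = ‖y - x‖ ^ ((n : ℝ) / 2 + s) * ‖y - x‖ := by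
    rw [Real.rpow_add_one hr.ne']
  have e2 : √(fracConst n s) / √2 * (√(fracConst n s) / √2) = fracConst n s / 2 := by
    rw [div_mul_div_comm, Real.mul_self_sqrt hC.le, Real.mul_self_sqrt (by norm_num)]
  have hp : ‖y - x‖ ^ ((n : ℝ) / 2 + s) ≠ 0 := by positivity
  simp only
  rw [e1, Real.rpow_neg hr.le, ← e2]
  field_simp

theorem condForm_eq (hs0 : 0 < s) (hs1 : s < 1) (hn : 0 < n) {γ : Sp n → ℝ}
    (hγ : Measurable γ) {b : ℝ} (hb : ∀ᵐ x, |√(γ x)| ≤ b) (u v : Hs n s) :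
    condForm γ u v = halfConst n s * dqForm s (fun x => √(γ x)) u v := by
  have hi := integrable_dqForm (a := fun x => √(γ x)) hγ.sqrt.aestronglyMeasurable hb
    (u.isHs hs0 hs1 hn) (v.isHs hs0 hs1 hn)
  rw [dqForm, ← integral_const_mul, condForm]
  refine Eq.trans ?_ (integral_prod _ (hi.const_mul (halfConst n s))).symm
  simp_rw [inner_fracGrad hs0 hs1]

theorem Htilde_isClosed (s : ℝ) (Ω : Set (Sp n)) : IsClosed (Htilde s Ω : Set (Hs n s)) :=
  Submodule.isClosed_topologicalClosure _

/-- A closed condition holding for test functions holds on `H̃^s(Ω)`. -/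
theorem Htilde_induction {Ω : Set (Sp n)} {P : Hs n s → Prop} (hP : IsClosed {u | P u})
    (h : ∀ (φ : Hs n s) (ψ : Sp n → ℝ), IsTestFunction Ω ψ → φ =ᵐ[volume] ψ → P φ)
    {φ : Hs n s} (hφ : φ ∈ Htilde s Ω) : P φ := by
  have : (Htilde s Ω : Set (Hs n s)) ⊆ {u | P u} := by
    rw [Htilde, Submodule.topologicalClosure_coe]
    refine closure_minimal ?_ hP
    rintro φ ⟨ψ, h1, h2⟩
    exact h φ ψ h1 h2
  exact this hφ

/-- Convergence in `H^s` implies convergence in `L²`, hence almost everywhere along a subsequence.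
-/
theorem isClosed_ae_eq_zero (hs0 : 0 < s) (Ω : Set (Sp n)) :
    IsClosed {u : Hs n s | ∀ᵐ x, x ∉ Ω → u x = 0} := by
  refine isSeqClosed_iff_isClosed.1 fun U u hU hlim => ?_
  have hL : Filter.Tendsto (fun k => Hs.toL2 (U k)) Filter.atTop (𝓝 (Hs.toL2 u)) := by
    rw [tendsto_iff_norm_sub_tendsto_zero] at hlim ⊢
    refine squeeze_zero (fun _ => norm_nonneg _) (fun k => ?_) hlim
    rw [← map_sub]
    exact Hs.norm_toL2_le hs0 _
  obtain ⟨ns, -, hns⟩ := (tendstoInMeasure_of_tendsto_Lp hL).exists_seq_tendsto_ae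
  have hall : ∀ᵐ x, ∀ k, x ∉ Ω → U k x = 0 := ae_all_iff.2 hU
  filter_upwards [hns, hall] with x hx hk hxΩ
  refine tendsto_nhds_unique hx ?_
  simp_rw [hk _ hxΩ]
  exact tendsto_const_nhds

theorem Htilde_ae_eq_zero (hs0 : 0 < s) {Ω : Set (Sp n)} {φ : Hs n s} (hφ : φ ∈ Htilde s Ω) :
    ∀ᵐ x, x ∉ Ω → φ x = 0 := by
  refine Htilde_induction (P := fun φ : Hs n s => ∀ᵐ x, x ∉ Ω → φ x = 0)
    (isClosed_ae_eq_zero hs0 Ω) (fun φ ψ hψ h => ?_) hφ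
  filter_upwards [h] with x hx hxΩ
  rw [hx]
  exact image_eq_zero_of_notMem_tsupport fun hx' => hxΩ (hψ.2.2 hx')

/-! ### Multiplication operators and coercivity -/

namespace IsApprox

variable {lo hi : ℝ} {m g : Sp n → ℝ} {M G : ℕ → Sp n → ℝ}

/-- Makes the estimates for m available for each M_k, with constants that depend only on `lo`, `hi`
and the norm of G_k. -/
theorem const (h : IsApprox s lo hi m g M G) (k : ℕ) :
    IsApprox s lo hi (M k) (G k) (fun _ => M k) (fun _ => G k) where
  contDiff _ := h.contDiff k
  hasCompactSupport _ := h.hasCompactSupport k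
  mem_Icc _ := h.mem_Icc k
  tendsto_ae := .of_forall fun _ => tendsto_const_nhds
  isFracLaplacian _ := h.isFracLaplacian k
  memLp := (h.isFracLaplacian k).1
  tendsto := by simp

theorem aestronglyMeasurable_one_add (h : IsApprox s lo hi m g M G) :
    AEStronglyMeasurable (fun x => 1 + m x) :=
  aestronglyMeasurable_const.add h.aestronglyMeasurable

theorem ae_abs_one_add_le (h : IsApprox s lo hi m g M G) :
    ∀ᵐ x, |1 + m x| ≤ 1 + max |lo| |hi| := by
  filter_upwards [h.ae_abs_le] with x hx
  exact (abs_add_le _ _).trans (by rw [abs_one]; linarith)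

theorem ae_le_one_add (h : IsApprox s lo hi m g M G) : ∀ᵐ x, 1 + lo ≤ 1 + m x := by
  filter_upwards [h.tendsto_ae] with x hx
  linarith [ge_of_tendsto' hx fun k => (h.mem_Icc k x).1]

end IsApprox

/-- The operator of multiplication by `1 + m` is bounded on `H^s`. -/
theorem exists_norm_mul_le (hs0 : 0 < s) (hs1 : s < 1) (hsn : 2 * s < n) (hn : 0 < n) (lo hi : ℝ) :
    ∃ K : ℝ, 0 < K ∧ ∀ {m g : Sp n → ℝ} {M G : ℕ → Sp n → ℝ} (_ : IsApprox s lo hi m g M G)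
      (u V : Hs n s), V =ᵐ[volume] (fun x => (1 + m x) * u x) →
      ‖V‖ ^ 2 ≤ K * (1 + (eLpNorm g (critExp n s) volume).toReal) * ‖u‖ ^ 2 := by
  obtain ⟨C, hC, hH⟩ := exists_holder hs0 hsn hn
  set β := 1 + max |lo| |hi|
  have hβ : 0 < β := by positivity
  -- One β² bounds the `L²` norm of (1+m)u, the other the weighted energy in the Liouville
  -- reduction; βC bounds the term with g by Hölder and Sobolev.
  refine ⟨2 * β ^ 2 + β * C, by positivity, fun {m g M G} h u V hV => ?_⟩
  set N := (eLpNorm g (critExp n s) volume).toReal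
  have hN : 0 ≤ N := ENNReal.toReal_nonneg
  have hu := u.isHs hs0 hs1 hn
  obtain ⟨B, hB, hBle⟩ := exists_dqBilin hs0 hs1 hn h.aestronglyMeasurable_one_add
    h.ae_abs_one_add_le
  have e := h.pairing_eq hs0 hs1 hsn hn 1 hu hu hV hV
  rw [Hs.pairing_self hs0 hs1 hn, ← hB] at e
  have h1 := (le_abs_self _).trans (hBle u u)
  have h2 : ∫ x, g x * ((1 + m x) * (u x * u x)) ≤ β * (C * N * ‖u‖ * ‖u‖) := by
    refine le_trans ?_ (mul_le_mul_of_nonneg_left (hH g h.memLp u u).2 hβ.le)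
    rw [← integral_const_mul]
    refine (Real.le_norm_self _).trans ((norm_integral_le_integral_norm _).trans
      (integral_mono_of_nonneg (.of_forall fun _ => norm_nonneg _)
        ((hH g h.memLp u u).1.abs.const_mul β) ?_))
    filter_upwards [h.ae_abs_one_add_le] with x hx
    simp only [norm_mul, Real.norm_eq_abs, abs_mul]
    calc |g x| * (|1 + m x| * (|u x| * |u x|)) = |1 + m x| * (|g x| * |u x| * |u x|) := by ring
      _ ≤ _ := by gcongr
  have h3 : ∫ x, V x ^ 2 ≤ β ^ 2 * ‖u‖ ^ 2 := by
    have h4 : ∫ x, u x ^ 2 ≤ ‖u‖ ^ 2 := by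
      rw [← Hs.norm_toL2_sq]
      exact pow_le_pow_left₀ (norm_nonneg _) (Hs.norm_toL2_le hs0 u) 2
    refine le_trans ?_ (mul_le_mul_of_nonneg_left h4 (sq_nonneg β))
    rw [← integral_const_mul]
    refine integral_mono_of_nonneg (.of_forall fun _ => sq_nonneg _)
      (hu.memLp.integrable_sq.const_mul _) ?_
    filter_upwards [hV, h.ae_abs_one_add_le] with x hx hx2
    rw [hx, mul_pow]
    exact mul_le_mul_of_nonneg_right (sq_le_sq' (abs_le.1 hx2).1 (abs_le.1 hx2).2) (sq_nonneg _)
  have h5 := Hs.norm_sq_le hs0 hs1 hn V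
  have h6 : 0 ≤ ‖u‖ ^ 2 * (2 * β ^ 2 * N + β * C) := by positivity
  nlinarith

theorem IsApprox.exists_mulCLM {lo hi : ℝ} {m g : Sp n → ℝ} {M G : ℕ → Sp n → ℝ}
    (h : IsApprox s lo hi m g M G) (hs0 : 0 < s) (hs1 : s < 1) (hsn : 2 * s < n) (hn : 0 < n) :
    ∃ T : Hs n s →L[ℝ] Hs n s, ∀ u, T u =ᵐ[volume] fun x => (1 + m x) * u x := by
  obtain ⟨K, hK, hle⟩ := exists_norm_mul_le (n := n) hs0 hs1 hsn hn lo hi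
  set L := K * (1 + (eLpNorm g (critExp n s) volume).toReal)
  let T : Hs n s → Hs n s := fun u =>
    (h.isHs_const_add_mul hs0 hs1 hsn hn 1 (u.isHs hs0 hs1 hn)).toHs hs0 hs1 hn
  have hT : ∀ u, T u =ᵐ[volume] fun x => (1 + m x) * u x := fun u => IsHs.coeFn_toHs _ _ _ _
  refine ⟨LinearMap.mkContinuous
    { toFun := T
      map_add' := fun u v => Hs.ext_ae ?_
      map_smul' := fun c u => Hs.ext_ae ?_ } (√L) fun u => ?_, hT⟩
  · filter_upwards [hT (u + v), hT u, hT v, Hs.coeFn_add u v, Hs.coeFn_add (T u) (T v)]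
      with x h1 h2 h3 h4 h5
    rw [h1, h5, h2, h3, h4]; ring
  · filter_upwards [hT (c • u), hT u, Hs.coeFn_smul c u, Hs.coeFn_smul c (T u)]
      with x h1 h2 h3 h4
    rw [RingHom.id_apply, h1, h4, h2, h3]; ring
  · have hL : 0 ≤ L := by positivity
    refine (pow_le_pow_iff_left₀ (norm_nonneg _) (by positivity) two_ne_zero).1 ?_
    rw [mul_pow, Real.sq_sqrt hL]
    exact hle h u (T u) (hT u)

theorem IsTestFunction.isHs (hs0 : 0 < s) (hs1 : s < 1) (hn : 0 < n) {Ω : Set (Sp n)}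
    {ψ : Sp n → ℝ} (h : IsTestFunction Ω ψ) : IsHs s ψ :=
  (bddLip_of_contDiff h.1 h.2.1).isHs hs0 hs1 hn h.2.1

theorem IsTestFunction.eq_zero {Ω : Set (Sp n)} {ψ : Sp n → ℝ} (h : IsTestFunction Ω ψ) {x : Sp n}
    (hx : x ∉ Ω) : ψ x = 0 :=
  image_eq_zero_of_notMem_tsupport fun hx' => hx (h.2.2 hx')

theorem IsTestFunction.mul_left {Ω : Set (Sp n)} {ψ a : Sp n → ℝ} (h : IsTestFunction Ω ψ)
    (ha : ContDiff ℝ ∞ a) : IsTestFunction Ω fun x => a x * ψ x :=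
  ⟨ha.mul h.1, h.2.1.mul_left, (tsupport_mul_subset_right).trans h.2.2⟩

namespace IsApprox

variable {lo hi : ℝ} {m g : Sp n → ℝ} {M G : ℕ → Sp n → ℝ}

/-- For a test function ψ each (1 + M_k)ψ is again one, and these converge to (1 + m)ψ in `H^s`;
closedness and density do the rest. -/
theorem mulCLM_mem_Htilde (h : IsApprox s lo hi m g M G) (hs0 : 0 < s) (hs1 : s < 1)
    (hsn : 2 * s < n) (hn : 0 < n) {Ω : Set (Sp n)} {T : Hs n s →L[ℝ] Hs n s}
    (hT : ∀ u, T u =ᵐ[volume] fun x => (1 + m x) * u x) {φ : Hs n s} (hφ : φ ∈ Htilde s Ω) :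
    T φ ∈ Htilde s Ω := by
  refine Htilde_induction (P := fun φ => T φ ∈ Htilde s Ω)
    ((Htilde_isClosed s Ω).preimage T.continuous) (fun φ ψ hψ hφψ => ?_) hφ
  have hU : ∀ k, ((h.isHs_const_add_mul_smooth hs0 hs1 hn 1 k (φ.isHs hs0 hs1 hn)).toHs hs0 hs1 hn)
      =ᵐ[volume] fun x => (1 + M k x) * φ x := fun k => IsHs.coeFn_toHs _ _ _ _
  refine (Htilde_isClosed s Ω).mem_of_tendsto
    (h.tendsto_mul hs0 hs1 hsn hn (φ.isHs hs0 hs1 hn) hU (hT φ)) (.of_forall fun k => ?_)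
  refine Submodule.le_topologicalClosure _ 
    ⟨fun x => (1 + M k x) * ψ x, hψ.mul_left (contDiff_const.add (h.contDiff k)), ?_⟩
  refine (hU k).trans ?_
  filter_upwards [hφψ] with x hx
  rw [hx]

theorem pos (h : IsApprox s lo hi m g M G) (hlo : 0 < 1 + lo) (k : ℕ) (x : Sp n) :
    0 < 1 + M k x := by linarith [(h.mem_Icc k x).1]

theorem isTestFunction_div (h : IsApprox s lo hi m g M G) (hlo : 0 < 1 + lo) (k : ℕ)
    {Ω : Set (Sp n)} {ψ : Sp n → ℝ} (hψ : IsTestFunction Ω ψ) :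
    IsTestFunction Ω fun x => (1 + M k x)⁻¹ * ψ x :=
  hψ.mul_left ((contDiff_const.add (h.contDiff k)).inv fun x => (h.pos hlo k x).ne')

/-- The Liouville reduction tested with ψ/(1 + M_k), which is a test function since 1 + M_k is
smooth and positive. The coefficient cancels from the zeroth order term. -/
theorem pairing_div (h : IsApprox s lo hi m g M G) (hs0 : 0 < s) (hs1 : s < 1)
    (hsn : 2 * s < n) (hn : 0 < n) (hlo : 0 < 1 + lo) (k : ℕ)
    {Ω : Set (Sp n)} {ψ : Sp n → ℝ} (hψ : IsTestFunction Ω ψ) {Φ : Hs n s} (hΦ : Φ =ᵐ[volume] ψ)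
    {u : Sp n → ℝ} (hu : IsHs s u) {U : Hs n s} (hU : U =ᵐ[volume] fun x => (1 + M k x) * u x) :
    fracLaplacianPairing U Φ
      = halfConst n s * dqForm s (fun x => 1 + M k x) u (fun x => (1 + M k x)⁻¹ * ψ x)
        + ∫ x, G k x * (u x * ψ x) := by
  have hd := (h.isTestFunction_div hlo k hψ).isHs hs0 hs1 hn
  rw [h.pairing_smooth hs0 hs1 hsn hn 1 k hu hd hU]
  · congr 2
    ext x
    have := (h.pos hlo k x).ne'
    field_simp
  · filter_upwards [hΦ] with x hx
    have := (h.pos hlo k x).ne'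
    rw [hx]
    field_simp

/-- The energy of `ψ / (1 + M k)`. -/
theorem energy_div_le (h : IsApprox s lo hi m g M G) (hs0 : 0 < s) (hs1 : s < 1)
    (hsn : 2 * s < n) (hn : 0 < n) (hlo : 0 < 1 + lo) (k : ℕ)
    {Ω : Set (Sp n)} {ψ : Sp n → ℝ} (hψ : IsTestFunction Ω ψ) {Φ : Hs n s} (hΦ : Φ =ᵐ[volume] ψ) :
    (1 + lo) ^ 2 * (halfConst n s * ∫ z, diffq s (fun x => (1 + M k x)⁻¹ * ψ x) z ^ 2 ∂vol2 n)
      ≤ fracLaplacianPairing Φ Φ - ∫ x, G k x * ((1 + M k x)⁻¹ * (ψ x * ψ x)) := by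
  have hκ := halfConst_pos (n := n) hs0 hs1
  have hd := (h.isTestFunction_div hlo k hψ).isHs hs0 hs1 hn
  have e := h.pairing_div hs0 hs1 hsn hn hlo k hψ hΦ hd (U := Φ) (by
    filter_upwards [hΦ] with x hx
    have := (h.pos hlo k x).ne'
    rw [hx]
    field_simp)
  have e2 : ∫ x, G k x * ((1 + M k x)⁻¹ * (ψ x * ψ x))
      = ∫ x, G k x * ((1 + M k x)⁻¹ * ψ x * ψ x) := by
    congr 1; ext x; ring
  rw [e, e2, add_sub_cancel_right, mul_left_comm]
  refine mul_le_mul_of_nonneg_left ?_ hκ.le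
  rw [← integral_const_mul]
  refine integral_mono (hd.memLp_diffq.integrable_sq.const_mul _)
    (integrable_dqForm (h.const k).aestronglyMeasurable_one_add (h.const k).ae_abs_one_add_le hd hd)
    fun z => ?_
  simp only
  rw [← sq]
  refine mul_le_mul_of_nonneg_right ?_ (sq_nonneg _)
  rw [sq]
  exact mul_le_mul (by linarith [(h.mem_Icc k z.1).1]) (by linarith [(h.mem_Icc k z.2).1]) hlo.le
    (h.pos hlo k z.1).le

theorem exists_eLpNorm_bound (h : IsApprox s lo hi m g M G) (hs0 : 0 < s) (hsn : 2 * s < n) :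
    ∃ N : ℝ, 0 ≤ N ∧ ∀ k, (eLpNorm (G k) (critExp n s) volume).toReal ≤ N := by
  have hlim := (ENNReal.tendsto_toReal ENNReal.zero_ne_top).comp h.tendsto
  obtain ⟨N, hN⟩ := hlim.bddAbove_range
  refine ⟨(eLpNorm g (critExp n s) volume).toReal + N, ?_, fun k => ?_⟩
  · exact add_nonneg ENNReal.toReal_nonneg (ENNReal.toReal_nonneg.trans (hN ⟨0, rfl⟩))
  · have hd : MemLp (fun x => G k x - g x) (critExp n s) := (h.isFracLaplacian k).1.sub h.memLp
    have h1 : eLpNorm (G k) (critExp n s) volume ≤ eLpNorm g (critExp n s) volume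
        + eLpNorm (fun x => G k x - g x) (critExp n s) volume := by
      refine le_trans (le_of_eq ?_) (eLpNorm_add_le h.memLp.1 hd.1 (one_le_critExp hs0 hsn))
      congr 1
      ext x
      simp
    refine (ENNReal.toReal_mono (ENNReal.add_ne_top.2 ⟨h.memLp.2.ne, hd.2.ne⟩) h1).trans ?_
    rw [ENNReal.toReal_add h.memLp.2.ne hd.2.ne]
    exact add_le_add le_rfl (hN ⟨k, rfl⟩)

/-- With u = Φ/(1 + M_k) the right side dominates (1+lo)² times the energy of u. Poincaré bounds the
norm of u by this energy, and multiplication by 1 + M_k, bounded uniformly in k, returns to Φ. No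
sign or smallness of the potential is involved. -/
theorem exists_coercive_smooth (h : IsApprox s lo hi m g M G) (hs0 : 0 < s) (hs1 : s < 1)
    (hsn : 2 * s < n) (hn : 0 < n) (hlo : 0 < 1 + lo) {Ω : Set (Sp n)}
    (hΩ : Bornology.IsBounded Ω) :
    ∃ δ : ℝ, 0 < δ ∧ ∀ (k : ℕ) (ψ : Sp n → ℝ) (Φ : Hs n s), IsTestFunction Ω ψ → Φ =ᵐ[volume] ψ →
      δ * ‖Φ‖ ^ 2 ≤ fracLaplacianPairing Φ Φ - ∫ x, G k x * ((1 + M k x)⁻¹ * (ψ x * ψ x)) := by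
  have hκ := halfConst_pos (n := n) hs0 hs1
  obtain ⟨K, hK, hle⟩ := exists_norm_mul_le (n := n) hs0 hs1 hsn hn lo hi
  obtain ⟨N, hN0, hN⟩ := h.exists_eLpNorm_bound hs0 hsn
  obtain ⟨P, hP, hPoin⟩ := exists_poincare (n := n) hs0 hn hΩ
  set L := K * (1 + N) * (P / halfConst n s + 1) with hL
  have hL0 : 0 < L := by positivity
  refine ⟨(1 + lo) ^ 2 / L, by positivity, fun k ψ Φ hψ hΦ => ?_⟩
  refine le_trans ?_ (h.energy_div_le hs0 hs1 hsn hn hlo k hψ hΦ)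
  have htest := h.isTestFunction_div hlo k hψ
  have hd := htest.isHs hs0 hs1 hn
  set u : Hs n s := hd.toHs hs0 hs1 hn
  have hu : u =ᵐ[volume] fun x => (1 + M k x)⁻¹ * ψ x := hd.coeFn_toHs hs0 hs1 hn
  set E := ∫ z, diffq s (fun x => (1 + M k x)⁻¹ * ψ x) z ^ 2 ∂vol2 n with hE
  have h1 := hle (h.const k) u Φ (by
    filter_upwards [hΦ, hu] with x hx hx2
    have := (h.pos hlo k x).ne'
    rw [hx, hx2]
    field_simp)
  have h2 := Hs.norm_sq_le hs0 hs1 hn u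
  have e1 : ∫ x, u x ^ 2 = ∫ x, ((1 + M k x)⁻¹ * ψ x) ^ 2 :=
    integral_congr_ae (by filter_upwards [hu] with x hx; rw [hx])
  have e2 : ∫ z, diffq s u z ^ 2 ∂vol2 n = E :=
    integral_congr_ae (by filter_upwards [diffq_congr_ae s hu] with x hx; rw [hx])
  have h3 := hPoin _ hd (.of_forall fun x hx => htest.eq_zero hx)
  rw [e1, e2] at h2
  have h4 : ‖u‖ ^ 2 ≤ (P / halfConst n s + 1) * (halfConst n s * E) := by
    have : (P / halfConst n s + 1) * (halfConst n s * E) = P * E + halfConst n s * E := by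
      field_simp
    linarith
  have h5 : ‖Φ‖ ^ 2 ≤ L * (halfConst n s * E) := by
    refine h1.trans ?_
    rw [hL, mul_assoc (K * (1 + N))]
    exact mul_le_mul (mul_le_mul_of_nonneg_left (by linarith [hN k]) hK.le) h4 (sq_nonneg _)
      (by positivity)
  rw [div_mul_eq_mul_div, div_le_iff₀ hL0]
  nlinarith [sq_nonneg (1 + lo)]

theorem tendsto_inv (h : IsApprox s lo hi m g M G) (hlo : 0 < 1 + lo) :
    ∀ᵐ x, Filter.Tendsto (fun k => (1 + M k x)⁻¹) Filter.atTop (𝓝 (1 + m x)⁻¹) := by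
  filter_upwards [h.tendsto_ae, h.ae_le_one_add] with x hx hx2
  exact (hx.const_add 1).inv₀ (by linarith)

theorem tendsto_integral_inv (h : IsApprox s lo hi m g M G) (hs0 : 0 < s) (hs1 : s < 1)
    (hsn : 2 * s < n) (hn : 0 < n) (hlo : 0 < 1 + lo) {u v : Sp n → ℝ} (hu : IsHs s u)
    (hv : IsHs s v) : Filter.Tendsto (fun k => ∫ x, G k x * ((1 + M k x)⁻¹ * (u x * v x)))
      Filter.atTop (𝓝 (∫ x, g x * ((1 + m x)⁻¹ * (u x * v x)))) := by
  refine tendsto_integral_mul_mul hs0 hs1 hsn hn h.memLp (fun k => (h.isFracLaplacian k).1)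
    h.tendsto (b := (1 + lo)⁻¹) (fun k => ?_) (fun k => .of_forall fun x => ?_)
    (h.tendsto_inv hlo) hu hv
  · exact ((continuous_const.add (h.contDiff k).continuous).inv₀
      fun x => (h.pos hlo k x).ne').aestronglyMeasurable
  · rw [abs_of_pos (inv_pos.2 (h.pos hlo k x))]
    exact inv_anti₀ hlo (by linarith [(h.mem_Icc k x).1])

/-- The constant of `exists_coercive_smooth` does not depend on k, so for fixed ψ the limit k → ∞
can be taken. This avoids showing that ψ/(1 + m) lies in `H^s`. -/
theorem exists_coercive (h : IsApprox s lo hi m g M G) (hs0 : 0 < s) (hs1 : s < 1)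
    (hsn : 2 * s < n) (hn : 0 < n) (hlo : 0 < 1 + lo) {Ω : Set (Sp n)}
    (hΩ : Bornology.IsBounded Ω) :
    ∃ δ : ℝ, 0 < δ ∧ ∀ (ψ : Sp n → ℝ) (Φ : Hs n s), IsTestFunction Ω ψ → Φ =ᵐ[volume] ψ →
      δ * ‖Φ‖ ^ 2 ≤ fracLaplacianPairing Φ Φ - ∫ x, g x * ((1 + m x)⁻¹ * (ψ x * ψ x)) := by
  obtain ⟨δ, hδ, hk⟩ := h.exists_coercive_smooth hs0 hs1 hsn hn hlo hΩ
  refine ⟨δ, hδ, fun ψ Φ hψ hΦ => ?_⟩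
  have hH := hψ.isHs hs0 hs1 hn
  exact ge_of_tendsto' ((h.tendsto_integral_inv hs0 hs1 hsn hn hlo hH hH).const_sub _)
    fun k => hk k ψ Φ hψ hΦ

end IsApprox

/-! ### The Dirichlet-to-Neumann maps -/

theorem exists_schrBilin (hs0 : 0 < s) (hs1 : s < 1) (hsn : 2 * s < n) (hn : 0 < n)
    {Ω : Set (Sp n)} (hΩ : MeasurableSet Ω) {q : Sp n → ℝ} (hq : MemLp q (critExp n s)) :
    ∃ A : Hs n s →L[ℝ] Hs n s →L[ℝ] ℝ, ∀ w v, A w v = schrForm q Ω w v := by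
  obtain ⟨B, hB⟩ := exists_pairingBilin (n := n) hs0 hs1 hn
  obtain ⟨B', hB'⟩ := exists_mulBilin hs0 hsn hn (hq.indicator hΩ)
  refine ⟨B + B', fun w v => ?_⟩
  rw [schrForm, add_apply, add_apply, hB, hB', ← integral_indicator hΩ]
  congr 2
  ext x
  by_cases hx : x ∈ Ω
  · simp only [Set.indicator_of_mem hx]; ring
  · simp only [Set.indicator_of_notMem hx, zero_mul]

theorem one_add_mOf (γ : Sp n → ℝ) (x : Sp n) : 1 + mOf γ x = √(γ x) := by
  rw [mOf]; ring

/-- Truncation of a function to a set and to an interval. -/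
theorem exists_truncation {Ω : Set (Sp n)} (hΩ : Bornology.IsBounded Ω) {m : Sp n → ℝ}
    (hm : Measurable m) {lo hi : ℝ} (hlo : lo ≤ 0) (hhi : 0 ≤ hi)
    (hb : ∀ᵐ x, m x ∈ Set.Icc lo hi) (hz : ∀ᵐ x, x ∉ closure Ω → m x = 0) :
    ∃ m' : Sp n → ℝ, Measurable m' ∧ m' =ᵐ[volume] m ∧ (∀ x, m' x ∈ Set.Icc lo hi) ∧
      HasCompactSupport m' := by
  classical
  have hS : MeasurableSet (closure Ω ∩ m ⁻¹' Set.Icc lo hi) :=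
    isClosed_closure.measurableSet.inter (hm measurableSet_Icc)
  refine ⟨(closure Ω ∩ m ⁻¹' Set.Icc lo hi).indicator m, hm.indicator hS, ?_, fun x => ?_, ?_⟩
  · filter_upwards [hb, hz] with x h1 h2
    by_cases hx : x ∈ closure Ω
    · have hxS : x ∈ closure Ω ∩ m ⁻¹' Set.Icc lo hi := ⟨hx, h1⟩
      rw [Set.indicator_of_mem hxS]
    · rw [Set.indicator_of_notMem (fun h => hx h.1), h2 hx]
  · by_cases hx : x ∈ closure Ω ∩ m ⁻¹' Set.Icc lo hi
    · rw [Set.indicator_of_mem hx]; exact hx.2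
    · rw [Set.indicator_of_notMem hx]; exact ⟨hlo, hhi⟩
  · refine HasCompactSupport.intro hΩ.isCompact_closure fun x hx => ?_
    exact Set.indicator_of_notMem (fun h => hx h.1) m

theorem IsApprox.congr {lo hi : ℝ} {m m' g : Sp n → ℝ} {M G : ℕ → Sp n → ℝ}
    (h : IsApprox s lo hi m g M G) (e : m =ᵐ[volume] m') : IsApprox s lo hi m' g M G :=
  { h with
    tendsto_ae := by
      filter_upwards [h.tendsto_ae, e] with x hx hx2
      rwa [← hx2] }

theorem MemSobolevC.congr {k : ℝ} {p : ℝ≥0∞} {Ω : Set (Sp n)} {m m' : Sp n → ℝ}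
    (h : MemSobolevC k p Ω m) (e : m =ᵐ[volume] m') : MemSobolevC k p Ω m' := by
  obtain ⟨hp, M, hM, h1, h2⟩ := h
  refine ⟨hp, M, ?_, h1, h2⟩
  filter_upwards [hM, e] with x hx hx2
  rw [hx, hx2]

/-- The fractional Laplacian of `m` exists and `m` can be approximated by smooth functions. -/
theorem exists_isApprox_mOf (hs0 : 0 < s) (hs1 : s < 1) (hsn : 2 * s < n) {Ω : Set (Sp n)}
    (hΩ : Bornology.IsBounded Ω) {γ : Sp n → ℝ} (hγ : Measurable γ)
    (hγb : ∃ a b : ℝ, 0 < a ∧ ∀ᵐ x ∂(volume : Measure (Sp n)), a ≤ γ x ∧ γ x ≤ b)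
    (hm : MemSobolevC (2 * s) (critExp n s) Ω (mOf γ)) :
    IsFracLaplacian s (critExp n s) (mOf γ) (fracLaplacianM s γ) ∧
      ∃ lo hi M G, 0 < 1 + lo ∧ IsApprox s lo hi (mOf γ) (fracLaplacianM s γ) M G := by
  obtain ⟨a, b, ha, hab⟩ := hγb
  -- The interval is widened to contain 0, so that setting m to 0 off the closure of Ω respects the
  -- bounds; `lo` stays above -1 because √a > 0.
  set lo := min (√a - 1) 0 with hlo
  set hi := max (√b - 1) 0 with hhi
  have hlo1 : 0 < 1 + lo := by
    have := Real.sqrt_pos.2 ha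
    rcases min_choice (√a - 1) 0 with h | h <;> rw [hlo, h] <;> linarith
  have hmm : Measurable (mOf γ) := hγ.sqrt.sub_const 1
  have hIcc : ∀ᵐ x, mOf γ x ∈ Set.Icc lo hi := by
    filter_upwards [hab] with x hx
    exact ⟨(min_le_left _ _).trans (sub_le_sub_right (Real.sqrt_le_sqrt hx.1) 1),
      (sub_le_sub_right (Real.sqrt_le_sqrt hx.2) 1).trans (le_max_left _ _)⟩
  obtain ⟨m', hm'm, e, hIcc', hc⟩ := exists_truncation hΩ hmm (min_le_right _ _)
    (le_max_right _ _) hIcc hm.ae_eq_zero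
  have hbd : ∀ x, |m' x| ≤ max |lo| |hi| := fun x => abs_le_max_abs_abs (hIcc' x).1 (hIcc' x).2
  have him : Integrable m' := by
    rw [← integrableOn_iff_integrable_of_support_subset (subset_tsupport m')]
    exact Measure.integrableOn_of_bounded (M := max |lo| |hi|) hc.isCompact.measure_lt_top.ne
      hm'm.aestronglyMeasurable (.of_forall hbd)
  obtain ⟨g, hg⟩ := exists_isFracLaplacian hs0 hs1 hsn hm'm him hbd (hm.congr e.symm)
  -- The Laplacian `fracLaplacianM` is a choice, so existence suffices; the approximation below is
  -- made for this chosen function.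
  have hF : IsFracLaplacian s (critExp n s) (mOf γ) (fracLaplacianM s γ) :=
    Classical.epsilon_spec (p := IsFracLaplacian s (critExp n s) (mOf γ))
      ⟨g, hg.congr e (.refl _ _)⟩
  obtain ⟨M, G, hMG⟩ := exists_isApprox hs0 hs1 hsn hm'm hIcc' hc (hF.congr e.symm (.refl _ _))
  exact ⟨hF, lo, hi, M, G, hlo1, hMG.congr e⟩

/-! ### The conductivity and Schrödinger forms on H̃^s(Ω). -/

section Forms

variable {lo hi : ℝ} {γ g : Sp n → ℝ} {M G : ℕ → Sp n → ℝ}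

theorem IsApprox.memLp_potential (h : IsApprox s lo hi (mOf γ) g M G) (hlo : 0 < 1 + lo)
    (hγ : Measurable γ) : MemLp (fun x => -g x / √(γ x)) (critExp n s) := by
  have h1 : MemLp (fun x => (√(γ x))⁻¹ * -g x) (critExp n s) := by
    refine memLp_bdd_mul h.memLp.neg hγ.sqrt.inv.aestronglyMeasurable (b := (1 + lo)⁻¹) ?_
    filter_upwards [h.ae_le_one_add] with x hx
    rw [one_add_mOf] at hx
    rw [abs_of_nonneg (by positivity)]
    exact inv_anti₀ hlo hx
  refine (memLp_congr_ae (.of_forall fun x => ?_)).1 h1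
  ring

theorem setIntegral_eq_integral_of_ae_zero {S : Set (Sp n)} {f : Sp n → ℝ}
    (h : ∀ᵐ x, x ∉ S → f x = 0) : ∫ x in S, f x = ∫ x, f x :=
  setIntegral_eq_integral_of_ae_compl_eq_zero h

/-- As 1 + m = √γ, on test functions the form is the one in `exists_coercive`; it extends to H̃^s(Ω)
by density and continuity. -/
theorem IsApprox.schr_coercive (h : IsApprox s lo hi (mOf γ) g M G) (hs0 : 0 < s) (hs1 : s < 1)
    (hsn : 2 * s < n) (hn : 0 < n) (hlo : 0 < 1 + lo) {Ω : Set (Sp n)}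
    (hΩ : Bornology.IsBounded Ω) {A : Hs n s →L[ℝ] Hs n s →L[ℝ] ℝ}
    (hA : ∀ w v, A w v = schrForm (fun x => -g x / √(γ x)) Ω w v) :
    ∃ δ : ℝ, 0 < δ ∧ ∀ φ ∈ Htilde s Ω, δ * ‖φ‖ ^ 2 ≤ A φ φ := by
  obtain ⟨δ, hδ, hc⟩ := h.exists_coercive hs0 hs1 hsn hn hlo hΩ
  refine ⟨δ, hδ, fun φ hφ => ?_⟩
  have hcont : Continuous fun φ : Hs n s => A φ φ :=
    A.isBoundedBilinearMap.continuous.comp (continuous_id.prodMk continuous_id)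
  refine Htilde_induction (P := fun φ => δ * ‖φ‖ ^ 2 ≤ A φ φ)
    (isClosed_le (by fun_prop) hcont) (fun Φ ψ hψ hΦ => ?_) hφ
  refine (hc ψ Φ hψ hΦ).trans (le_of_eq ?_)
  rw [hA, schrForm, sub_eq_add_neg, ← integral_neg, setIntegral_eq_integral_of_ae_zero]
  · congr 1
    refine integral_congr_ae ?_
    filter_upwards [hΦ] with x hx
    rw [hx, one_add_mOf]
    ring
  · filter_upwards [hΦ] with x hx hxΩ
    rw [hx, hψ.eq_zero hxΩ, mul_zero]

/-- Ellipticity √γ ≥ 1 + lo > 0 and the Poincaré inequality, valid because elements of H̃^s(Ω)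
vanish outside Ω. -/
theorem IsApprox.cond_coercive (h : IsApprox s lo hi (mOf γ) g M G) (hs0 : 0 < s) (hs1 : s < 1)
    (hn : 0 < n) (hlo : 0 < 1 + lo) {Ω : Set (Sp n)}
    (hΩ : Bornology.IsBounded Ω) {B : Hs n s →L[ℝ] Hs n s →L[ℝ] ℝ}
    (hB : ∀ u v, B u v = halfConst n s * dqForm s (fun x => 1 + mOf γ x) u v) :
    ∃ δ : ℝ, 0 < δ ∧ ∀ φ ∈ Htilde s Ω, δ * ‖φ‖ ^ 2 ≤ B φ φ := by
  have hκ := halfConst_pos (n := n) hs0 hs1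
  obtain ⟨P, hP, hPoin⟩ := exists_poincare (n := n) hs0 hn hΩ
  refine ⟨(1 + lo) ^ 2 / (P / halfConst n s + 1), by positivity, fun φ hφ => ?_⟩
  have hH := φ.isHs hs0 hs1 hn
  have h1 := hPoin φ hH (Htilde_ae_eq_zero hs0 hφ)
  have h2 := Hs.norm_sq_le hs0 hs1 hn φ
  set E := ∫ z, diffq s φ z ^ 2 ∂vol2 n
  have h3 : (1 + lo) ^ 2 * E ≤ dqForm s (fun x => 1 + mOf γ x) φ φ := by
    rw [← integral_const_mul]
    refine integral_mono_ae (hH.memLp_diffq.integrable_sq.const_mul _)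
      (integrable_dqForm h.aestronglyMeasurable_one_add h.ae_abs_one_add_le hH hH) ?_
    filter_upwards [ae_vol2_of_ae h.ae_le_one_add] with z hz
    rw [← sq, sq (1 + lo)]
    exact mul_le_mul_of_nonneg_right (mul_le_mul hz.1 hz.2 hlo.le (hlo.le.trans hz.1)) (sq_nonneg _)
  rw [hB, div_mul_eq_mul_div, div_le_iff₀ (by positivity)]
  have h4 : ‖φ‖ ^ 2 ≤ (P / halfConst n s + 1) * (halfConst n s * E) := by
    have : (P / halfConst n s + 1) * (halfConst n s * E) = P * E + halfConst n s * E := by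
      field_simp
    linarith
  calc (1 + lo) ^ 2 * ‖φ‖ ^ 2 ≤ (1 + lo) ^ 2 * ((P / halfConst n s + 1) * (halfConst n s * E)) :=
        mul_le_mul_of_nonneg_left h4 (sq_nonneg _)
    _ = halfConst n s * ((1 + lo) ^ 2 * E) * (P / halfConst n s + 1) := by ring
    _ ≤ _ := by gcongr

/-- If `u` is a weak solution of the conductivity equation, `(1 + m) u` is one of the Schrödinger
equation. -/
theorem IsApprox.schrForm_eq_zero (h : IsApprox s lo hi (mOf γ) g M G) (hs0 : 0 < s) (hs1 : s < 1)
    (hsn : 2 * s < n) (hn : 0 < n) (hlo : 0 < 1 + lo) {Ω : Set (Sp n)} {A : Hs n s →L[ℝ] Hs n s →L[ℝ] ℝ}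
    (hA : ∀ w v, A w v = schrForm (fun x => -g x / √(γ x)) Ω w v) {u W : Hs n s}
    (hW : W =ᵐ[volume] fun x => (1 + mOf γ x) * u x)
    (hu : ∀ φ ∈ Htilde s Ω, halfConst n s * dqForm s (fun x => 1 + mOf γ x) u φ = 0)
    {φ : Hs n s} (hφ : φ ∈ Htilde s Ω) : A W φ = 0 := by
  refine Htilde_induction (P := fun φ => A W φ = 0)
    (isClosed_eq (A W).continuous continuous_const) (fun Φ ψ hψ hΦ => ?_) hφ
  have hκ := halfConst_pos (n := n) hs0 hs1
  have hu' := u.isHs hs0 hs1 hn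
  have hψ' := hψ.isHs hs0 hs1 hn
  obtain ⟨B, hB⟩ := exists_pairingBilin (n := n) hs0 hs1 hn
  let U := fun k => (h.isHs_const_add_mul_smooth hs0 hs1 hn 1 k hu').toHs hs0 hs1 hn
  have hU : ∀ k, U k =ᵐ[volume] fun x => (1 + M k x) * u x := fun k => IsHs.coeFn_toHs _ _ _ _
  have tU := h.tendsto_mul hs0 hs1 hsn hn hu' hU hW
  have L1 := tendsto_bilin B tU (tendsto_const_nhds (x := Φ))
  have L2 : Filter.Tendsto (fun k => ∫ x, G k x * (u x * ψ x)) Filter.atTop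
      (𝓝 (∫ x, g x * (u x * ψ x))) := by
    have := tendsto_integral_mul_mul hs0 hs1 hsn hn h.memLp (fun k => (h.isFracLaplacian k).1)
      h.tendsto (c := fun _ => 1) (c' := fun _ _ => 1) (b := 1)
      (fun k => aestronglyMeasurable_const) (fun k => .of_forall fun x => by simp)
      (.of_forall fun x => tendsto_const_nhds) hu' hψ'
    simpa using this
  -- The natural test function for the conductivity equation would be ψ/(1 + m); the functions T_k
  -- replace it and are genuine test functions.
  set T : ℕ → Sp n → ℝ := fun k x => (1 + M k x)⁻¹ * ψ x
  have hT : ∀ k, IsTestFunction Ω (T k) := fun k => h.isTestFunction_div hlo k hψ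
  have hTH : ∀ k, IsHs s (T k) := fun k => (hT k).isHs hs0 hs1 hn
  have hzero : ∀ k, dqForm s (fun x => 1 + mOf γ x) u (T k) = 0 := by
    intro k
    have e := (hTH k).coeFn_toHs hs0 hs1 hn
    have hmem : (hTH k).toHs hs0 hs1 hn ∈ Htilde s Ω :=
      Submodule.le_topologicalClosure _ ⟨T k, hT k, e⟩
    have h0 := (mul_eq_zero.1 (hu _ hmem)).resolve_left hκ.ne'
    rw [← h0]
    refine integral_congr_ae ?_
    filter_upwards [diffq_congr_ae s e] with z hz
    rw [hz]
  -- Subtract the form with coefficient 1 + m, which vanishes at T_k because u is a solution. By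
  -- Cauchy–Schwarz the rest is the `L²` norm of the coefficient difference times Du, which tends to
  -- 0 by dominated convergence, times the square root of the energy of T_k, which is bounded by
  -- `energy_div_le`.
  have L3 : Filter.Tendsto (fun k => dqForm s (fun x => 1 + M k x) u (T k)) Filter.atTop (𝓝 0) := by
    obtain ⟨R, hR⟩ := ((h.tendsto_integral_inv hs0 hs1 hsn hn hlo hψ' hψ').const_sub
      (fracLaplacianPairing Φ Φ)).bddAbove_range
    have hE : ∀ k, ∫ z, diffq s (T k) z ^ 2 ∂vol2 n ≤ R / ((1 + lo) ^ 2 * halfConst n s) := by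
      intro k
      rw [le_div_iff₀ (by positivity)]
      refine le_trans (le_of_eq ?_)
        ((h.energy_div_le hs0 hs1 hsn hn hlo k hψ hΦ).trans (hR ⟨k, rfl⟩))
      ring
    set β := 1 + max |lo| |hi|
    have hd : ∀ k, MemLp (fun z => ((1 + M k z.1) * (1 + M k z.2)
        - (1 + mOf γ z.1) * (1 + mOf γ z.2)) * diffq s u z) 2 (vol2 n) := by
      intro k
      have ha := (h.const k).aestronglyMeasurable_one_add
      refine memLp_bdd_mul hu'.memLp_diffq ((aestronglyMeasurable_prod_mul ha).sub
        (aestronglyMeasurable_prod_mul h.aestronglyMeasurable_one_add)) (b := β ^ 2 + β ^ 2) ?_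
      filter_upwards [ae_abs_prod_mul_le (h.const k).ae_abs_one_add_le,
        ae_abs_prod_mul_le h.ae_abs_one_add_le] with z h1 h2
      exact (abs_sub _ _).trans (add_le_add h1 h2)
    have L5 : Filter.Tendsto (fun k => ∫ z, (((1 + M k z.1) * (1 + M k z.2)
        - (1 + mOf γ z.1) * (1 + mOf γ z.2)) * diffq s u z) ^ 2 ∂vol2 n) Filter.atTop
        (𝓝 (∫ z : Sp n × Sp n, (0 : ℝ) ∂vol2 n)) := by
      refine tendsto_integral_of_dominated_convergence
        (fun z => (β ^ 2 + β ^ 2) ^ 2 * diffq s u z ^ 2) (fun k => (hd k).1.pow 2)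
        (hu'.memLp_diffq.integrable_sq.const_mul _) (fun k => ?_) ?_
      · filter_upwards [ae_abs_prod_mul_le (h.const k).ae_abs_one_add_le,
          ae_abs_prod_mul_le h.ae_abs_one_add_le] with z h1 h2
        rw [Real.norm_of_nonneg (sq_nonneg _), mul_pow]
        refine mul_le_mul_of_nonneg_right ?_ (sq_nonneg _)
        have h3 := _root_.abs_le.1 ((abs_sub _ _).trans (add_le_add h1 h2))
        exact sq_le_sq' h3.1 h3.2
      · filter_upwards [ae_vol2_of_ae h.tendsto_ae] with z hz
        have := ((((hz.1.const_add 1).mul (hz.2.const_add 1)).sub_const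
          ((1 + mOf γ z.1) * (1 + mOf γ z.2))).mul_const (diffq s u z)).pow 2
        simpa using this
    rw [integral_zero] at L5
    refine squeeze_zero_norm (fun k => ?_)
      (by simpa using L5.sqrt.mul_const √(R / ((1 + lo) ^ 2 * halfConst n s)))
    have e : dqForm s (fun x => 1 + M k x) u (T k) = ∫ z, (((1 + M k z.1) * (1 + M k z.2)
        - (1 + mOf γ z.1) * (1 + mOf γ z.2)) * diffq s u z) * diffq s (T k) z ∂vol2 n := by
      rw [← sub_zero (dqForm s (fun x => 1 + M k x) u (T k)), ← hzero k]
      refine Eq.trans (integral_sub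
        (integrable_dqForm (h.const k).aestronglyMeasurable_one_add
          (h.const k).ae_abs_one_add_le hu' (hTH k))
        (integrable_dqForm h.aestronglyMeasurable_one_add h.ae_abs_one_add_le hu' (hTH k))).symm ?_
      congr 1
      ext z
      ring
    rw [e]
    refine (norm_integral_le_integral_norm _).trans
      ((integral_abs_mul_le_sqrt (hd k) (hTH k).memLp_diffq).trans ?_)
    exact mul_le_mul_of_nonneg_left (Real.sqrt_le_sqrt (hE k)) (Real.sqrt_nonneg _)
  have L4 : B W Φ = halfConst n s * 0 + ∫ x, g x * (u x * ψ x) := by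
    refine tendsto_nhds_unique L1 (((L3.const_mul (halfConst n s)).add L2).congr fun k => ?_)
    exact ((hB _ _).trans (h.pairing_div hs0 hs1 hsn hn hlo k hψ hΦ hu' (hU k))).symm
  rw [hA, schrForm, ← hB, L4, mul_zero, zero_add, setIntegral_eq_integral_of_ae_zero]
  · rw [← sub_neg_eq_add, ← integral_neg, sub_eq_zero]
    refine integral_congr_ae ?_
    filter_upwards [hΦ, hW, h.ae_le_one_add] with x h1 h2 h3
    rw [h1, h2, one_add_mOf]
    rw [one_add_mOf] at h3
    have : √(γ x) ≠ 0 := by linarith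
    field_simp
  · filter_upwards [hΦ] with x hx hxΩ
    rw [hx, hψ.eq_zero hxΩ]
    ring

end Forms

/-! ### Supports up to null sets, and the conclusion. -/

theorem ae_eq_zero_of_aeSupport {f : Sp n → ℝ} {S : Set (Sp n)} (h : aeSupport f ⊆ Sᶜ) :
    ∀ᵐ x, x ∈ S → f x = 0 := by
  have h0 : volume {x | x ∈ S ∧ f x ≠ 0} = 0 := by
    refine measure_null_of_locally_null _ fun x hx => ?_
    have hx' : x ∉ aeSupport f := fun h' => h h' hx.1
    simp only [aeSupport, Set.mem_ofPred_eq, not_forall, not_not] at hx'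
    obtain ⟨U, hU, hae⟩ := hx'
    refine ⟨{x | x ∈ S ∧ f x ≠ 0} ∩ U, Filter.inter_mem self_mem_nhdsWithin
      (mem_nhdsWithin_of_mem_nhds hU), ?_⟩
    refine measure_mono_null ?_ hae
    exact fun y hy hy' => hy.1.2 (hy' hy.2)
  refine measure_mono_null ?_ h0
  intro x hx
  simpa using hx

end FracCalderon

end

theorem lemma3p4 (n : ℕ) (s : ℝ) (hs0 : 0 < s) (hs1 : s < 1) (hsn : 2 * s < n)
    (Ω : Set (Sp n)) (hΩ : IsOpen Ω) (hΩb : Bornology.IsBounded Ω)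
    (γ : Sp n → ℝ) (hγ : Measurable γ)
    (hγb : ∃ a b : ℝ, 0 < a ∧ ∀ᵐ x ∂(volume : Measure (Sp n)), a ≤ γ x ∧ γ x ≤ b)
    (hm : MemSobolevC (2 * s) (critExp n s) Ω (mOf γ)) :
    IsFracLaplacian s (critExp n s) (mOf γ)
      (fracLaplacianM s γ) ∧
    IsCondDN γ Ω (condDN s γ Ω) ∧
    IsSchrDN (potential s γ) Ω
      (schrDN s (potential s γ) Ω) ∧
    ∀ f v : Hs n s,
      aeSupport f ⊆ exterior Ω →
      aeSupport v ⊆ exterior Ω →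
      IntegrableOn (fun x => f x * v x * fracLaplacianM s γ x)
        (exterior Ω) volume ∧
      schrDN s (potential s γ) Ω
          (trace s Ω f) (trace s Ω v)
        - condDN s γ Ω (trace s Ω f) (trace s Ω v)
        = ∫ x in exterior Ω, f x * v x * fracLaplacianM s γ x := by
  have hn : 0 < n := by
    have h : (0 : ℝ) < n := by linarith
    exact_mod_cast h
  obtain ⟨hF, lo, hi, M, G, hlo, h⟩ := exists_isApprox_mOf hs0 hs1 hsn hΩb hγ hγb hm
  have hq := h.memLp_potential hlo hγ
  obtain ⟨A, hA⟩ := exists_schrBilin hs0 hs1 hsn hn hΩ.measurableSet hq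
  have hA' : ∀ w v : Hs n s, A w v = schrForm (potential s γ) Ω w v := hA
  obtain ⟨B, hB, -⟩ := exists_dqBilin (n := n) hs0 hs1 hn h.aestronglyMeasurable_one_add
    h.ae_abs_one_add_le
  have hB' : ∀ u v, B u v = condForm γ u v := fun u v => by
    rw [hB, condForm_eq hs0 hs1 hn hγ (by simpa only [one_add_mOf] using h.ae_abs_one_add_le)]
    simp only [one_add_mOf]
  have hcomp := Hs.completeSpace (n := n) hs0
  obtain ⟨δ, hδ, hAc⟩ := h.schr_coercive hs0 hs1 hsn hn hlo hΩb hA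
  obtain ⟨δ', hδ', hBc⟩ := h.cond_coercive hs0 hs1 hn hlo hΩb hB
  have hcond : IsCondDN γ Ω (condDN s γ Ω) := by
    refine Classical.epsilon_spec (p := IsCondDN (s := s) γ Ω) ?_
    have hΛ := exists_dn_of_coercive Hs.parallelogram (Htilde_isClosed s Ω) hδ' hBc
    simp only [hB'] at hΛ
    exact hΛ
  have hschr : IsSchrDN (potential s γ) Ω (schrDN s (potential s γ) Ω) := by
    refine Classical.epsilon_spec (p := IsSchrDN (s := s) (potential s γ) Ω) ?_
    have hΛ := exists_dn_of_coercive Hs.parallelogram (Htilde_isClosed s Ω) hδ hAc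
    simp only [hA'] at hΛ
    exact hΛ
  refine ⟨hF, hcond, hschr, fun f v hf hv => ?_⟩
  obtain ⟨C, -, hH⟩ := exists_holder hs0 hsn hn
  have hint : Integrable (fun x => f x * v x * fracLaplacianM s γ x) :=
    (hH _ hF.1 f v).1.congr (.of_forall fun x => by ring)
  refine ⟨hint.integrableOn, ?_⟩
  have hf0 := ae_eq_zero_of_aeSupport hf
  have hv0 := ae_eq_zero_of_aeSupport hv
  have hm0 := hm.ae_eq_zero
  obtain ⟨u, hu, hΛu⟩ := hcond f
  obtain ⟨w, hw, hΛw⟩ := hschr f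
  obtain ⟨hu1, hu2⟩ := (hu u).2 rfl
  obtain ⟨T, hT⟩ := h.exists_mulCLM hs0 hs1 hsn hn
  -- On the closure of Ω f is 0, off it m is 0. Working with the closure makes the measure of the
  -- boundary irrelevant.
  have hmf : T f = f := by
    refine Hs.ext_ae ?_
    filter_upwards [hT f, hm0, hf0] with x h1 h2 h3
    rw [h1]
    by_cases hx : x ∈ closure Ω
    · rw [h3 hx, mul_zero]
    · rw [h2 hx, add_zero, one_mul]
  -- The function √γ u has exterior value √γ f = f and solves the Schrödinger equation, so
  -- uniqueness identifies it with w_f.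
  have hw1 : T u = w := by
    refine (hw (T u)).1 ⟨?_, fun φ hφ => ?_⟩
    · have := h.mulCLM_mem_Htilde hs0 hs1 hsn hn hT hu1
      rwa [map_sub, hmf] at this
    · rw [← hA']
      refine h.schrForm_eq_zero hs0 hs1 hsn hn hlo hA (hT u) (fun ψ hψ => ?_) hφ
      rw [← hB, hB', hu2 ψ hψ]
  have hTv : v =ᵐ[volume] fun x => (1 + mOf γ x) * v x := by
    filter_upwards [hm0, hv0] with x h2 h3
    by_cases hx : x ∈ closure Ω
    · rw [h3 hx, mul_zero]
    · rw [h2 hx, add_zero, one_mul]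
  -- The Liouville reduction for u and v, where √γ v = v lets v itself be paired with w.
  have e := h.pairing_eq hs0 hs1 hsn hn 1 (u.isHs hs0 hs1 hn) (v.isHs hs0 hs1 hn) (hT u) hTv
  rw [← hB, hB', hw1] at e
  have ez : ∫ x in Ω, potential s γ x * v x * w x = 0 := by
    refine Eq.trans (setIntegral_congr_ae (g := fun _ => 0) hΩ.measurableSet ?_) (integral_zero _ _)
    filter_upwards [hv0] with x hx hxΩ
    rw [hx (subset_closure hxΩ)]
    ring
  rw [hΛw v, hΛu v, schrForm, ez, e, add_zero, add_sub_cancel_left,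
    setIntegral_eq_integral_of_ae_zero]
  -- On the closure of Ω both integrands vanish with v. Off it u = f, and the factor 1 + m is
  -- absorbed by v.
  · refine integral_congr_ae ?_
    filter_upwards [hTv, hv0, Htilde_ae_eq_zero hs0 hu1, Hs.coeFn_sub u f] with x h1 h2 h3 h4
    by_cases hx : x ∈ closure Ω
    · rw [h2 hx]; ring
    · have h5 := h3 fun hx' => hx (subset_closure hx')
      rw [h4, sub_eq_zero] at h5
      rw [← h5]
      calc fracLaplacianM s γ x * ((1 + mOf γ x) * (u x * v x))
          = fracLaplacianM s γ x * (u x * ((1 + mOf γ x) * v x)) := by ring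
        _ = _ := by rw [← h1]; ring
  · filter_upwards [hv0] with x hx hxΩ
    rw [hx (Set.notMem_compl_iff.1 hxΩ)]
    ring
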